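/- For a group $G$ with a finite symmetric generating set $X$ (finite, closed under inverses), write $\overline w\in G$ for the element represented by a word $w\in X^*$. A \emph{logspace normal form function} for $(G,X)$ is a function $f:X^*\to X^*$, computable by a deterministic transducer (read-only input tape, read-write work tape limited to $O(\log n)$ squares on inputs of length $n$, write-only output tape), for which there is a set $L\subseteq X^*$, mapped bijectively onto $G$ by $w\mapsto\overline w$, such that $f(w)\in L$ and $\overline{f(w)}=\overline w$ for all $w\in X^*$. If such an $f$ exists, $(G,X)$ has a \emph{logspace normal form}. \textbf{Proposition.} Let $G=\langle X\rangle$ and $H=\langle Y\rangle$ be groups with finite symmetric generating sets and logspace normal form functions $g_X$ and $h_Y$. Suppose that the word problem of the free product $G*H$ (with respect to some finite symmetric generating set) is decidable in logspace. Then $(G*H, X\sqcup Y)$ has a logspace normal form. More precisely, let $g'_X$ and $h'_Y$ be $g_X$ and $h_Y$ changed only in that words representing the identity are sent to the empty word $\lambda$. Then there is a logspace normal form function $f$ for $(G*H,X\sqcup Y)$ with $f(\lambda)=\lambda$ and with the following property for all $w\in (X\sqcup Y)^*$: if $w=pw'$, where $p$ is the longest prefix of $w$ representing an element of $G$, then $f(w)=g'_X(X(p))\,f(w')$,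 where $X(p)$ is $p$ with all letters of $Y$ deleted; and if $w=pw'$, where $p$ is the longest prefix of $w$ representing an element of $H$, then $f(w)=h'_Y(Y(p))\,f(w')$, where $Y(p)$ is $p$ with all letters of $X$ deleted. -/

import Mathlib

/-! ### Deterministic logspace transducers -/

/-- A symbol of the input tape: a letter, or one of the two end markers that delimit the word. -/
inductive TapeSymbol (X : Type*) where
  | leftEnd : TapeSymbol X
  | letter : X → TapeSymbol X
  | rightEnd : TapeSymbol X

/-- A move of a tape head. -/
inductive HeadMove where
  | left : HeadMove
  | stay : HeadMove
  | right : HeadMove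

/-- The head position after a move; a head on square `0` cannot move further left. -/
def HeadMove.apply : HeadMove → ℕ → ℕ
  | .left, p => p - 1
  | .stay, p => p
  | .right, p => p + 1

/-- What a machine does in one transition: enter a new state, move the input head, overwrite the
scanned square of the work tape, move the work head, and append a string to the output tape. -/
structure TransducerAction (Q W Y : Type*) where
  state : Q
  inputMove : HeadMove
  write : W
  workMove : HeadMove
  output : List Y

/-- A deterministic transducer: a finite control `State`, a read-only two-way input tape over `X`,
a work tape over the finite alphabet `Work`, and a write-only output tape over `Y`, written from
left to right.  A transition depends on the state, the scanned input symbol and the scanned work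
symbol; the value `none` means that the machine halts.  (For a finite alphabet `X` there are
finitely many transitions, so the number of letters output per transition is bounded.) -/
structure Transducer (X Y : Type*) where
  State : Type
  Work : Type
  finiteState : Finite State
  finiteWork : Finite Work
  start : State
  blank : Work
  trans : State → TapeSymbol X → Work → Option (TransducerAction State Work Y)

namespace Transducer

variable {X Y : Type*}

/-- A configuration of a transducer (the input word is kept separately). -/
structure Config (M : Transducer X Y) where
  state : M.State
  inputPos : ℕ
  work : ℕ → M.Work
  workPos : ℕ
  out : List Y

/-- The symbol on square `p` of the input tape: the left end marker is on square `0`, the letters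
of `w` are on squares `1, …, |w|`, and the right end marker follows. -/
def inputSymbol (w : List X) : ℕ → TapeSymbol X
  | 0 => .leftEnd
  | p + 1 => match w[p]? with
    | some a => .letter a
    | none => .rightEnd

/-- The initial configuration: blank work tape, empty output tape, input head on the left end
marker. -/
def initial (M : Transducer X Y) : M.Config where
  state := M.start
  inputPos := 0
  work := fun _ => M.blank
  workPos := 0
  out := []

/-- One step on input `w`; `none` if the machine halts.  The input head stays between the two end
markers. -/
def step (M : Transducer X Y) (w : List X) (c : M.Config) : Option M.Config :=
  (M.trans c.state (inputSymbol w c.inputPos) (c.work c.workPos)).map fun a =>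
    { state := a.state
      inputPos := min (a.inputMove.apply c.inputPos) (w.length + 1)
      work := Function.update c.work c.workPos a.write
      workPos := a.workMove.apply c.workPos
      out := c.out ++ a.output }

/-- The configurations that occur in the computation on input `w`. -/
def Reachable (M : Transducer X Y) (w : List X) (c : M.Config) : Prop :=
  Relation.ReflTransGen (fun c₁ c₂ => M.step w c₁ = some c₂) M.initial c

/-- On input `w` the machine halts, with the word `y` on its output tape. -/
def HaltsWithOutput (M : Transducer X Y) (w : List X) (y : List Y) : Prop :=
  ∃ c : M.Config, M.Reachable w c ∧ M.step w c = none ∧ c.out = y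

/-- On input `w` the machine uses only the first `s` squares of its work tape. -/
def UsesSpaceAtMost (M : Transducer X Y) (w : List X) (s : ℕ) : Prop :=
  ∀ c : M.Config, M.Reachable w c → c.workPos < s

end Transducer

/-- `f : X* → Y*` is computed by a deterministic transducer in space `O(log n)`, where `n` is the
length of the input.  (The summand `1` only serves to give the machine some work square on inputs
of length `0` and `1`.) -/
def LogspaceComputable {X Y : Type*} (f : List X → List Y) : Prop :=
  ∃ (M : Transducer X Y) (c : ℕ), ∀ w : List X,
    M.HaltsWithOutput w (f w) ∧ M.UsesSpaceAtMost w (c * (Nat.log 2 w.length + 1))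

/-! ### Normal forms and the word problem -/

/-- The group element represented by a word, where the letter `a` stands for `x a`. -/
def evalWord {X G : Type*} [Group G] (x : X → G) (w : List X) : G := (w.map x).prod

/-- The letters of the alphabet `X`, interpreted by `x`, form a finite symmetric (closed under
inversion) generating set of `G`. -/
structure IsFiniteSymmetricGenerating {X G : Type*} [Group G] (x : X → G) : Prop where
  finite : Finite X
  symmetric : ∀ a, ∃ b, x b = (x a)⁻¹
  generates : Subgroup.closure (Set.range x) = ⊤

/-- A normal form: a set of words in bijection with `G` under evaluation. -/
def IsNormalForm {X G : Type*} [Group G] (x : X → G) (L : Set (List X)) : Prop :=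
  Set.BijOn (evalWord x) L Set.univ

/-- `f` is a logspace normal form function for `G` with respect to the finite symmetric generating
set given by `x`: it is logspace computable and sends each word to the word representing the same
element in some fixed normal form. -/
structure IsLogspaceNormalFormFunction {X G : Type*} [Group G] (x : X → G)
    (f : List X → List X) : Prop where
  generating : IsFiniteSymmetricGenerating x
  logspace : LogspaceComputable f
  normalForm : ∃ L : Set (List X), IsNormalForm x L ∧
    ∀ w, f w ∈ L ∧ evalWord x (f w) = evalWord x w

open Classical in
/-- The characteristic function of the word problem, as a function from words to one-letter
words. -/
noncomputable def wordProblem {X G : Type*} [Group G] (x : X → G) (w : List X) : List Bool :=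
  [decide (evalWord x w = 1)]

/-- The word problem of `G` is decidable in logspace, over some finite symmetric generating set. -/
def HasLogspaceWordProblem (G : Type*) [Group G] : Prop :=
  ∃ (k : ℕ) (z : Fin k → G), IsFiniteSymmetricGenerating z ∧ LogspaceComputable (wordProblem z)

/-! ### Free products -/

/-- The generating set `X ⊔ Y` of the free product `G ∗ H`. -/
def freeProductGen {X Y G H : Type*} [Group G] [Group H] (x : X → G) (y : Y → H) :
    X ⊕ Y → Monoid.Coprod G H :=
  Sum.elim (fun a => Monoid.Coprod.inl (x a)) (fun b => Monoid.Coprod.inr (y b))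

open Classical in
/-- The function that agrees with `f`, except that words representing the identity are sent to the
empty word. -/
noncomputable def emptyAtIdentity {X G : Type*} [Group G] (x : X → G) (f : List X → List X)
    (w : List X) : List X :=
  if evalWord x w = 1 then [] else f w

/-- `p` is the longest prefix of `w` that represents an element of the subgroup `K`. -/
def IsLongestPrefixIn {X G : Type*} [Group G] (x : X → G) (K : Subgroup G)
    (p w : List X) : Prop :=
  p <+: w ∧ evalWord x p ∈ K ∧ ∀ q, q <+: w → evalWord x q ∈ K → q.length ≤ p.length

/-- `f` is the function on words over `X ⊔ Y` that repeatedly peels off the longest prefix `p` lying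
in `G` or in `H`, and replaces it by the normal form of the word obtained from `p` by deleting the
letters of the other alphabet.  Here `g` and `h` are the normal form functions on `X*` and `Y*`. -/
structure IsPeelingFunction {X Y G H : Type*} [Group G] [Group H] (x : X → G) (y : Y → H)
    (g : List X → List X) (h : List Y → List Y) (f : List (X ⊕ Y) → List (X ⊕ Y)) : Prop where
  nil : f [] = []
  peelLeft : ∀ p w, IsLongestPrefixIn (freeProductGen x y)
      (Monoid.Coprod.inl : G →* Monoid.Coprod G H).range p (p ++ w) →
    f (p ++ w) = (g (p.filterMap Sum.getLeft?)).map Sum.inl ++ f w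
  peelRight : ∀ p w, IsLongestPrefixIn (freeProductGen x y)
      (Monoid.Coprod.inr : H →* Monoid.Coprod G H).range p (p ++ w) →
    f (p ++ w) = (h (p.filterMap Sum.getRight?)).map Sum.inr ++ f w

/-! Algebra. Let `K i` be the two factors of the free product. A letter of type `i` that follows the
prefix `u` of `w` is assigned to the left coset `u K i`; geometrically, `w` traces a path in the
Bass–Serre tree and the letter is read at the vertex `u K i`. Collect the letters of type `i`
assigned to one coset and multiply them in order. If the path merely visits a branch off the
geodesic, it leaves the coset where it entered and the product is `1`; otherwise the product is a
syllable of the reduced form of `w`. Hence the reduced form can be written down without any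
cancellation: run through `w`, and at the first letter of each coset output the normal form of the
product of all letters of that coset, where `1` gives the empty word. This is `wordOutput_eq`. It
rests on `evalWord_cosetLetters`, which says that the letters of type `i` read at `K i` itself
multiply to the first syllable of type `i`. The reduced form is obtained, as in van der Waerden's
proof, from an action of the free product on reduced lists (`isReducedForm_coprodForm`).

The function `coprodNormalForm` translates the reduced form syllable by syllable. It depends only on
the element and returns a word for it, so its range is a normal form. After the longest prefix in `K
i` the rest of the word has no leading syllable of type `i` (`lead_of_isLongestPrefixIn`); therefore
the prefix contributes a whole syllable, which is the peeling property.

Complexity. Two places of `w` lie in the same coset if and only if the segment between them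
evaluates into `K i`. An element `a` lies in `K i` exactly if it equals its image under the
retraction onto that factor, so membership is an instance of the word problem
(`exists_logspace_membership`). The output above is thus given by two nested loops over the
positions of `w`, case distinctions, finite automata with output, and the given normal form
functions. It remains to see that logspace functions are closed under composition, case distinction
and loops over a marked position.

These closure properties are proved for counter machines with polynomially bounded counters, which
compute the same functions: counters are stored in binary on tracks of a work tape
(`CounterComputable.logspaceComputable`), and conversely a work tape of logarithmic length is a pair
of polynomially bounded numbers (`LogspaceComputable.counterComputable`). Composition recomputes the
intermediate word whenever one of its letters is needed; this works because that word has polynomial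
length (`CounterComputable.length_le`). -/

/-! ### Finite controls -/

/-- A finite control that operates some device: in state `q` and on observation `o` it executes an
instruction and then enters a new state or exits with a value in `E`. -/
structure Control (O I E : Type) where
  Q : Type
  finite : Finite Q
  start : Q
  act : Q → O → (Q ⊕ E) × I

/-- A device with configurations `C`, observations `O` and instructions `I`. -/
structure Device (C O I : Type) where
  obs : C → O
  exec : I → C → C

namespace Control

variable {C O I E E' : Type}

/-- The control `F`, started in a state (or exit) `r` and a configuration `c`, exits with the value
`e` in the configuration `c'`, and all the configurations on the way satisfy `ok`. -/
inductive Run (D : Device C O I) (ok : C → Prop) (F : Control O I E) :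
    F.Q ⊕ E → C → E → C → Prop
  | exit (e : E) (c : C) : ok c → Run D ok F (.inr e) c e c
  | step (q : F.Q) (c : C) (e : E) (c' : C) : ok c →
      Run D ok F (F.act q (D.obs c)).1 (D.exec (F.act q (D.obs c)).2 c) e c' →
      Run D ok F (.inl q) c e c'

/-- A run from the start state. -/
def Runs (D : Device C O I) (ok : C → Prop) (F : Control O I E) (c : C) (e : E) (c' : C) : Prop :=
  F.Run D ok (.inl F.start) c e c'

variable {D : Device C O I} {ok : C → Prop}

theorem Run.ok_start {F : Control O I E} {r c e c'} (h : F.Run D ok r c e c') : ok c := by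
  cases h <;> assumption

theorem Run.ok_end {F : Control O I E} {r c e c'} (h : F.Run D ok r c e c') : ok c' := by
  induction h <;> assumption

/-- Since `ι` respects transitions until `F` exits, a run of `F` is an initial piece of a run of
`F'`, which continues from `κ e`. Relabelling, sequencing and looping are all instances. -/
theorem Run.lift {F : Control O I E} {F' : Control O I E'} (ι : F.Q → F'.Q) (κ : E → F'.Q ⊕ E')
    (hact : ∀ q o, F'.act (ι q) o = (Sum.elim (Sum.inl ∘ ι) κ (F.act q o).1, (F.act q o).2))
    {r c e c'} (h : F.Run D ok r c e c') {e' c''} (h' : F'.Run D ok (κ e) c' e' c'') :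
    F'.Run D ok (Sum.elim (Sum.inl ∘ ι) κ r) c e' c'' := by
  induction h with
  | exit e c h => exact h'
  | step q c e c' h _ ih =>
    refine .step _ _ _ _ h ?_
    rw [hact]
    exact ih h'

/-- The control that executes one instruction. -/
def atom (f : O → E × I) : Control O I E where
  Q := Unit
  finite := inferInstance
  start := ()
  act _ o := (.inr (f o).1, (f o).2)

theorem runs_atom (f : O → E × I) {c : C} (h : ok c) (h' : ok (D.exec (f (D.obs c)).2 c)) :
    (atom f).Runs D ok c (f (D.obs c)).1 (D.exec (f (D.obs c)).2 c) :=
  .step _ _ _ _ h (.exit _ _ h')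

/-- The control `F` with relabelled exits. -/
def map (g : E → E') (F : Control O I E) : Control O I E' where
  Q := F.Q
  finite := F.finite
  start := F.start
  act q o := (Sum.map id g (F.act q o).1, (F.act q o).2)

theorem Runs.map {F : Control O I E} {c e c'} (h : F.Runs D ok c e c') (g : E → E') :
    (F.map g).Runs D ok c (g e) c' :=
  Run.lift (F := F) (F' := F.map g) id (fun e => .inr (g e))
    (by intro q o; simp only [Control.map, id]; rcases (F.act q o).1 with _ | _ <;> rfl)
    h (.exit _ _ h.ok_end)

/-- Run `F` and continue with `G e`, where `e` is the exit of `F`. -/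
def bind [Finite E] (F : Control O I E) (G : E → Control O I E') : Control O I E' where
  Q := F.Q ⊕ (Σ e, (G e).Q)
  finite := by
    have := F.finite
    have := fun e => (G e).finite
    infer_instance
  start := .inl F.start
  act q o := match q with
    | .inl q => (Sum.elim (Sum.inl ∘ Sum.inl) (fun e => .inl (.inr ⟨e, (G e).start⟩)) (F.act q o).1,
        (F.act q o).2)
    | .inr ⟨e, q⟩ => (Sum.elim (fun q' => .inl (.inr ⟨e, q'⟩)) .inr ((G e).act q o).1,
        ((G e).act q o).2)

theorem Runs.bind [Finite E] {F : Control O I E} {G : E → Control O I E'} {c e c' e' c''}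
    (h : F.Runs D ok c e c') (h' : (G e).Runs D ok c' e' c'') :
    (F.bind G).Runs D ok c e' c'' := by
  refine Run.lift (F' := F.bind G) Sum.inl (fun e => .inl (.inr ⟨e, (G e).start⟩))
    (fun q o => rfl) h ?_
  exact Run.lift (F' := F.bind G) (fun q => Sum.inr ⟨e, q⟩) Sum.inr (fun q o => rfl) h'
    (.exit _ _ h'.ok_end)

/-- Repeat `F s` for a control value `s : S`, until it exits with a value in `E`. -/
def loop {S : Type} [Finite S] (F : S → Control O I (S ⊕ E)) (s₀ : S) : Control O I E where
  Q := Σ s, (F s).Q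
  finite := by
    have := fun s => (F s).finite
    infer_instance
  start := ⟨s₀, (F s₀).start⟩
  act q o := (match ((F q.1).act q.2 o).1 with
    | .inl q' => .inl ⟨q.1, q'⟩
    | .inr (.inl s) => .inl ⟨s, (F s).start⟩
    | .inr (.inr e) => .inr e, ((F q.1).act q.2 o).2)

section loop

variable {S : Type} [Finite S] {F : S → Control O I (S ⊕ E)}

/-- The initial control value only enters into the start state, not into the transitions. -/
theorem Run.loop_start {s t : S} {r c e c'} (h : (loop F s).Run D ok r c e c') :
    (loop F t).Run D ok r c e c' := by
  induction h with
  | exit e c h => exact .exit e c h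
  | step q c e c' h _ ih => exact Run.step (F := loop F t) q c e c' h ih

theorem Runs.loop_step {s s' : S} {c c' e c''} (h : (F s).Runs D ok c (.inl s') c')
    (h' : (loop F s').Runs D ok c' e c'') : (loop F s).Runs D ok c e c'' :=
  Run.lift (F := F s) (F' := loop F s) (fun q => (⟨s, q⟩ : Σ s, (F s).Q))
    (fun x => match x with
      | .inl s => .inl ⟨s, (F s).start⟩
      | .inr e => .inr e)
    (by
      intro q o
      simp only [loop]
      rcases ((F s).act q o).1 with _ | _ | _ <;> rfl)
    h (Run.loop_start (s := s') h')

theorem Runs.loop_exit {s : S} {c c' : C} {e : E} (h : (F s).Runs D ok c (.inr e) c') :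
    (loop F s).Runs D ok c e c' :=
  Run.lift (F := F s) (F' := loop F s) (fun q => (⟨s, q⟩ : Σ s, (F s).Q))
    (fun x => match x with
      | .inl s => .inl ⟨s, (F s).start⟩
      | .inr e => .inr e)
    (by
      intro q o
      simp only [loop]
      rcases ((F s).act q o).1 with _ | _ | _ <;> rfl)
    h (.exit _ _ h.ok_end)

end loop

/-- Simulate `F` on another device: observations are made by `rd`, instructions are executed by
`im`, which may also change a control value in `T`. -/
def transl {O' I' T : Type} [Finite T] [Finite O] (rd : Control O' I' O)
    (im : I → T → Control O' I' T) (F : Control O I E) (t₀ : T) : Control O' I' (E × T) :=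
  have := F.finite
  loop (S := F.Q × T) (fun s => rd.bind fun o => (im (F.act s.1 o).2 s.2).map fun t =>
    Sum.map (·, t) (·, t) (F.act s.1 o).1) (F.start, t₀)

/-- The common principle of all simulations below: it suffices to check a relation `R` between
configurations for a single observation and a single instruction. `R` and `ok` carry the information
on resources. -/
theorem Runs.transl {O' I' T C' : Type} [Finite T] [Finite O] {rd : Control O' I' O}
    {im : I → T → Control O' I' T} {D' : Device C' O' I'} {ok' : C' → Prop}
    (R : C → T → C' → Prop)
    (hrd : ∀ c t c', ok c → R c t c' → ∃ c'', rd.Runs D' ok' c' (D.obs c) c'' ∧ R c t c'')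
    (him : ∀ i c t c', ok c → ok (D.exec i c) → R c t c' →
      ∃ t' c'', (im i t).Runs D' ok' c' t' c'' ∧ R (D.exec i c) t' c'')
    {F : Control O I E} {c e d} (h : F.Runs D ok c e d) {t c'} (hR : R c t c') :
    ∃ t' d', (transl rd im F t).Runs D' ok' c' (e, t') d' ∧ R d t' d' := by
  -- The induction passes through all states of `F`, so the start state has to be variable.
  have key : ∀ r c e d, F.Run D ok r c e d → ∀ q, r = .inl q → ∀ t c', R c t c' →
      ∃ t' d', (Control.transl rd im { F with start := q } t).Runs D' ok' c' (e, t') d' ∧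
        R d t' d' := by
    intro r c e d h
    induction h with
    | exit e c h => intro q hq; cases hq
    | step q c e d h hrun ih =>
      rintro _ ⟨⟩ t c' hR
      obtain ⟨c₁, h₁, hR₁⟩ := hrd c t c' h hR
      obtain ⟨t₂, c₂, h₂, hR₂⟩ := him (F.act q (D.obs c)).2 c t c₁ h hrun.ok_start hR₁
      have hF := F.finite
      rcases hr : (F.act q (D.obs c)).1 with q' | e'
      · obtain ⟨t₃, d', h₃, hR₃⟩ := ih q' hr t₂ c₂ hR₂
        refine ⟨t₃, d', ?_, hR₃⟩
        have := h₁.bind (G := fun o => (im (F.act q o).2 t).map fun t =>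
          Sum.map (·, t) (·, t) (F.act q o).1) (h₂.map _)
        rw [hr] at this
        exact Runs.loop_step (F := fun s : F.Q × T => rd.bind fun o =>
          (im (F.act s.1 o).2 s.2).map fun t =>
          Sum.map (·, t) (·, t) (F.act s.1 o).1) this h₃
      · rw [hr] at hrun
        cases hrun
        refine ⟨t₂, c₂, ?_, hR₂⟩
        have := h₁.bind (G := fun o => (im (F.act q o).2 t).map fun t =>
          Sum.map (·, t) (·, t) (F.act q o).1) (h₂.map _)
        rw [hr] at this
        exact Runs.loop_exit (F := fun s : F.Q × T => rd.bind fun o =>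
          (im (F.act s.1 o).2 s.2).map fun t =>
          Sum.map (·, t) (·, t) (F.act s.1 o).1) this
  exact key _ _ _ _ h F.start rfl t c' hR

end Control

/-! ### Counter machines -/

instance {A : Type*} [Finite A] : Finite (TapeSymbol A) := by
  refine Finite.of_injective (β := Option (Option A)) (fun s => match s with
    | .leftEnd => none
    | .rightEnd => some none
    | .letter a => some (some a)) ?_
  rintro (_ | _ | _) (_ | _ | _) h <;> simp_all

/-- A configuration of a counter machine with counters indexed by `V`: the position of the input
head, the values of the counters, and the output written so far. -/
@[ext] structure CounterConfig (V B : Type) where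
  pos : ℕ
  reg : V → ℕ
  out : List B

/-- The instructions of a counter machine. -/
inductive CounterInstr (V B : Type) where
  | nop : CounterInstr V B
  | inc : V → CounterInstr V B
  | dec : V → CounterInstr V B
  | left : CounterInstr V B
  | right : CounterInstr V B
  | emit : B → CounterInstr V B

/-- A counter machine sees the scanned input symbol and which counters are nonzero. -/
abbrev CounterObs (A V : Type) : Type := TapeSymbol A × (V → Bool)

/-- A program for a counter machine. -/
abbrev CounterProg (A V B E : Type) := Control (CounterObs A V) (CounterInstr V B) E

namespace CounterConfig

variable {V B : Type} [DecidableEq V]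

/-- Set the counter `v` to `n`. -/
def set (c : CounterConfig V B) (v : V) (n : ℕ) : CounterConfig V B :=
  { c with reg := Function.update c.reg v n }

@[simp] theorem set_pos (c : CounterConfig V B) (v : V) (n : ℕ) : (c.set v n).pos = c.pos := rfl
@[simp] theorem set_out (c : CounterConfig V B) (v : V) (n : ℕ) : (c.set v n).out = c.out := rfl
theorem set_reg (c : CounterConfig V B) (v u : V) (n : ℕ) :
    (c.set v n).reg u = if u = v then n else c.reg u := by
  simp [set, Function.update_apply]
@[simp] theorem set_reg_self (c : CounterConfig V B) (v : V) (n : ℕ) :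
    (c.set v n).reg v = n := by simp [set_reg]
theorem set_reg_of_ne (c : CounterConfig V B) {v u : V} (n : ℕ) (h : u ≠ v) :
    (c.set v n).reg u = c.reg u := by simp [set_reg, h]
@[simp] theorem set_set (c : CounterConfig V B) (v : V) (m n : ℕ) :
    (c.set v m).set v n = c.set v n := by simp [set]
theorem set_eq_self (c : CounterConfig V B) {v : V} {n : ℕ} (h : c.reg v = n) :
    c.set v n = c := by subst h; simp [set]
theorem set_comm (c : CounterConfig V B) {v u : V} (m n : ℕ) (h : u ≠ v) :
    (c.set v m).set u n = (c.set u n).set v m := by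
  simp [set, Function.update_comm h]

/-- The counters are at most `N` and the input head is between the end markers of an input of
length `l`. -/
def Bounded (l N : ℕ) (c : CounterConfig V B) : Prop :=
  (∀ v, c.reg v ≤ N) ∧ c.pos ≤ l + 1

theorem Bounded.set {l N : ℕ} {c : CounterConfig V B} (hc : c.Bounded l N) (v : V) {n : ℕ}
    (hn : n ≤ N) : (c.set v n).Bounded l N := by
  refine ⟨fun u => ?_, hc.2⟩
  rw [set_reg]; split_ifs
  exacts [hn, hc.1 u]

end CounterConfig

/-- The device operated by a counter machine on the input `w`. -/
def counterDevice {A V : Type} (B : Type) [DecidableEq V] (w : List A) :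
    Device (CounterConfig V B) (CounterObs A V) (CounterInstr V B) where
  obs c := (Transducer.inputSymbol w c.pos, fun v => decide (c.reg v ≠ 0))
  exec
    | .nop, c => c
    | .inc v, c => c.set v (c.reg v + 1)
    | .dec v, c => c.set v (c.reg v - 1)
    | .left, c => { c with pos := c.pos - 1 }
    | .right, c => { c with pos := c.pos + 1 }
    | .emit b, c => { c with out := c.out ++ [b] }

/-- The initial configuration of a counter machine. -/
def CounterConfig.init (V B : Type) : CounterConfig V B := ⟨0, fun _ => 0, []⟩

/-- `f` is computed by a counter machine whose counters are bounded by a polynomial in the length of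
the input. -/
def CounterComputable {A B : Type} (f : List A → List B) : Prop :=
  ∃ (V : Type) (_ : Fintype V) (_ : DecidableEq V) (F : CounterProg A V B Unit) (k : ℕ),
    ∀ w, ∃ c, F.Runs (counterDevice B w) (CounterConfig.Bounded w.length ((w.length + 2) ^ k))
      (.init V B) () c ∧ c.out = f w

set_option linter.unusedSectionVars false

/-! ### Elementary counter programs -/

namespace CounterProg

open CounterConfig

variable {A V B : Type} [Finite A] [DecidableEq V] {w : List A} {l N : ℕ} {c : CounterConfig V B}

/-- The program that executes one instruction. -/
def op (i : CounterInstr V B) : CounterProg A V B Unit := .atom fun _ => ((), i)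

/-- The program that exits with the value `e`. -/
def pure {E : Type} (e : E) : CounterProg A V B E := .atom fun _ => (e, .nop)

/-- The program that tests whether the counter `v` is nonzero. -/
def test (v : V) : CounterProg A V B Bool := .atom fun o => (o.2 v, .nop)

/-- The program that reads the scanned input symbol. -/
def symbol : CounterProg A V B (TapeSymbol A) := .atom fun o => (o.1, .nop)

/-- Sequential composition. -/
def seq {E : Type} (F : CounterProg A V B Unit) (G : CounterProg A V B E) : CounterProg A V B E :=
  F.bind fun _ => G

/-- Run `F` or `G` according to whether the counter `v` is nonzero. -/
def ite {E : Type} (v : V) (F G : CounterProg A V B E) : CounterProg A V B E :=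
  (test v).bind fun b => bif b then F else G

/-- Repeat `F` while the counter `v` is nonzero. -/
def repeatWhile (v : V) (F : CounterProg A V B Unit) : CounterProg A V B Unit :=
  .loop (S := Unit) (fun _ => ite v (F.map .inl) (pure (.inr ()))) ()

theorem runs_op {ok : CounterConfig V B → Prop} {i : CounterInstr V B} (h : ok c)
    (h' : ok ((counterDevice B w).exec i c)) :
    (op i).Runs (counterDevice B w) ok c () ((counterDevice B w).exec i c) :=
  Control.runs_atom (fun _ => ((), i)) h h'

theorem runs_inc {v : V} (h : c.Bounded l N) (hv : c.reg v + 1 ≤ N) :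
    (op (.inc v)).Runs (counterDevice B w) (Bounded l N) c () (c.set v (c.reg v + 1)) :=
  runs_op h (h.set v hv)

theorem runs_dec {v : V} (h : c.Bounded l N) :
    (op (.dec v)).Runs (counterDevice B w) (Bounded l N) c () (c.set v (c.reg v - 1)) :=
  runs_op h (h.set v ((Nat.sub_le _ _).trans (h.1 v)))

theorem runs_pure {E : Type} (e : E) {ok : CounterConfig V B → Prop} (h : ok c) :
    (pure e).Runs (counterDevice B w) ok c e c :=
  Control.runs_atom (D := counterDevice B w) (fun _ => (e, .nop)) h h

theorem runs_test (v : V) {ok : CounterConfig V B → Prop} (h : ok c) :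
    (test v).Runs (counterDevice B w) ok c (decide (c.reg v ≠ 0)) c :=
  Control.runs_atom (D := counterDevice B w) (fun o => (o.2 v, .nop)) h h

theorem runs_symbol {ok : CounterConfig V B → Prop} (h : ok c) :
    symbol.Runs (counterDevice B w) ok c (Transducer.inputSymbol w c.pos) c :=
  Control.runs_atom (D := counterDevice B w) (fun o => (o.1, .nop)) h h

section

variable {D : Device (CounterConfig V B) (CounterObs A V) (CounterInstr V B)}
  {ok : CounterConfig V B → Prop} {E : Type} {e : E} {c' c'' : CounterConfig V B}

theorem _root_.Control.Runs.seq {F : CounterProg A V B Unit} {G : CounterProg A V B E}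
    (h : F.Runs D ok c () c') (h' : G.Runs D ok c' e c'') : (seq F G).Runs D ok c e c'' :=
  h.bind (G := fun _ => G) h'

theorem _root_.Control.Runs.ite_pos {v : V} {F G : CounterProg A V B E} (hv : c.reg v ≠ 0)
    (h : F.Runs (counterDevice B w) ok c e c') :
    (ite v F G).Runs (counterDevice B w) ok c e c' := by
  refine (runs_test v h.ok_start).bind ?_
  simpa [hv] using h

theorem _root_.Control.Runs.ite_neg {v : V} {F G : CounterProg A V B E} (hv : c.reg v = 0)
    (h : G.Runs (counterDevice B w) ok c e c') :
    (ite v F G).Runs (counterDevice B w) ok c e c' := by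
  refine (runs_test v h.ok_start).bind ?_
  simpa [hv] using h

theorem runs_while_exit {v : V} {F : CounterProg A V B Unit} (hv : c.reg v = 0) (h : ok c) :
    (repeatWhile v F).Runs (counterDevice B w) ok c () c :=
  .loop_exit (F := fun _ : Unit => ite v (F.map .inl) (pure (.inr ())))
    (Control.Runs.ite_neg hv (runs_pure _ h))

theorem _root_.Control.Runs.while_step {v : V} {F : CounterProg A V B Unit} (hv : c.reg v ≠ 0)
    (h : F.Runs (counterDevice B w) ok c () c')
    (h' : (repeatWhile v F).Runs (counterDevice B w) ok c' () c'') :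
    (repeatWhile v F).Runs (counterDevice B w) ok c () c'' :=
  .loop_step (F := fun _ : Unit => ite v (F.map .inl) (pure (.inr ())))
    (Control.Runs.ite_pos hv (h.map Sum.inl)) h'

/-- The family `f` is indexed by the number of rounds that remain, so the loop runs from `f n` down
to `f 0`. -/
theorem runs_while {v : V} {F : CounterProg A V B Unit} (f : ℕ → CounterConfig V B) (n : ℕ)
    (h₀ : ok (f 0)) (hf₀ : (f 0).reg v = 0)
    (h : ∀ i < n, (f (i + 1)).reg v ≠ 0 ∧
      F.Runs (counterDevice B w) ok (f (i + 1)) () (f i)) :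
    (repeatWhile v F).Runs (counterDevice B w) ok (f n) () (f 0) := by
  induction n with
  | zero => exact runs_while_exit hf₀ h₀
  | succ n ih =>
    exact Control.Runs.while_step (h n n.lt_succ_self).1 (h n n.lt_succ_self).2
      (ih fun i hi => h i (hi.trans n.lt_succ_self))

end

/-- Set the counter `v` to zero. -/
def clear (v : V) : CounterProg A V B Unit := repeatWhile v (op (.dec v))

theorem runs_clear (v : V) (h : c.Bounded l N) :
    (clear v).Runs (counterDevice B w) (Bounded l N) c () (c.set v 0) := by
  have := runs_while (w := w) (v := v) (F := op (.dec v)) (ok := Bounded l N)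
    (fun i => c.set v (min i (c.reg v))) (c.reg v) (h.set v (by simp)) (by simp) (fun i hi => by
      refine ⟨by simp; omega, ?_⟩
      have := runs_dec (w := w) (v := v) (h.set v (n := min (i + 1) (c.reg v))
        (by have := h.1 v; omega))
      simp only [set_reg_self, set_set] at this
      convert this using 3
      omega)
  simpa [set_eq_self, clear] using this

/-- Set the counters in a list to zero. -/
def clearList : List V → CounterProg A V B Unit
  | [] => pure ()
  | v :: vs => seq (clear v) (clearList vs)

theorem runs_clearList (vs : List V) (h : c.Bounded l N) :
    (clearList vs).Runs (counterDevice B w) (Bounded l N) c ()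
      { c with reg := fun v => if v ∈ vs then 0 else c.reg v } := by
  induction vs generalizing c with
  | nil => simpa [clearList] using runs_pure (w := w) () h
  | cons v vs ih =>
    refine (runs_clear v h).seq ?_
    have := ih (h.set v (Nat.zero_le N))
    convert this using 2
    · rfl
    · funext u
      by_cases hu : u = v <;> simp [set_reg, hu]
    · rfl

/-- Increment the counter `v` by `k`. -/
def incBy (v : V) : ℕ → CounterProg A V B Unit
  | 0 => pure ()
  | k + 1 => seq (op (.inc v)) (incBy v k)

theorem runs_incBy (v : V) (k : ℕ) (h : c.Bounded l N) (hv : c.reg v + k ≤ N) :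
    (incBy v k).Runs (counterDevice B w) (Bounded l N) c () (c.set v (c.reg v + k)) := by
  induction k generalizing c with
  | zero => simpa [set_eq_self, incBy] using runs_pure (w := w) () h
  | succ k ih =>
    refine (runs_inc h (by omega)).seq ?_
    have := ih (h.set v (n := c.reg v + 1) (by omega)) (by simp; omega)
    simpa [add_assoc, add_comm 1 k] using this

/-- Add `k` times the counter `u` to the counter `v`, and set `u` to zero. -/
def drain (u v : V) (k : ℕ) : CounterProg A V B Unit :=
  repeatWhile u (seq (op (.dec u)) (incBy v k))

theorem runs_drain {u v : V} (huv : u ≠ v) (k : ℕ) (h : c.Bounded l N)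
    (hv : c.reg v + k * c.reg u ≤ N) :
    (drain u v k).Runs (counterDevice B w) (Bounded l N) c ()
      ((c.set u 0).set v (c.reg v + k * c.reg u)) := by
  -- The index `i` is what remains in `u`; the minimum makes the bound hold for every `i`.
  have hb : ∀ i, ((c.set u (min i (c.reg u))).set v (c.reg v + k * (c.reg u - i))).Bounded l N :=
    fun i => (h.set u (by have := h.1 u; omega)).set v
      (le_trans (by gcongr; omega) hv)
  have := runs_while (w := w) (v := u) (F := seq (op (.dec u)) (incBy v k)) (ok := Bounded l N)
    (fun i => (c.set u (min i (c.reg u))).set v (c.reg v + k * (c.reg u - i))) (c.reg u)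
    (hb 0) (by simp [set_reg_of_ne _ _ huv]) (fun i hi => by
      refine ⟨by simp [set_reg_of_ne _ _ huv]; omega, ?_⟩
      refine (runs_dec (hb _)).seq ?_
      have e : c.reg u - i = (c.reg u - (i + 1)) + 1 := by omega
      have hk : c.reg v + k * (c.reg u - i) ≤ N := le_trans (by gcongr; omega) hv
      have := runs_incBy (w := w) v k ((hb (i + 1)).set u (n := min (i + 1) (c.reg u) - 1)
        (by have := h.1 u; omega)) (by
          rw [set_reg_of_ne _ _ huv.symm, set_reg_self]
          rw [e, mul_add, mul_one] at hk; omega)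
      convert this using 1
      · simp [set_reg_of_ne _ _ huv]
      · rw [set_reg_of_ne _ _ huv.symm, set_reg_self, set_comm _ _ _ huv, set_set, set_set,
          e, mul_add, mul_one, add_assoc, set_comm _ _ _ huv.symm,
          show min (i + 1) (c.reg u) - 1 = min i (c.reg u) by omega, set_comm _ _ _ huv.symm])
  simpa [set_eq_self, drain] using this

/-- Add the counter `u` to the counter `v`, using the counter `t`, which must be zero. -/
def copy (u v t : V) : CounterProg A V B Unit :=
  seq (drain u t 1) (repeatWhile t (seq (op (.dec t)) (seq (op (.inc u)) (op (.inc v)))))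

theorem runs_copy {u v t : V} (huv : u ≠ v) (hut : u ≠ t) (hvt : v ≠ t) (h : c.Bounded l N)
    (ht : c.reg t = 0) (hv : c.reg v + c.reg u ≤ N) :
    (copy u v t).Runs (counterDevice B w) (Bounded l N) c () (c.set v (c.reg v + c.reg u)) := by
  refine (runs_drain hut 1 h (by rw [ht]; have := h.1 u; omega)).seq ?_
  have hb : ∀ i, (((c.set t (min i (c.reg u))).set u (c.reg u - i)).set v
      (c.reg v + (c.reg u - i))).Bounded l N :=
    fun i => ((h.set t (by have := h.1 u; omega)).set u (by have := h.1 u; omega)).set v (by omega)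
  have := runs_while (w := w) (v := t)
    (F := seq (op (.dec t)) (seq (op (.inc u)) (op (.inc v)))) (ok := Bounded l N)
    (fun i => ((c.set t (min i (c.reg u))).set u (c.reg u - i)).set v
      (c.reg v + (c.reg u - i))) (c.reg u)
    (hb 0) (by simp [set_reg, huv.symm, hut.symm, hvt.symm]) (fun i hi => by
      refine ⟨by simp [set_reg, huv.symm, hut.symm, hvt.symm]; omega, ?_⟩
      refine (runs_dec (hb _)).seq ?_
      have hb' := (hb (i + 1)).set t (n := min (i + 1) (c.reg u) - 1)
        (by have := h.1 u; omega)
      refine Control.Runs.seq (runs_inc (v := u) (by simpa [set_reg, huv, hut, hvt, huv.symm, hut.symm, hvt.symm] using hb')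
        (by have := h.1 u; simp [set_reg, huv, hut, hvt, huv.symm, hut.symm, hvt.symm]; omega)) ?_
      have := runs_inc (w := w) (v := v) (hb'.set u (n := c.reg u - i) (by have := h.1 u; omega))
        (by simp [set_reg, huv, hut, hvt, huv.symm, hut.symm, hvt.symm]; omega)
      convert this using 1
      · ext x <;> simp [set_reg, huv, hut, hvt, huv.symm, hut.symm, hvt.symm]
        split_ifs <;> first | rfl | omega | simp_all
      · ext x <;> simp [set_reg, huv, hut, hvt, huv.symm, hut.symm, hvt.symm]
        split_ifs <;> first | rfl | omega | simp_all)
  convert this using 1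
  · ext x <;> simp [set_reg, ht]
    split_ifs <;> simp_all
  · ext x <;> simp [set_reg, ht]
    split_ifs <;> simp_all

/-- Move the input head to the left end marker. -/
def rewind : CounterProg A V B Unit :=
  .loop (S := Unit) (fun _ => symbol.bind fun s => match s with
    | .leftEnd => pure (.inr ())
    | _ => (op .left).map .inl) ()

theorem runs_rewind (h : c.Bounded l N) :
    rewind.Runs (counterDevice B w) (Bounded l N) c () { c with pos := 0 } := by
  obtain ⟨p, r, o⟩ := c
  induction p with
  | zero => exact .loop_exit ((runs_symbol h).bind (runs_pure _ h))
  | succ p ih =>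
    have h' : Bounded l N ⟨p, r, o⟩ := ⟨h.1, (Nat.le_succ p).trans h.2⟩
    refine .loop_step ((runs_symbol h).bind ?_) (ih h')
    have h₂ := (runs_op (w := w) (i := .left) h h').map (Sum.inl : Unit → Unit ⊕ Unit)
    rcases hs : Transducer.inputSymbol w (p + 1) with _ | a | _
    · rw [Transducer.inputSymbol] at hs; split at hs <;> cases hs
    · exact h₂
    · exact h₂

end CounterProg

/-! ### Work tapes with several tracks -/

/-- A configuration of a transducer without its state. -/
structure TapeConfig (W B : Type) where
  inputPos : ℕ
  work : ℕ → W
  workPos : ℕ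
  out : List B

/-- What a transducer does in one transition, apart from entering a new state. -/
structure TapeInstr (W B : Type) where
  inputMove : HeadMove
  write : W
  workMove : HeadMove
  output : List B

/-- The tapes operated by a transducer on the input `w`. -/
def tapeDevice {A : Type} (W B : Type) (w : List A) :
    Device (TapeConfig W B) (TapeSymbol A × W) (TapeInstr W B) where
  obs c := (Transducer.inputSymbol w c.inputPos, c.work c.workPos)
  exec i c :=
    { inputPos := min (i.inputMove.apply c.inputPos) (w.length + 1)
      work := Function.update c.work c.workPos i.write
      workPos := i.workMove.apply c.workPos
      out := c.out ++ i.output }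

/-- A program for a work tape. -/
abbrev TapeProg (A W B E : Type) := Control (TapeSymbol A × W) (TapeInstr W B) E

namespace TapeProg

variable {A W B : Type}

/-- The transducer whose states are those of the program, and its exit. -/
def toTransducer (F : TapeProg A W B Unit) [Finite W] (blank : W) : Transducer A B where
  State := F.Q ⊕ Unit
  Work := W
  finiteState := have := F.finite; inferInstance
  finiteWork := inferInstance
  start := .inl F.start
  blank := blank
  trans r a x := match r with
    | .inl q => some
        { state := (F.act q (a, x)).1
          inputMove := (F.act q (a, x)).2.inputMove
          write := (F.act q (a, x)).2.write
          workMove := (F.act q (a, x)).2.workMove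
          output := (F.act q (a, x)).2.output }
    | .inr _ => none

/-- The configuration of the transducer with the given state and tapes. -/
def config (F : TapeProg A W B Unit) [Finite W] (blank : W) (r : F.Q ⊕ Unit)
    (c : TapeConfig W B) : (F.toTransducer blank).Config :=
  ⟨r, c.inputPos, c.work, c.workPos, c.out⟩

/-- The space bound concerns all reachable configurations; by determinism these are the ones on the
given run, where the bound holds by the definition of a run. -/
theorem run_toTransducer [Finite W] (blank : W) {F : TapeProg A W B Unit} {w : List A}
    {s : ℕ} {r c c'} (h : F.Run (tapeDevice W B w) (fun c => c.workPos < s) r c () c') :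
    Relation.ReflTransGen (fun c₁ c₂ => (F.toTransducer blank).step w c₁ = some c₂)
      (F.config blank r c) (F.config blank (.inr ()) c') ∧
    ∀ d, Relation.ReflTransGen (fun c₁ c₂ => (F.toTransducer blank).step w c₁ = some c₂)
      (F.config blank r c) d → d.workPos < s := by
  generalize he : () = e at h
  induction h with
  | exit e c h =>
    refine ⟨.refl, fun d hd => ?_⟩
    rcases hd.cases_head with rfl | ⟨d', h', -⟩
    · exact h
    · cases h'
  | step q c e c' h _ ih =>
    obtain ⟨ih₁, ih₂⟩ := ih he
    have hs : (F.toTransducer blank).step w (F.config blank (.inl q) c) = some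
      (F.config blank (F.act q ((tapeDevice W B w).obs c)).1
        ((tapeDevice W B w).exec (F.act q ((tapeDevice W B w).obs c)).2 c)) := rfl
    refine ⟨ih₁.head hs, fun d hd => ?_⟩
    rcases hd.cases_head with rfl | ⟨d', h', hd⟩
    · exact h
    · rw [hs] at h'
      cases h'
      exact ih₂ d hd

theorem logspaceComputable [Finite W] (blank : W) (F : TapeProg A W B Unit)
    {f : List A → List B} (k : ℕ) (h : ∀ w : List A, ∃ c,
      F.Runs (tapeDevice W B w) (fun c => c.workPos < k * (Nat.log 2 w.length + 1))
        ⟨0, fun _ => blank, 0, []⟩ () c ∧ c.out = f w) :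
    LogspaceComputable f := by
  refine ⟨F.toTransducer blank, k, fun w => ?_⟩
  obtain ⟨c, hc, hout⟩ := h w
  obtain ⟨h₁, h₂⟩ := run_toTransducer blank hc
  exact ⟨⟨_, h₁, rfl, hout⟩, h₂⟩

end TapeProg

/-! ### Bijective binary numerals -/

/-- The successor of a number in the bijective binary numeral system, least digit first, where the
digits `1` and `2` are represented by `false` and `true`. -/
def incDigits : List Bool → List Bool
  | [] => [false]
  | false :: l => true :: l
  | true :: l => false :: incDigits l

/-- The predecessor of a number in the bijective binary numeral system. -/
def decDigits : List Bool → List Bool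
  | [] => []
  | true :: l => false :: l
  | false :: l => if l = [] then [] else true :: decDigits l

/-- The digits of a number in the bijective binary numeral system. -/
def bijDigits : ℕ → List Bool
  | 0 => []
  | n + 1 => incDigits (bijDigits n)

theorem incDigits_ne_nil (l : List Bool) : incDigits l ≠ [] := by
  rcases l with _ | ⟨_ | _, l⟩ <;> simp [incDigits]

theorem decDigits_incDigits (l : List Bool) : decDigits (incDigits l) = l := by
  induction l with
  | nil => simp [incDigits, decDigits]
  | cons b l ih => cases b <;> simp [incDigits, decDigits, ih, incDigits_ne_nil]

theorem decDigits_bijDigits (n : ℕ) : decDigits (bijDigits n) = bijDigits (n - 1) := by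
  cases n with
  | zero => rfl
  | succ n => exact decDigits_incDigits _

theorem bijDigits_eq_nil {n : ℕ} : bijDigits n = [] ↔ n = 0 := by
  cases n with
  | zero => simp [bijDigits]
  | succ n => simp [bijDigits, incDigits_ne_nil]

/-- The value of a bijective binary numeral. -/
def bijValue : List Bool → ℕ
  | [] => 0
  | b :: l => 2 * bijValue l + (if b then 2 else 1)

theorem bijValue_incDigits (l : List Bool) : bijValue (incDigits l) = bijValue l + 1 := by
  induction l with
  | nil => rfl
  | cons b l ih => cases b <;> simp [incDigits, bijValue, ih]; omega

theorem bijValue_bijDigits (n : ℕ) : bijValue (bijDigits n) = n := by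
  induction n with
  | zero => rfl
  | succ n ih => rw [bijDigits, bijValue_incDigits, ih]

/-- All digits are at least `1`, so the least value for a given number of digits is attained when
all of them are `1`. -/
theorem two_pow_length_le (l : List Bool) : 2 ^ l.length ≤ bijValue l + 1 := by
  induction l with
  | nil => simp [bijValue]
  | cons b l ih => simp only [List.length_cons, bijValue, pow_succ]; split_ifs <;> omega

theorem length_bijDigits_le (n : ℕ) : (bijDigits n).length ≤ Nat.log 2 (n + 1) := by
  have := two_pow_length_le (bijDigits n)
  rw [bijValue_bijDigits] at this
  exact Nat.le_log_of_pow_le (by norm_num) this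

/-- The work alphabet for tracks indexed by `V`: the left most square is marked by `true`. -/
abbrev TrackSymbol (V : Type) : Type := Bool × (V → Option Bool)

/-- The work tape with the given contents of the tracks. -/
def tracks {V : Type} (τ : V → List Bool) (i : ℕ) : TrackSymbol V :=
  (decide (i = 0), fun v => (τ v)[i]?)

/-! ### Counters on the tracks of a work tape -/

namespace TapeProg

variable {A V B : Type} [DecidableEq V] {w : List A} {s : ℕ} {τ : V → List Bool}

/-- The symbol `x`, with the digit `d` on the track `v`. -/
def setDigit (x : TrackSymbol V) (v : V) (d : Option Bool) : TrackSymbol V :=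
  (x.1, Function.update x.2 v d)

theorem update_tracks {v : V} {i : ℕ} {d : Option Bool} {l : List Bool}
    (h : ∀ j, l[j]? = if j = i then d else (τ v)[j]?) :
    Function.update (tracks τ) i (setDigit (tracks τ i) v d) =
      tracks (Function.update τ v l) := by
  funext j
  by_cases hj : j = i
  · subst hj
    simp only [Function.update_self, tracks, setDigit]
    congr 1
    funext u
    by_cases hu : u = v
    · subst hu; simp [h]
    · simp [hu]
  · simp only [Function.update_of_ne hj, tracks]
    congr 1
    funext u
    by_cases hu : u = v
    · subst hu; simp [h, hj]
    · simp [hu]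

theorem runs_workAtom {W E : Type} {f : TapeSymbol A × W → E × TapeInstr W B} {p q s : ℕ}
    {T T' : ℕ → W} {o : List B} {e : E} {x : W} {m : HeadMove}
    (hf : f (Transducer.inputSymbol w p, T q) = (e, ⟨.stay, x, m, []⟩)) (hp : p ≤ w.length + 1)
    (hT : Function.update T q x = T') (hq : q < s) (hq' : m.apply q < s) :
    (Control.atom f).Runs (tapeDevice W B w) (fun c => c.workPos < s) ⟨p, T, q, o⟩ e
      ⟨p, T', m.apply q, o⟩ := by
  have := Control.runs_atom (D := tapeDevice W B w) (ok := fun c => c.workPos < s) f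
    (c := ⟨p, T, q, o⟩) hq
  have hobs : (tapeDevice W B w).obs ⟨p, T, q, o⟩ = (Transducer.inputSymbol w p, T q) := rfl
  rw [hobs, hf] at this
  simpa [tapeDevice, show HeadMove.stay.apply p = p from rfl, hp, hT, hq'] using this

/-- Move the work head to the left most square. -/
def home : TapeProg A (TrackSymbol V) B Unit :=
  .loop (S := Unit) (fun _ => .atom fun o =>
    (if o.2.1 then .inr () else .inl (), ⟨.stay, o.2, .left, []⟩)) ()

theorem runs_home {p q : ℕ} {o : List B} (hq : q < s) (hp : p ≤ w.length + 1) :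
    home.Runs (tapeDevice _ B w) (fun c => c.workPos < s) ⟨p, tracks τ, q, o⟩ ()
      ⟨p, tracks τ, 0, o⟩ := by
  induction q with
  | zero =>
    exact .loop_exit (runs_workAtom (m := .left) (by simp [tracks]) hp
      (Function.update_eq_self _ _) hq hq)
  | succ q ih =>
    exact .loop_step (runs_workAtom (m := .left) (by simp [tracks]) hp
      (Function.update_eq_self _ _) hq (Nat.lt_of_succ_lt hq)) (ih (by omega))

/-- Increment the number on the track `v`, and leave the work head on the last digit changed. -/
def incSweep (v : V) : TapeProg A (TrackSymbol V) B Unit :=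
  .loop (S := Unit) (fun _ => .atom fun o => match o.2.2 v with
    | none => (.inr (), ⟨.stay, setDigit o.2 v (some false), .stay, []⟩)
    | some false => (.inr (), ⟨.stay, setDigit o.2 v (some true), .stay, []⟩)
    | some true => (.inl (), ⟨.stay, setDigit o.2 v (some false), .right, []⟩)) ()

theorem runs_incSweep {v : V} {p : ℕ} {o : List B} (hp : p ≤ w.length + 1) (pre l : List Bool)
    (hs : (pre ++ l).length < s) (hτ : τ v = pre ++ l) :
    ∃ q < s, (incSweep v).Runs (tapeDevice _ B w) (fun c => c.workPos < s)
      ⟨p, tracks τ, pre.length, o⟩ ()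
      ⟨p, tracks (Function.update τ v (pre ++ incDigits l)), q, o⟩ := by
  have hlen : pre.length < s := by simp at hs; omega
  induction l generalizing pre τ with
  | nil =>
    have hd : (tracks τ pre.length).2 v = none := by simp [tracks, hτ]
    exact ⟨pre.length, hlen, .loop_exit (runs_workAtom (m := .stay) (by simp only [hd]; rfl) hp
      (update_tracks fun j => by
        grind [incDigits]) hlen hlen)⟩
  | cons b l ih =>
    have hd : (tracks τ pre.length).2 v = some b := by simp [tracks, hτ]
    cases b with
    | false =>
      exact ⟨pre.length, hlen, .loop_exit (runs_workAtom (m := .stay) (by simp only [hd]; rfl) hp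
        (update_tracks fun j => by grind [incDigits]) hlen hlen)⟩
    | true =>
      obtain ⟨q, hq, h⟩ := ih (τ := Function.update τ v (pre ++ [false] ++ l)) (pre ++ [false])
        (by simpa [add_assoc, add_comm] using hs) (by simp) (by simp at hs ⊢; omega)
      refine ⟨q, hq, .loop_step (runs_workAtom (m := .right) (by simp only [hd]; rfl) hp
        (update_tracks (l := pre ++ [false] ++ l) fun j => ?_) hlen
        (by simp [HeadMove.apply] at hs ⊢; omega)) (s' := ()) ?_⟩
      · grind
      · simpa [HeadMove.apply, incDigits, incSweep] using h

/-- Decrement the number on the track `v`.  The control value `0` is that at the start, `1` means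
that a digit has been borrowed from, and `2` that the scanned digit, the last one, is to be
erased. -/
def decSweep (v : V) : TapeProg A (TrackSymbol V) B Unit :=
  .loop (S := Fin 3) (fun t => .atom fun o =>
    if t = 2 then (.inr (), ⟨.stay, setDigit o.2 v none, .stay, []⟩) else
    match o.2.2 v with
    | none => if t = 0 then (.inr (), ⟨.stay, o.2, .stay, []⟩) else
        (.inl 2, ⟨.stay, o.2, .left, []⟩)
    | some true => (.inr (), ⟨.stay, setDigit o.2 v (some false), .stay, []⟩)
    | some false => (.inl 1, ⟨.stay, setDigit o.2 v (some true), .right, []⟩)) 0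

/-- The digit `true` behind `pre` has just been written in place of a `false`, on the assumption
that a higher digit can be lowered. If the numeral turns out to end there, that digit must be erased
instead; this is why the head steps back in the case `l = []`. -/
theorem runs_decSweep_borrow {v : V} {p : ℕ} {o : List B} (hp : p ≤ w.length + 1)
    (pre l : List Bool) (hs : (pre ++ true :: l).length < s) (hτ : τ v = pre ++ true :: l) :
    ∃ q < s, Control.Runs (tapeDevice _ B w) (fun c => c.workPos < s)
      (.loop (S := Fin 3) (fun t => .atom fun o =>
        if t = 2 then (.inr (), ⟨.stay, setDigit o.2 v none, .stay, []⟩) else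
        match o.2.2 v with
        | none => if t = 0 then (.inr (), ⟨.stay, o.2, .stay, []⟩) else
            (.inl 2, ⟨.stay, o.2, .left, []⟩)
        | some true => (.inr (), ⟨.stay, setDigit o.2 v (some false), .stay, []⟩)
        | some false => (.inl 1, ⟨.stay, setDigit o.2 v (some true), .right, []⟩)) 1)
      ⟨p, tracks τ, pre.length + 1, o⟩ ()
      ⟨p, tracks (Function.update τ v (pre ++ decDigits (false :: l))), q, o⟩ := by
  have hlen : pre.length + 1 < s := by simp at hs; omega
  induction l generalizing pre τ with
  | nil =>
    have hd : (tracks τ (pre.length + 1)).2 v = none := by simp [tracks, hτ]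
    refine ⟨pre.length, by omega, .loop_step (runs_workAtom (m := .left) (by simp only [hd]; rfl) hp
      (Function.update_eq_self _ _) hlen (by simp [HeadMove.apply]; omega)) (s' := 2)
      (.loop_exit (runs_workAtom (m := .stay) (by simp; rfl) hp
      (update_tracks fun j => ?_) ?_ ?_))⟩
    · simp only [decDigits, HeadMove.apply]; grind
    all_goals simp [HeadMove.apply]; omega
  | cons b l ih =>
    have hd : (tracks τ (pre.length + 1)).2 v = some b := by simp [tracks, hτ]
    cases b with
    | true =>
      exact ⟨_, hlen, .loop_exit (runs_workAtom (m := .stay) (by simp only [hd]; rfl) hp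
        (update_tracks fun j => by simp only [decDigits]; grind) hlen hlen)⟩
    | false =>
      obtain ⟨q, hq, h⟩ := ih (τ := Function.update τ v (pre ++ [true] ++ true :: l)) (pre ++ [true])
        (by simp at hs ⊢; omega) (by simp) (by simp at hs ⊢; omega)
      refine ⟨q, hq, .loop_step (runs_workAtom (m := .right) (by simp only [hd]; rfl) hp
        (update_tracks (l := pre ++ [true] ++ true :: l) fun j => ?_) hlen
        (by simp [HeadMove.apply] at hs ⊢; omega)) (s' := 1) ?_⟩
      · grind
      · simpa [HeadMove.apply, decDigits] using h

theorem runs_decSweep {v : V} {p : ℕ} {o : List B} (hp : p ≤ w.length + 1)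
    (hs : (τ v).length < s) :
    ∃ q < s, (decSweep v).Runs (tapeDevice _ B w) (fun c => c.workPos < s)
      ⟨p, tracks τ, 0, o⟩ () ⟨p, tracks (Function.update τ v (decDigits (τ v))), q, o⟩ := by
  have hlen : 0 < s := by omega
  rcases hτ : τ v with _ | ⟨_ | _, l⟩
  · have hd : (tracks τ 0).2 v = none := by simp [tracks, hτ]
    refine ⟨0, hlen, .loop_exit (runs_workAtom (m := .stay) (by simp only [hd]; rfl) hp
      ?_ hlen hlen)⟩
    rw [Function.update_eq_self, decDigits, ← hτ, Function.update_eq_self]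
  · have hd : (tracks τ 0).2 v = some false := by simp [tracks, hτ]
    obtain ⟨q, hq, h⟩ := runs_decSweep_borrow (B := B) (o := o) (v := v) (s := s)
      (τ := Function.update τ v (true :: l)) hp [] l (by simpa [hτ] using hs) (by simp)
    refine ⟨q, hq, .loop_step (runs_workAtom (m := .right) (by simp only [hd]; rfl) hp
      (update_tracks (l := true :: l) fun j => ?_) hlen ?_) (s' := 1) ?_⟩
    · grind
    · simp [HeadMove.apply, hτ] at hs ⊢; omega
    · simpa [HeadMove.apply, decDigits] using h
  · have hd : (tracks τ 0).2 v = some true := by simp [tracks, hτ]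
    exact ⟨0, hlen, .loop_exit (runs_workAtom (m := .stay) (by simp only [hd]; rfl) hp
      (update_tracks fun j => by simp only [decDigits]; grind) hlen hlen)⟩

/-- Execute an instruction of a counter machine, whose counters are stored on the tracks. -/
def execCounter : CounterInstr V B → TapeProg A (TrackSymbol V) B Unit
  | .nop => .atom fun o => ((), ⟨.stay, o.2, .stay, []⟩)
  | .inc v => (incSweep v).bind fun _ => home
  | .dec v => (decSweep v).bind fun _ => home
  | .left => .atom fun o => ((), ⟨.left, o.2, .stay, []⟩)
  | .right => .atom fun o => ((), ⟨.right, o.2, .stay, []⟩)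
  | .emit b => .atom fun o => ((), ⟨.stay, o.2, .stay, [b]⟩)

/-- The configuration of the tapes that represents a configuration of a counter machine. -/
def encode (c : CounterConfig V B) : TapeConfig (TrackSymbol V) B :=
  ⟨c.pos, tracks fun v => bijDigits (c.reg v), 0, c.out⟩

omit [DecidableEq V] in
theorem runs_encode_atom {N : ℕ} {c c' : CounterConfig V B} (h : c.Bounded w.length N)
    (h' : c'.Bounded w.length N) (hc : c'.reg = c.reg) {m : HeadMove} {l : List B}
    (hm : c'.pos = m.apply c.pos) (hl : c'.out = c.out ++ l) (hs : 0 < s) :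
    (Control.atom fun o : TapeSymbol A × TrackSymbol V => ((), ⟨m, o.2, .stay, l⟩)).Runs
      (tapeDevice _ B w) (fun c => c.workPos < s) (encode c) () (encode c') := by
  have := Control.runs_atom (D := tapeDevice _ B w) (ok := fun c => c.workPos < s)
    (c := encode c) (fun o : TapeSymbol A × TrackSymbol V => ((), ⟨m, o.2, .stay, l⟩)) hs hs
  convert this using 1
  simp [encode, tapeDevice, hc, hl, ← hm, show HeadMove.stay.apply 0 = 0 from rfl, h'.2]

theorem runs_execCounter (i : CounterInstr V B) {N : ℕ} {c : CounterConfig V B}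
    (h : c.Bounded w.length N) (h' : ((counterDevice B w).exec i c).Bounded w.length N)
    (hs : Nat.log 2 (N + 1) + 2 ≤ s) :
    (execCounter i).Runs (tapeDevice _ B w) (fun c => c.workPos < s) (encode c) ()
      (encode ((counterDevice B w).exec i c)) := by
  have hlen : ∀ v, (bijDigits (c.reg v)).length < s := fun v => by
    have := (length_bijDigits_le (c.reg v)).trans
      (Nat.log_mono_right (Nat.add_le_add_right (h.1 v) 1))
    omega
  cases i with
  | nop => exact runs_encode_atom h h' rfl rfl (by simp [counterDevice]) (by omega)
  | left => exact runs_encode_atom h h' rfl rfl (by simp [counterDevice]) (by omega)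
  | right => exact runs_encode_atom h h' rfl rfl (by simp [counterDevice]) (by omega)
  | emit b => exact runs_encode_atom h h' rfl rfl (by simp [counterDevice]) (by omega)
  | inc v =>
    obtain ⟨q, hq, hr⟩ := runs_incSweep (B := B) (o := c.out) (v := v) (s := s)
      (τ := fun v => bijDigits (c.reg v)) h.2 [] _ (hlen v) rfl
    have hfun : Function.update (fun v => bijDigits (c.reg v)) v ([] ++ incDigits (bijDigits (c.reg v))) =
        fun u => bijDigits (((counterDevice B w).exec (.inc v) c).reg u) := by
      funext u
      by_cases hu : u = v
      · subst hu; simp [counterDevice, bijDigits]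
      · simp [counterDevice, CounterConfig.set_reg_of_ne, hu]
    rw [hfun] at hr
    exact hr.bind (runs_home hq h.2)
  | dec v =>
    obtain ⟨q, hq, hr⟩ := runs_decSweep (B := B) (o := c.out) (v := v) (s := s)
      (τ := fun v => bijDigits (c.reg v)) h.2 (hlen v)
    have hfun : Function.update (fun v => bijDigits (c.reg v)) v (decDigits (bijDigits (c.reg v))) =
        fun u => bijDigits (((counterDevice B w).exec (.dec v) c).reg u) := by
      funext u
      by_cases hu : u = v
      · subst hu; simp [counterDevice, decDigits_bijDigits]
      · simp [counterDevice, CounterConfig.set_reg_of_ne, hu]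
    rw [hfun] at hr
    exact hr.bind (runs_home hq h.2)

end TapeProg

/-- A counter bounded by `(n + 2) ^ k` has `O(log n)` digits: use `n + 2 ≤ 2 ^ (log n + 2)` and
absorb the summand `1` into one more factor `n + 2`. -/
theorem log_two_add_two_pow_le (n k : ℕ) :
    Nat.log 2 ((n + 2) ^ k + 1) + 2 ≤ (2 * k + 4) * (Nat.log 2 n + 1) := by
  have h₁ : n + 2 ≤ 2 ^ (Nat.log 2 n + 2) := by
    have := Nat.lt_pow_succ_log_self (b := 2) (by norm_num) n
    have h1 : 1 ≤ 2 ^ Nat.log 2 n := Nat.one_le_two_pow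
    rw [pow_succ] at this ⊢
    rw [pow_succ]
    omega
  have h₂ : (n + 2) ^ k + 1 ≤ (n + 2) ^ (k + 1) := by
    have : 1 ≤ (n + 2) ^ k := Nat.one_le_pow _ _ (by omega)
    rw [pow_succ]; nlinarith
  have h₃ : (n + 2) ^ k + 1 ≤ 2 ^ ((Nat.log 2 n + 2) * (k + 1)) := by
    rw [pow_mul]
    exact h₂.trans (Nat.pow_le_pow_left h₁ _)
  have h₄ := Nat.log_mono_right (b := 2) h₃
  rw [Nat.log_pow (by norm_num)] at h₄
  nlinarith

/-- A function computed by a counter machine with polynomially bounded counters is computable in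
logarithmic space. -/
theorem CounterComputable.logspaceComputable {A B : Type} [Finite A] {f : List A → List B}
    (hf : CounterComputable f) : LogspaceComputable f := by
  obtain ⟨V, _, _, F, k, hF⟩ := hf
  have : Finite (CounterObs A V) := inferInstance
  -- Blank squares are unmarked, so the program first marks the leftmost square, which `home` has to
  -- recognise.
  refine TapeProg.logspaceComputable (W := TrackSymbol V) (false, fun _ => none)
    (Control.bind (E := Unit) (.atom fun o => ((), ⟨.stay, (true, o.2.2), .stay, []⟩)) fun _ =>
      (Control.transl (T := Unit)
        (.atom fun o : TapeSymbol A × TrackSymbol V =>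
          ((o.1, fun v => (o.2.2 v).isSome), ⟨.stay, o.2, .stay, []⟩))
        (fun i _ => TapeProg.execCounter i) F ()).map fun _ => ()) (2 * k + 4) fun w => ?_
  obtain ⟨c, hc, hout⟩ := hF w
  have hs := log_two_add_two_pow_le w.length k
  set s := (2 * k + 4) * (Nat.log 2 w.length + 1)
  have hs₀ : 0 < s := by omega
  obtain ⟨⟨⟩, d, hd, rfl⟩ := Control.Runs.transl (D' := tapeDevice _ B w)
    (ok' := fun c => c.workPos < s)
    (rd := .atom fun o : TapeSymbol A × TrackSymbol V =>
          ((o.1, fun v => (o.2.2 v).isSome), ⟨.stay, o.2, .stay, []⟩))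
    (im := fun i _ => TapeProg.execCounter i) (T := Unit)
    (fun c _ c' => c' = TapeProg.encode c)
    (by
      rintro c _ _ h rfl
      refine ⟨_, ?_, rfl⟩
      have := TapeProg.runs_workAtom (w := w) (s := s) (o := c.out) (p := c.pos) (q := 0)
        (T := tracks fun v => bijDigits (c.reg v)) (m := .stay)
        (f := fun o : TapeSymbol A × TrackSymbol V =>
          ((o.1, fun v => (o.2.2 v).isSome), ⟨.stay, o.2, .stay, []⟩)) rfl h.2
        (Function.update_eq_self _ _) hs₀ hs₀
      -- Zero is the empty numeral, so a look at the leftmost square tells which counters are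
      -- nonzero.
      have hobs : (counterDevice B w).obs c = (Transducer.inputSymbol w c.pos,
          fun v => (((tracks fun v => bijDigits (c.reg v)) 0).2 v).isSome) := by
        refine Prod.ext rfl ?_
        funext v
        rw [Bool.eq_iff_iff]
        simp [counterDevice, tracks, ← bijDigits_eq_nil, List.length_pos_iff]
      rw [hobs]
      exact this)
    (fun i c _ _ h h' hR => ⟨(), _, hR ▸ TapeProg.runs_execCounter i h h' hs, rfl⟩) hc (t := ()) rfl
  refine ⟨_, Control.Runs.bind (e := ()) (c' := TapeProg.encode (CounterConfig.init V B)) ?_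
    (hd.map fun _ => ()), hout⟩
  refine TapeProg.runs_workAtom (m := .stay) rfl (Nat.zero_le _) ?_ hs₀ hs₀
  · funext i
    by_cases hi : i = 0
    · subst hi; simp [tracks, CounterConfig.init, bijDigits]
    · simp [tracks, CounterConfig.init, bijDigits, hi]

/-! ### Counter machines simulate transducers -/

namespace CounterProg

open CounterConfig

set_option linter.unusedSectionVars false

variable {A V B : Type} [Finite A] [DecidableEq V] {w : List A} {l N : ℕ} {c : CounterConfig V B}

/-- Divide the counter `x` by `b + 1`, and exit with the remainder.  The counter `t` must be
zero. -/
def popDigit (b : ℕ) (x t : V) : CounterProg A V B (Fin (b + 1)) :=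
  Control.bind (.loop (S := Fin (b + 1)) (fun j => ite x
    (seq (op (.dec x)) (if h : j.1 + 1 < b + 1 then pure (.inl ⟨j.1 + 1, h⟩) else
      seq (op (.inc t)) (pure (.inl 0))))
    (pure (.inr j))) 0) fun d => seq (drain t x 1) (pure d)

/-- Here `n` is still to be divided, `q` is the quotient so far and `j` the remainder so far, so `n
+ (b + 1) * q + j` is invariant. -/
theorem runs_popDigit_loop {b : ℕ} {x t : V} (hxt : x ≠ t) (n q : ℕ) (j : Fin (b + 1))
    (h : c.Bounded l N) (hN : n + q ≤ N) :
    Control.Runs (counterDevice B w) (Bounded l N)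
      (.loop (S := Fin (b + 1)) (fun j => ite x
        (seq (op (.dec x)) (if h : j.1 + 1 < b + 1 then pure (.inl ⟨j.1 + 1, h⟩) else
          seq (op (.inc t)) (pure (.inl 0))))
        (pure (.inr j))) j)
      ((c.set x n).set t q) (Fin.ofNat (b + 1) (n + j.1))
      ((c.set x 0).set t (q + (n + j.1) / (b + 1))) := by
  have hb : ∀ n q : ℕ, n + q ≤ N → ((c.set x n).set t q).Bounded l N :=
    fun n q hn => (h.set x (by omega)).set t (by omega)
  induction n generalizing q j with
  | zero =>
    have hj : Fin.ofNat (b + 1) (0 + j.1) = j := by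
      ext; simp [Nat.mod_eq_of_lt j.2]
    rw [hj, zero_add, Nat.div_eq_of_lt j.2]
    exact .loop_exit (Control.Runs.ite_neg (by simp [set_reg_of_ne _ _ hxt])
      (runs_pure _ (hb _ _ hN)))
  | succ n ih =>
    have hdec := runs_dec (w := w) (v := x) (hb _ _ hN)
    rw [set_comm _ _ _ hxt, set_reg_of_ne _ _ hxt, set_reg_self, set_set, Nat.add_sub_cancel]
      at hdec
    by_cases hj : j.1 + 1 < b + 1
    · have := ih q ⟨j.1 + 1, hj⟩ (by omega)
      rw [show n + (⟨j.1 + 1, hj⟩ : Fin (b + 1)).1 = n + 1 + j.1 by simp; omega] at this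
      refine .loop_step (Control.Runs.ite_pos (by simp [set_reg_of_ne _ _ hxt]) (hdec.seq ?_)) this
      rw [dif_pos hj]
      exact runs_pure _ (hb _ _ (by omega))
    · have hj' : j.1 = b := by omega
      have := ih (q + 1) 0 (by omega)
      have hinc := runs_inc (w := w) (v := t) (hb n q (by omega)) (by simp; omega)
      rw [set_reg_self, set_set] at hinc
      have e₁ : Fin.ofNat (b + 1) (n + (0 : Fin (b + 1)).1) = Fin.ofNat (b + 1) (n + 1 + j.1) := by
        ext
        rw [Fin.val_ofNat, Fin.val_ofNat, hj', add_assoc, add_comm 1 b, Nat.add_mod_right]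
        simp
      have e₂ : q + 1 + (n + (0 : Fin (b + 1)).1) / (b + 1) = q + (n + 1 + j.1) / (b + 1) := by
        rw [hj', add_assoc n, add_comm 1 b, Nat.add_div_right _ (Nat.succ_pos b)]
        simp; omega
      rw [e₁, e₂] at this
      refine .loop_step (Control.Runs.ite_pos (by simp [set_reg_of_ne _ _ hxt]) (hdec.seq ?_)) this
      rw [dif_neg hj]
      exact hinc.seq (runs_pure _ (hb _ _ (by omega)))

theorem runs_popDigit {b : ℕ} {x t : V} (hxt : x ≠ t) (h : c.Bounded l N) (ht : c.reg t = 0)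
    {q : ℕ} {d : Fin (b + 1)} (hx : c.reg x = (b + 1) * q + d.1) :
    (popDigit b x t).Runs (counterDevice B w) (Bounded l N) c d (c.set x q) := by
  have := runs_popDigit_loop (w := w) (b := b) hxt (c.reg x) 0 0 h (by simpa using h.1 x)
  rw [set_eq_self (n := c.reg x) _ rfl, set_eq_self _ ht] at this
  have e₁ : Fin.ofNat (b + 1) (c.reg x + (0 : Fin (b + 1)).1) = d := by
    ext; simp [hx, Nat.mod_eq_of_lt d.2]
  have e₂ : 0 + (c.reg x + (0 : Fin (b + 1)).1) / (b + 1) = q := by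
    simp [hx, Nat.mul_add_div, Nat.div_eq_of_lt d.2]
  rw [e₁, e₂] at this
  refine this.bind ?_
  have hd := runs_drain (w := w) (v := x) hxt.symm 1 this.ok_end (by
    have := h.1 x
    simp [set_reg_of_ne _ _ hxt]
    nlinarith)
  refine hd.seq ?_
  convert runs_pure (w := w) d hd.ok_end using 1
  ext u <;> simp [set_reg, hxt]
  split_ifs <;> simp_all

/-- Multiply the counter `x` by `b` and add `d`.  The counter `t` must be zero. -/
def pushDigit (b : ℕ) (x t : V) (d : ℕ) : CounterProg A V B Unit :=
  seq (drain x t b) (seq (drain t x 1) (incBy x d))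

theorem runs_pushDigit {b : ℕ} {x t : V} (hxt : x ≠ t) {d : ℕ} (h : c.Bounded l N)
    (ht : c.reg t = 0) (hN : b * c.reg x + d ≤ N) :
    (pushDigit b x t d).Runs (counterDevice B w) (Bounded l N) c ()
      (c.set x (b * c.reg x + d)) := by
  have h₁ := runs_drain (w := w) hxt b h (by omega)
  refine h₁.seq ?_
  have h₂ := runs_drain (w := w) hxt.symm 1 h₁.ok_end (by
    simp [ht, set_reg_of_ne _ _ hxt]; omega)
  refine h₂.seq ?_
  have h₃ := runs_incBy (w := w) x d h₂.ok_end (by simp [ht, set_reg_of_ne _ _ hxt]; omega)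
  convert h₃ using 1
  ext u <;> simp [set_reg, ht, hxt]
  split_ifs <;> simp_all

/-- Write a list on the output tape. -/
def emitList : List B → CounterProg A V B Unit
  | [] => pure ()
  | b :: bs => seq (op (.emit b)) (emitList bs)

theorem runs_emitList (bs : List B) (h : c.Bounded l N) :
    (emitList bs).Runs (counterDevice B w) (Bounded l N) c () { c with out := c.out ++ bs } := by
  induction bs generalizing c with
  | nil => simpa [emitList] using runs_pure (w := w) () h
  | cons b bs ih =>
    refine (runs_op (w := w) (i := .emit b) h h).seq ?_
    have := ih (c := { c with out := c.out ++ [b] }) h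
    simpa [counterDevice] using this

end CounterProg

/-! ### The two halves of a work tape as numbers in base `b` -/

section StackCode

variable {W : Type} (b : ℕ) (code : W → ℕ) (T : ℕ → W)

/-- The squares to the left of square `p`, as a number in base `b`. -/
def leftCode : ℕ → ℕ
  | 0 => 0
  | p + 1 => b * leftCode p + code (T p)

/-- The `m` squares from square `p` on, as a number in base `b`. -/
def rightCode (p : ℕ) : ℕ → ℕ
  | 0 => 0
  | m + 1 => b * rightCode (p + 1) m + code (T p)

variable {b code T}

theorem leftCode_lt (hcode : ∀ x, code x < b) (p : ℕ) : leftCode b code T p < b ^ p := by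
  induction p with
  | zero => simp [leftCode]
  | succ p ih =>
    rw [leftCode, pow_succ, mul_comm (b ^ p)]
    have := hcode (T p)
    calc b * leftCode b code T p + code (T p) < b * leftCode b code T p + b := by omega
      _ = b * (leftCode b code T p + 1) := by ring
      _ ≤ b * b ^ p := Nat.mul_le_mul_left _ ih

theorem rightCode_lt (hcode : ∀ x, code x < b) (p m : ℕ) : rightCode b code T p m < b ^ m := by
  induction m generalizing p with
  | zero => simp [rightCode]
  | succ m ih =>
    rw [rightCode, pow_succ, mul_comm (b ^ m)]
    have := hcode (T p)
    calc b * rightCode b code T (p + 1) m + code (T p)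
        < b * rightCode b code T (p + 1) m + b := by omega
      _ = b * (rightCode b code T (p + 1) m + 1) := by ring
      _ ≤ b * b ^ m := Nat.mul_le_mul_left _ (ih _)

theorem leftCode_congr {T' : ℕ → W} {p : ℕ} (h : ∀ i < p, T i = T' i) :
    leftCode b code T p = leftCode b code T' p := by
  induction p with
  | zero => rfl
  | succ p ih =>
    rw [leftCode, leftCode, ih fun i hi => h i (by omega), h p (by omega)]

theorem rightCode_congr {T' : ℕ → W} {p m : ℕ} (h : ∀ i ≥ p, T i = T' i) :
    rightCode b code T p m = rightCode b code T' p m := by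
  induction m generalizing p with
  | zero => rfl
  | succ m ih =>
    rw [rightCode, rightCode, ih fun i hi => h i (by omega), h p le_rfl]

theorem rightCode_const {x : W} (hx : code x = 0) (p m : ℕ) :
    rightCode b code (fun _ => x) p m = 0 := by
  induction m generalizing p with
  | zero => rfl
  | succ m ih => simp [rightCode, ih, hx]

end StackCode

/-! ### Instructions of a transducer executed on counters -/

namespace CounterProg

open CounterConfig

variable {A W B : Type} [Finite A] {w : List A} {N S : ℕ} {b : ℕ} {code : W → ℕ}

/-- The counters `0` and `1` hold the parts of the work tape to the left and to the right of the
head, the counter `2` is scratch space, and the counter `3` holds the position of the head. -/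
def stackConfig (p L R h : ℕ) (o : List B) : CounterConfig (Fin 4) B := ⟨p, ![L, R, 0, h], o⟩

theorem stackConfig_set_zero (p L R h n : ℕ) (o : List B) :
    (stackConfig p L R h o).set 0 n = stackConfig p n R h o := by
  ext i <;> simp [stackConfig]
  fin_cases i <;> simp [set_reg]

theorem stackConfig_set_one (p L R h n : ℕ) (o : List B) :
    (stackConfig p L R h o).set 1 n = stackConfig p L n h o := by
  ext i <;> simp [stackConfig]
  fin_cases i <;> simp [set_reg]

theorem stackConfig_set_three (p L R h n : ℕ) (o : List B) :
    (stackConfig p L R h o).set 3 n = stackConfig p L R n o := by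
  ext i <;> simp [stackConfig]
  fin_cases i <;> simp [set_reg]

theorem bounded_stackConfig {l p L R h : ℕ} {o : List B} :
    (stackConfig p L R h o).Bounded l N ↔ (L ≤ N ∧ R ≤ N ∧ h ≤ N) ∧ p ≤ l + 1 := by
  simp [Bounded, stackConfig, Fin.forall_fin_succ]

/-- Read the scanned symbols of the input and of the work tape. -/
def readTapes (b : ℕ) (decode : ℕ → W) : CounterProg A (Fin 4) B (TapeSymbol A × W) :=
  symbol.bind fun a => (popDigit b 1 2).bind fun d => seq (pushDigit (b + 1) 1 2 d.1)
    (pure (a, decode d.1))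

/-- Move the input head. -/
def moveInput : HeadMove → CounterProg A (Fin 4) B Unit
  | .left => op .left
  | .stay => pure ()
  | .right => symbol.bind fun a => match a with
    | .rightEnd => pure ()
    | _ => op .right

/-- Overwrite the scanned symbol of the work tape. -/
def writeWork (b : ℕ) (d : ℕ) : CounterProg A (Fin 4) B Unit :=
  (popDigit b 1 2).bind fun _ => pushDigit (b + 1) 1 2 d

/-- Move the head of the work tape. -/
def moveWork (b : ℕ) : HeadMove → CounterProg A (Fin 4) B Unit
  | .left => ite 3 (seq (op (.dec 3)) ((popDigit b 0 2).bind fun d => pushDigit (b + 1) 1 2 d.1))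
      (pure ())
  | .stay => pure ()
  | .right => seq (op (.inc 3)) ((popDigit b 1 2).bind fun d => pushDigit (b + 1) 0 2 d.1)

/-- Execute an instruction of a transducer. -/
def execTape (b : ℕ) (code : W → ℕ) (i : TapeInstr W B) : CounterProg A (Fin 4) B Unit :=
  seq (moveInput i.inputMove) (seq (writeWork b (code i.write))
    (seq (moveWork b i.workMove) (emitList i.output)))

variable {p L R h d : ℕ} {o : List B}

theorem runs_popDigit_zero (d : Fin (b + 1))
    (hb : (stackConfig p ((b + 1) * L + d) R h o).Bounded w.length N) :
    (popDigit b 0 2).Runs (counterDevice B w) (Bounded w.length N)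
      (stackConfig p ((b + 1) * L + d) R h o) d (stackConfig p L R h o) := by
  have := runs_popDigit (w := w) (b := b) (x := 0) (t := 2) (d := d) (by decide) hb rfl rfl
  rwa [stackConfig_set_zero] at this

theorem runs_popDigit_one (d : Fin (b + 1))
    (hb : (stackConfig p L ((b + 1) * R + d) h o).Bounded w.length N) :
    (popDigit b 1 2).Runs (counterDevice B w) (Bounded w.length N)
      (stackConfig p L ((b + 1) * R + d) h o) d (stackConfig p L R h o) := by
  have := runs_popDigit (w := w) (b := b) (x := 1) (t := 2) (d := d) (by decide) hb rfl rfl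
  rwa [stackConfig_set_one] at this

theorem runs_pushDigit_zero (hb : (stackConfig p L R h o).Bounded w.length N)
    (hb' : (stackConfig p ((b + 1) * L + d) R h o).Bounded w.length N) :
    (pushDigit (b + 1) 0 2 d).Runs (counterDevice B w) (Bounded w.length N)
      (stackConfig p L R h o) () (stackConfig p ((b + 1) * L + d) R h o) := by
  have := runs_pushDigit (w := w) (b := b + 1) (x := 0) (t := 2) (d := d) (by decide) hb rfl
    (hb'.1 0)
  rwa [stackConfig_set_zero] at this

theorem runs_pushDigit_one (hb : (stackConfig p L R h o).Bounded w.length N)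
    (hb' : (stackConfig p L ((b + 1) * R + d) h o).Bounded w.length N) :
    (pushDigit (b + 1) 1 2 d).Runs (counterDevice B w) (Bounded w.length N)
      (stackConfig p L R h o) () (stackConfig p L ((b + 1) * R + d) h o) := by
  have := runs_pushDigit (w := w) (b := b + 1) (x := 1) (t := 2) (d := d) (by decide) hb rfl
    (hb'.1 1)
  rwa [stackConfig_set_one] at this

theorem inputSymbol_eq_rightEnd {p : ℕ} (hp : p ≤ w.length + 1) :
    Transducer.inputSymbol w p = .rightEnd ↔ p = w.length + 1 := by
  cases p with
  | zero => simp [Transducer.inputSymbol]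
  | succ p =>
    rcases lt_or_ge p w.length with h | h
    · simp [Transducer.inputSymbol, h, h.ne]
    · simp [Transducer.inputSymbol, h]; omega

theorem runs_moveInput (m : HeadMove) (hc : (stackConfig p L R h o).Bounded w.length N) :
    (moveInput m).Runs (counterDevice B w) (Bounded w.length N) (stackConfig p L R h o) ()
      (stackConfig (min (m.apply p) (w.length + 1)) L R h o) := by
  have hp : p ≤ w.length + 1 := hc.2
  cases m with
  | left =>
    rw [show min (HeadMove.left.apply p) (w.length + 1) = p - 1 by simp [HeadMove.apply]; omega]
    exact runs_op (w := w) (i := .left) hc ⟨hc.1, by simp [counterDevice, stackConfig]; omega⟩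
  | stay =>
    rw [show min (HeadMove.stay.apply p) (w.length + 1) = p by simp [HeadMove.apply]; omega]
    exact runs_pure _ hc
  | right =>
    refine (runs_symbol hc).bind ?_
    by_cases hr : p = w.length + 1
    · have := (inputSymbol_eq_rightEnd hp).2 hr
      rw [show min (HeadMove.right.apply p) (w.length + 1) = p by simp [HeadMove.apply]; omega,
        show (stackConfig p L R h o).pos = p from rfl, this]
      exact runs_pure _ hc
    · have := (inputSymbol_eq_rightEnd hp).not.2 hr
      rw [show min (HeadMove.right.apply p) (w.length + 1) = p + 1 by simp [HeadMove.apply]; omega,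
        show (stackConfig p L R h o).pos = p from rfl]
      have hop := runs_op (w := w) (i := .right) hc
        ⟨hc.1, by simp [counterDevice, stackConfig]; omega⟩
      rcases hs : Transducer.inputSymbol w p with _ | _ | _
      · exact hop
      · exact hop
      · exact absurd hs this

/-- The counter configuration that represents a configuration of the tapes, if only the first `S`
squares of the work tape are used. -/
def stackRep (b : ℕ) (code : W → ℕ) (S : ℕ) (c : TapeConfig W B) : CounterConfig (Fin 4) B :=
  stackConfig c.inputPos (leftCode b code c.work c.workPos)
    (rightCode b code c.work c.workPos (S - c.workPos)) c.workPos c.out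

/-- Each half of the tape is a numeral of at most `S` digits. The base is written `b + 2` because it
must be at least `2` for the head position, at most `S`, to obey the same bound. -/
theorem bounded_stackRep (hcode : ∀ x, code x < b + 2) (hN : (b + 2) ^ S ≤ N) {c : TapeConfig W B}
    (hc : c.workPos ≤ S) (hp : c.inputPos ≤ w.length + 1) :
    (stackRep (b + 2) code S c).Bounded w.length N := by
  refine bounded_stackConfig.2 ⟨⟨?_, ?_, ?_⟩, hp⟩
  · exact (leftCode_lt hcode _).le.trans ((Nat.pow_le_pow_right (by omega) hc).trans hN)
  · exact (rightCode_lt hcode _ _).le.trans ((Nat.pow_le_pow_right (by omega) (by omega)).trans hN)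
  · exact hc.trans ((Nat.lt_pow_self (by omega)).le.trans hN)

theorem rightCode_pos {T : ℕ → W} {p : ℕ} (h : p < S) :
    rightCode b code T p (S - p) = b * rightCode b code T (p + 1) (S - (p + 1)) + code (T p) := by
  rw [show S - p = (S - (p + 1)) + 1 by omega, rightCode]

theorem runs_readTapes (hcode : ∀ x, code x < b + 2) (hN : (b + 2) ^ S ≤ N) {decode : ℕ → W}
    (hdecode : ∀ x, decode (code x) = x) {c : TapeConfig W B} (hc : c.workPos < S)
    (hp : c.inputPos ≤ w.length + 1) :
    (readTapes (b + 1) decode).Runs (counterDevice B w) (Bounded w.length N)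
      (stackRep (b + 2) code S c) ((tapeDevice W B w).obs c) (stackRep (b + 2) code S c) := by
  have hb := bounded_stackRep hcode hN hc.le hp
  refine (runs_symbol hb).bind ?_
  rw [stackRep, rightCode_pos hc] at hb ⊢
  have h₁ := runs_popDigit_one ⟨code (c.work c.workPos), hcode _⟩ hb
  refine h₁.bind ((runs_pushDigit_one h₁.ok_end hb).seq ?_)
  have := runs_pure (w := w) (E := TapeSymbol A × W) ((tapeDevice W B w).obs c) hb
  simp only [hdecode]
  exact this

theorem runs_writeWork (hcode : ∀ x, code x < b + 2) (hN : (b + 2) ^ S ≤ N) {c : TapeConfig W B}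
    (hc : c.workPos < S) (hp : c.inputPos ≤ w.length + 1) (x : W) :
    (writeWork (b + 1) (code x)).Runs (counterDevice B w) (Bounded w.length N)
      (stackRep (b + 2) code S c) ()
      (stackRep (b + 2) code S { c with work := Function.update c.work c.workPos x }) := by
  have hb := bounded_stackRep hcode hN hc.le hp
  have hb' := bounded_stackRep (c := { c with work := Function.update c.work c.workPos x })
    hcode hN hc.le hp
  rw [stackRep, rightCode_pos hc] at hb ⊢
  rw [stackRep, rightCode_pos (p := c.workPos) hc] at hb' ⊢
  have hl : leftCode (b + 2) code (Function.update c.work c.workPos x) c.workPos =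
      leftCode (b + 2) code c.work c.workPos :=
    leftCode_congr fun i hi => Function.update_of_ne hi.ne _ _
  have hr : rightCode (b + 2) code (Function.update c.work c.workPos x) (c.workPos + 1)
      (S - (c.workPos + 1)) = rightCode (b + 2) code c.work (c.workPos + 1)
      (S - (c.workPos + 1)) :=
    rightCode_congr fun i hi => Function.update_of_ne (by omega) _ _
  simp only [hl, hr, Function.update_self] at hb' ⊢
  have h₁ := runs_popDigit_one ⟨code (c.work c.workPos), hcode _⟩ hb
  exact h₁.bind (runs_pushDigit_one h₁.ok_end hb')

theorem runs_moveWork (hcode : ∀ x, code x < b + 2) (hN : (b + 2) ^ S ≤ N) {c : TapeConfig W B}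
    (hc : c.workPos < S) (hp : c.inputPos ≤ w.length + 1) (m : HeadMove)
    (hm : m.apply c.workPos < S) :
    (moveWork (b + 1) m).Runs (counterDevice B w) (Bounded w.length N)
      (stackRep (b + 2) code S c) ()
      (stackRep (b + 2) code S { c with workPos := m.apply c.workPos }) := by
  have hb := bounded_stackRep hcode hN hc.le hp
  have hb' := bounded_stackRep (c := { c with workPos := m.apply c.workPos })
    hcode hN hm.le hp
  cases m with
  | stay => exact runs_pure _ hb
  | right =>
    have hm' : c.workPos + 1 < S := hm
    rw [stackRep, rightCode_pos hc] at hb ⊢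
    rw [stackRep, show HeadMove.right.apply c.workPos = c.workPos + 1 from rfl, leftCode] at hb' ⊢
    have h₀ := runs_inc (w := w) (v := 3) hb
      (show c.workPos + 1 ≤ N from (Nat.lt_pow_self (by omega)).le.trans
        ((Nat.pow_le_pow_right (n := b + 2) (by omega) hm'.le).trans hN))
    rw [stackConfig_set_three] at h₀
    have h₁ := runs_popDigit_one ⟨code (c.work c.workPos), hcode _⟩ h₀.ok_end
    exact h₀.seq (h₁.bind (runs_pushDigit_zero h₁.ok_end hb'))
  | left =>
    -- On square `0` a move to the left has no effect. The stack code alone cannot tell that the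
    -- left half is empty rather than blank; the counter `3` is there for this test.
    rcases hq : c.workPos with _ | q
    · refine Control.Runs.ite_neg hq ?_
      rw [show HeadMove.left.apply 0 = c.workPos by simp [HeadMove.apply, hq]]
      exact runs_pure _ hb
    · refine Control.Runs.ite_pos (by simp [stackRep, stackConfig, hq]) ?_
      have hqS : q < S := by omega
      rw [stackRep, hq] at hb ⊢
      rw [leftCode] at hb ⊢
      rw [stackRep, hq, show HeadMove.left.apply (q + 1) = q from rfl,
        rightCode_pos (p := q) hqS] at hb'
      rw [stackRep, show HeadMove.left.apply (q + 1) = q from rfl, rightCode_pos (p := q) hqS]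
      have h₀ := runs_dec (w := w) (v := 3) hb
      rw [stackConfig_set_three, show (stackConfig c.inputPos
        ((b + 2) * leftCode (b + 2) code c.work q + code (c.work q))
        (rightCode (b + 2) code c.work (q + 1) (S - (q + 1))) (q + 1) c.out).reg 3 - 1 = q from rfl]
        at h₀
      have h₁ := runs_popDigit_zero ⟨code (c.work q), hcode _⟩ h₀.ok_end
      exact h₀.seq (h₁.bind (runs_pushDigit_one h₁.ok_end hb'))

theorem runs_execTape (hcode : ∀ x, code x < b + 2) (hN : (b + 2) ^ S ≤ N) {c : TapeConfig W B}
    (hc : c.workPos < S) (hp : c.inputPos ≤ w.length + 1) (i : TapeInstr W B)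
    (hi : i.workMove.apply c.workPos < S) :
    (execTape (b + 1) code i).Runs (counterDevice B w) (Bounded w.length N)
      (stackRep (b + 2) code S c) () (stackRep (b + 2) code S ((tapeDevice W B w).exec i c)) := by
  have hp' : min (i.inputMove.apply c.inputPos) (w.length + 1) ≤ w.length + 1 := min_le_right _ _
  refine (runs_moveInput _ (bounded_stackRep hcode hN hc.le hp)).seq ?_
  refine (runs_writeWork (c := { c with
    inputPos := min (i.inputMove.apply c.inputPos) (w.length + 1) }) hcode hN hc hp' i.write).seq ?_
  have := runs_moveWork (c := { c with
    inputPos := min (i.inputMove.apply c.inputPos) (w.length + 1)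
    work := Function.update c.work c.workPos i.write }) hcode hN hc hp' i.workMove hi
  exact this.seq (runs_emitList _ this.ok_end)

end CounterProg

/-! ### Transducers as programs -/

namespace Transducer

variable {A B : Type}

/-- The program of a transducer. -/
def program (M : Transducer A B) : TapeProg A M.Work B Unit where
  Q := M.State
  finite := M.finiteState
  start := M.start
  act q o := match M.trans q o.1 o.2 with
    | none => (.inr (), ⟨.stay, o.2, .stay, []⟩)
    | some a => (.inl a.state, ⟨a.inputMove, a.write, a.workMove, a.output⟩)

theorem run_program {M : Transducer A B} {w : List A} {s : ℕ} {c c' : M.Config}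
    (h : Relation.ReflTransGen (fun c₁ c₂ => M.step w c₁ = some c₂) c c')
    (hc' : M.step w c' = none)
    (hs : ∀ d, Relation.ReflTransGen (fun c₁ c₂ => M.step w c₁ = some c₂) c d → d.workPos < s) :
    ∃ d, M.program.Run (tapeDevice M.Work B w) (fun c => c.workPos < s) (.inl c.state)
      ⟨c.inputPos, c.work, c.workPos, c.out⟩ () d ∧ d.out = c'.out := by
  induction h using Relation.ReflTransGen.head_induction_on with
  | refl =>
    have ht : M.trans c'.state (inputSymbol w c'.inputPos) (c'.work c'.workPos) = none := by
      simpa [step] using hc'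
    have ha : M.program.act c'.state ((tapeDevice M.Work B w).obs
        ⟨c'.inputPos, c'.work, c'.workPos, c'.out⟩) =
        (.inr (), ⟨.stay, c'.work c'.workPos, .stay, []⟩) := by
      simp [program, tapeDevice, ht]
    -- Where the transducer halts, the program makes one more step in order to exit; it rewrites the
    -- scanned symbol and writes no output.
    refine ⟨(tapeDevice M.Work B w).exec ⟨.stay, c'.work c'.workPos, .stay, []⟩
      ⟨c'.inputPos, c'.work, c'.workPos, c'.out⟩, .step _ _ _ _ (hs _ .refl) ?_, ?_⟩
    · rw [ha]
      exact .exit _ _ (hs _ .refl)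
    · simp [tapeDevice]
  | @head c c₁ h _ ih =>
    obtain ⟨d, hd, hout⟩ := ih fun d hd => hs d (hd.head h)
    refine ⟨d, .step _ _ _ _ (hs _ .refl) ?_, hout⟩
    simp only [step, Option.map_eq_some_iff] at h
    obtain ⟨a, ha, rfl⟩ := h
    have ha : M.program.act c.state ((tapeDevice M.Work B w).obs
        ⟨c.inputPos, c.work, c.workPos, c.out⟩) =
        (.inl a.state, ⟨a.inputMove, a.write, a.workMove, a.output⟩) := by
      simp [program, tapeDevice, ha]
    rw [ha]
    exact hd

end Transducer

theorem two_pow_log_succ_le (n : ℕ) : 2 ^ (Nat.log 2 n + 1) ≤ (n + 2) ^ 2 := by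
  rcases Nat.eq_zero_or_pos n with rfl | h
  · simp
  · have := Nat.pow_log_le_self 2 h.ne'
    rw [pow_succ]; nlinarith

/-- The blank is coded by `0` so that the blank tape is represented by counters that are all zero,
as they are at the start. -/
theorem exists_code (W : Type) [Finite W] (blank : W) :
    ∃ (b : ℕ) (code : W → ℕ) (decode : ℕ → W), (∀ x, code x < b + 2) ∧
      (∀ x, decode (code x) = x) ∧ code blank = 0 := by
  classical
  have := Fintype.ofFinite W
  let e := Fintype.equivFin W
  refine ⟨Fintype.card W, fun x => if x = blank then 0 else e x + 1,
    fun n => if h : n - 1 < Fintype.card W then if n = 0 then blank else e.symm ⟨n - 1, h⟩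
      else blank, fun x => ?_, fun x => ?_, if_pos rfl⟩
  · have := (e x).2
    dsimp only
    split_ifs <;> omega
  · by_cases hx : x = blank
    · simp [hx]
    · simp [hx]

/-- A function computable in logarithmic space is computed by a counter machine with polynomially
bounded counters. -/
theorem LogspaceComputable.counterComputable {A B : Type} [Finite A] {f : List A → List B}
    (hf : LogspaceComputable f) : CounterComputable f := by
  obtain ⟨M, k, hM⟩ := hf
  have := M.finiteWork
  obtain ⟨b, code, decode, hcode, hdecode, hblank⟩ := exists_code M.Work M.blank
  refine ⟨Fin 4, inferInstance, inferInstance,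
    (Control.transl (T := Unit) (CounterProg.readTapes (b + 1) decode)
      (fun i _ => CounterProg.execTape (b + 1) code i) M.program ()).map fun _ => (),
    2 * ((b + 2) * k), fun w => ?_⟩
  obtain ⟨⟨c, hc, hstep, hout⟩, hs⟩ := hM w
  set S := k * (Nat.log 2 w.length + 1)
  -- Logarithmically many squares have only polynomially many contents: bound the base by `2 ^ (b +
  -- 2)`, exchange the exponents, and use `2 ^ (log n + 1) ≤ (n + 2) ^ 2`.
  have hN : (b + 2) ^ S ≤ (w.length + 2) ^ (2 * ((b + 2) * k)) := by
    calc (b + 2) ^ S ≤ (2 ^ (b + 2)) ^ S := Nat.pow_le_pow_left Nat.lt_two_pow_self.le _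
      _ = (2 ^ (Nat.log 2 w.length + 1)) ^ ((b + 2) * k) := by
        rw [← pow_mul, ← pow_mul]; congr 1; simp only [S]; ring
      _ ≤ ((w.length + 2) ^ 2) ^ ((b + 2) * k) :=
        Nat.pow_le_pow_left (two_pow_log_succ_le _) _
      _ = _ := by rw [← pow_mul]
  obtain ⟨d, hd, hd'⟩ := Transducer.run_program hc hstep hs
  obtain ⟨⟨⟩, e, he, rfl, he'⟩ := Control.Runs.transl (D' := counterDevice B w)
    (ok' := CounterConfig.Bounded w.length ((w.length + 2) ^ (2 * ((b + 2) * k))))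
    (rd := CounterProg.readTapes (b + 1) decode)
    (im := fun i _ => CounterProg.execTape (b + 1) code i) (T := Unit)
    (fun c _ c' => c' = CounterProg.stackRep (b + 2) code S c ∧ c.inputPos ≤ w.length + 1)
    (by
      rintro c _ _ h ⟨rfl, hp⟩
      exact ⟨_, CounterProg.runs_readTapes hcode hN hdecode h hp, rfl, hp⟩)
    (by
      rintro i c _ _ h h' ⟨rfl, hp⟩
      exact ⟨(), _, CounterProg.runs_execTape hcode hN h hp i h', rfl, min_le_right _ _⟩)
    hd (t := ()) (c' := CounterConfig.init (Fin 4) B) (by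
      refine ⟨?_, Nat.zero_le _⟩
      simp only [CounterProg.stackRep, Transducer.initial, rightCode_const hblank, leftCode,
        CounterProg.stackConfig, CounterConfig.init]
      congr 1
      funext i
      fin_cases i <;> rfl)
  exact ⟨_, he.map fun _ => (), hd'.trans hout⟩

/-! ### Closure properties of the functions computed by counter machines -/

/-! ### Running time and length of the output -/

namespace Control

variable {C O I E : Type}

/-- `F`, started in the state `r` and the configuration `c`, exits after exactly `m` steps. -/
def HaltsIn (D : Device C O I) (F : Control O I E) : ℕ → F.Q ⊕ E → C → Prop
  | 0, .inr _, _ => True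
  | m + 1, .inl q, c =>
    HaltsIn D F m (F.act q (D.obs c)).1 (D.exec (F.act q (D.obs c)).2 c)
  | _, _, _ => False

/-- By determinism, the remaining running time depends only on the state and on the part `key` of
the configuration that influences observations. For counter machines this part omits the output, so
it takes finitely many values within the bounds. -/
theorem HaltsIn.unique {D : Device C O I} {F : Control O I E} {K : Type} (key : C → K)
    (hobs : ∀ c c', key c = key c' → D.obs c = D.obs c')
    (hexec : ∀ i c c', key c = key c' → key (D.exec i c) = key (D.exec i c'))
    {m m' : ℕ} {r : F.Q ⊕ E} {c c' : C} (h : HaltsIn D F m r c) (h' : HaltsIn D F m' r c')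
    (hc : key c = key c') : m = m' := by
  induction m generalizing m' r c c' with
  | zero =>
    cases r with
    | inl q => exact h.elim
    | inr e =>
      cases m' with
      | zero => rfl
      | succ m' => exact h'.elim
  | succ m ih =>
    cases r with
    | inr e => exact h.elim
    | inl q =>
      cases m' with
      | zero => exact h'.elim
      | succ m' =>
        rw [HaltsIn] at h h'
        rw [← hobs c c' hc] at h'
        rw [ih h h' (hexec _ _ _ hc)]

theorem Run.haltsIn {D : Device C O I} {F : Control O I E} {ok : C → Prop} {r c e c'}
    (h : F.Run D ok r c e c') : ∃ m, HaltsIn D F m r c ∧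
      ∀ j < m, ∃ q d, ok d ∧ HaltsIn D F (j + 1) (.inl q) d := by
  induction h with
  | exit e c h => exact ⟨0, trivial, by simp⟩
  | step q c e c' h _ ih =>
    obtain ⟨m, hm, hj⟩ := ih
    refine ⟨m + 1, hm, fun j hjm => ?_⟩
    rcases Nat.lt_succ_iff_lt_or_eq.1 hjm with hj' | rfl
    · exact hj j hj'
    · exact ⟨q, c, h, hm⟩

theorem HaltsIn.out_length_le {A V B : Type} [DecidableEq V] {w : List A}
    {F : CounterProg A V B E} {ok : CounterConfig V B → Prop} {r c e c'}
    (h : F.Run (counterDevice B w) ok r c e c') {m : ℕ}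
    (hm : HaltsIn (counterDevice B w) F m r c) : c'.out.length ≤ c.out.length + m := by
  induction h generalizing m with
  | exit e c h => omega
  | step q c e c' h _ ih =>
    cases m with
    | zero => exact hm.elim
    | succ m =>
      refine (ih hm).trans ?_
      have : ∀ i, ((counterDevice B w).exec i c).out.length ≤ c.out.length + 1 := by
        rintro (_ | _ | _ | _ | _ | _) <;> simp [counterDevice]
      have := this (F.act q ((counterDevice B w).obs c)).2
      omega

end Control

/-- At most one letter is written per step, and a halting machine never repeats a combination of
state, head position and counter values. There are polynomially many of these. -/
theorem CounterComputable.length_le {A B : Type} {f : List A → List B}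
    (hf : CounterComputable f) : ∃ k, ∀ w, (f w).length ≤ (w.length + 2) ^ k := by
  obtain ⟨V, _, _, F, k, hF⟩ := hf
  have := F.finite
  have := Fintype.ofFinite F.Q
  -- The three summands account for the states, the head positions and the counter values, each
  -- counted by a power of `w.length + 2`.
  refine ⟨Fintype.card F.Q + 1 + (k + 1) * Fintype.card V, fun w => ?_⟩
  obtain ⟨c, hc, hout⟩ := hF w
  obtain ⟨m, hm, hj⟩ := Control.Run.haltsIn hc
  have hle := Control.HaltsIn.out_length_le hc hm
  rw [hout] at hle
  refine (hle.trans (by simp [CounterConfig.init])).trans (b := m) ?_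
  choose q d hd hq using hj
  set n := w.length
  set N := (n + 2) ^ k
  -- For each `j < m` a configuration with `j + 1` steps left has been chosen; the number of
  -- remaining steps recovers `j`.
  have hinj : Function.Injective (fun j : Fin m => (q j.1 j.2,
      (⟨(d j.1 j.2).pos, Nat.lt_succ_of_le (hd j.1 j.2).2⟩ : Fin (n + 2)),
      fun v => (⟨(d j.1 j.2).reg v, Nat.lt_succ_of_le ((hd j.1 j.2).1 v)⟩ : Fin (N + 1)))) := by
    intro i j hij
    simp only [Prod.mk.injEq, Fin.mk.injEq, funext_iff] at hij
    have := (hq i.1 i.2).unique (fun c => (c.pos, c.reg)) (c' := d j.1 j.2) (m' := j.1 + 1)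
      (by rintro c c' h; simp only [Prod.mk.injEq] at h; simp [counterDevice, h])
      (by
        rintro (_ | _ | _ | _ | _ | _) c c' h <;> simp only [Prod.mk.injEq] at h <;>
          simp [counterDevice, h, CounterConfig.set])
      (by rw [hij.1]; exact hq j.1 j.2)
      (Prod.ext hij.2.1 (funext hij.2.2))
    ext; omega
  have hcard := Fintype.card_le_of_injective _ hinj
  simp only [Fintype.card_fin, Fintype.card_prod, Fintype.card_fun] at hcard
  refine hcard.trans ?_
  have h₂ : N + 1 ≤ (n + 2) ^ (k + 1) := by
    have : 1 ≤ N := Nat.one_le_pow _ _ (by omega)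
    rw [pow_succ]
    change N + 1 ≤ N * (n + 2)
    nlinarith
  rw [pow_add, pow_add, pow_one, pow_mul, mul_assoc]
  refine Nat.mul_le_mul ?_ (Nat.mul_le_mul_left _ (Nat.pow_le_pow_left h₂ _))
  exact Nat.lt_two_pow_self.le.trans (Nat.pow_le_pow_left (by omega) _)

section extend

variable {V V' : Type} [DecidableEq V] [DecidableEq V'] {ι : V → V'}

theorem extend_update (hι : Function.Injective ι) (r : V → ℕ) (ρ : V' → ℕ) (v : V) (n : ℕ) :
    Function.extend ι (Function.update r v n) ρ =
      Function.update (Function.extend ι r ρ) (ι v) n := by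
  funext x
  by_cases hx : ∃ u, ι u = x
  · obtain ⟨u, rfl⟩ := hx
    rw [hι.extend_apply]
    by_cases hu : u = v
    · subst hu; simp
    · rw [Function.update_of_ne hu, Function.update_of_ne (hι.ne hu), hι.extend_apply]
  · rw [Function.extend_apply' _ _ _ hx, Function.update_of_ne (by rintro rfl; exact hx ⟨v, rfl⟩),
      Function.extend_apply' _ _ _ hx]

omit [DecidableEq V] in
theorem extend_update_right (hι : Function.Injective ι) (r : V → ℕ) (ρ : V' → ℕ) {x : V'}
    (hx : ¬ ∃ u, ι u = x) (n : ℕ) :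
    Function.extend ι r (Function.update ρ x n) =
      Function.update (Function.extend ι r ρ) x n := by
  funext y
  by_cases hy : ∃ u, ι u = y
  · obtain ⟨u, rfl⟩ := hy
    rw [hι.extend_apply, Function.update_of_ne (by rintro rfl; exact hx ⟨u, rfl⟩),
      hι.extend_apply]
  · rw [Function.extend_apply' _ _ _ hy]
    by_cases hxy : y = x
    · subst hxy; simp
    · rw [Function.update_of_ne hxy, Function.update_of_ne hxy, Function.extend_apply' _ _ _ hy]

end extend

/-! ### Programs embedded among further counters -/

namespace CounterProg

open CounterConfig

variable {A V V' B C T E : Type} [Finite A] [Fintype V] [DecidableEq V] [DecidableEq V'] [Finite T]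
  {w : List A} {l N N' : ℕ}

/-- Execute an instruction on counters renamed by `ι`; letters for the output tape are treated by
`em`. -/
def embedInstr (ι : V → V') (em : B → T → CounterProg A V' C T) :
    CounterInstr V B → T → CounterProg A V' C T
  | .nop, t => pure t
  | .inc v, t => seq (op (.inc (ι v))) (pure t)
  | .dec v, t => seq (op (.dec (ι v))) (pure t)
  | .left, t => seq (op .left) (pure t)
  | .right, t => seq (op .right) (pure t)
  | .emit b, t => em b t

/-- The program `F` with counters renamed by `ι`, where letters for the output tape are treated by
`em`. -/
def embed (ι : V → V') (em : B → T → CounterProg A V' C T) (F : CounterProg A V B E) (t : T) :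
    CounterProg A V' C (E × T) :=
  Control.transl (.atom fun o => ((o.1, fun v => o.2 (ι v)), .nop)) (embedInstr ι em) F t

/-- The configuration of a program whose counters include those of the embedded program. -/
noncomputable def overlay (ι : V → V') (c : CounterConfig V B) (ρ : V' → ℕ) (o : List C) : CounterConfig V' C :=
  ⟨c.pos, Function.extend ι c.reg ρ, o⟩

omit [Finite A] [Fintype V] [DecidableEq V] [DecidableEq V'] in
theorem bounded_overlay {ι : V → V'} (hι : Function.Injective ι) {c : CounterConfig V B}
    (hc : c.Bounded l N) (hN : N ≤ N') {ρ : V' → ℕ} (hρ : ∀ u, ρ u ≤ N') (o : List C) :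
    (overlay ι c ρ o).Bounded l N' := by
  refine ⟨fun x => ?_, hc.2⟩
  by_cases hx : ∃ u, ι u = x
  · obtain ⟨u, rfl⟩ := hx
    simp only [overlay, hι.extend_apply]
    exact (hc.1 u).trans hN
  · simp only [overlay, Function.extend_apply' _ _ _ hx]
    exact hρ x

/-- The invariant `J` relates the output that `F` would have written so far to the control value,
the foreign counters and the actual output. Only the treatment `em` of an emitted letter can affect
it, since all other instructions act within the range of `ι`. -/
theorem runs_embed {ι : V → V'} (hι : Function.Injective ι) {em : B → T → CounterProg A V' C T}
    (hN : N ≤ N') (J : List B → T → (V' → ℕ) → List C → Prop)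
    (hJ : ∀ l t ρ o, J l t ρ o → ∀ u, ρ u ≤ N')
    (hem : ∀ b (c : CounterConfig V B) t ρ o, c.Bounded w.length N → J c.out t ρ o →
      ∃ t' ρ' o', (em b t).Runs (counterDevice C w) (Bounded w.length N') (overlay ι c ρ o) t'
        (overlay ι c ρ' o') ∧ J (c.out ++ [b]) t' ρ' o')
    {F : CounterProg A V B E} {c : CounterConfig V B} {e d}
    (h : F.Runs (counterDevice B w) (Bounded w.length N) c e d) {t ρ o} (ht : J c.out t ρ o) :
    ∃ t' ρ' o', (embed ι em F t).Runs (counterDevice C w) (Bounded w.length N') (overlay ι c ρ o)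
      (e, t') (overlay ι d ρ' o') ∧ J d.out t' ρ' o' := by
  obtain ⟨t', d', hd, ρ', o', hJ', rfl⟩ := Control.Runs.transl (D' := counterDevice C w)
    (ok' := Bounded w.length N')
    (rd := .atom fun o : CounterObs A V' => ((o.1, fun v => o.2 (ι v)), .nop))
    (im := embedInstr ι em) (fun c t c' => ∃ ρ o, J c.out t ρ o ∧ c' = overlay ι c ρ o)
    (by
      rintro c t _ hc ⟨ρ, o, ht, rfl⟩
      refine ⟨_, ?_, ρ, o, ht, rfl⟩
      have hb := bounded_overlay hι hc hN (hJ _ _ _ _ ht) o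
      have := Control.runs_atom (D := counterDevice C w)
        (fun o : CounterObs A V' => ((o.1, fun v => o.2 (ι v)), CounterInstr.nop)) hb hb
      have hobs : (counterDevice B w).obs c = (((counterDevice C w).obs (overlay ι c ρ o)).1,
          fun v => ((counterDevice C w).obs (overlay ι c ρ o)).2 (ι v)) := by
        simp [counterDevice, overlay, hι.extend_apply]
      rw [hobs]
      exact this)
    (by
      rintro i c t _ hc hc' ⟨ρ, o, ht, rfl⟩
      have hb := bounded_overlay hι hc hN (hJ _ _ _ _ ht) o
      cases i with
      | nop => exact ⟨t, _, runs_pure _ hb, ρ, o, ht, rfl⟩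
      | left =>
        have hb' := bounded_overlay hι hc' hN (hJ _ _ _ _ ht) o
        exact ⟨t, _, (runs_op (w := w) (i := .left) hb hb').seq (runs_pure _ hb'), ρ, o, ht, rfl⟩
      | right =>
        have hb' := bounded_overlay hι hc' hN (hJ _ _ _ _ ht) o
        exact ⟨t, _, (runs_op (w := w) (i := .right) hb hb').seq (runs_pure _ hb'), ρ, o, ht, rfl⟩
      | inc v =>
        have hb' := bounded_overlay hι hc' hN (hJ _ _ _ _ ht) o
        have he : overlay ι ((counterDevice B w).exec (.inc v) c) ρ o =
            (counterDevice C w).exec (.inc (ι v)) (overlay ι c ρ o) := by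
          simp [overlay, counterDevice, CounterConfig.set, extend_update hι, hι.extend_apply]
        rw [he] at hb'
        exact ⟨t, _, (runs_op (w := w) (i := .inc (ι v)) hb hb').seq (runs_pure _ hb'), ρ, o, ht,
          he.symm⟩
      | dec v =>
        have hb' := bounded_overlay hι hc' hN (hJ _ _ _ _ ht) o
        have he : overlay ι ((counterDevice B w).exec (.dec v) c) ρ o =
            (counterDevice C w).exec (.dec (ι v)) (overlay ι c ρ o) := by
          simp [overlay, counterDevice, CounterConfig.set, extend_update hι, hι.extend_apply]
        rw [he] at hb'
        exact ⟨t, _, (runs_op (w := w) (i := .dec (ι v)) hb hb').seq (runs_pure _ hb'), ρ, o, ht,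
          he.symm⟩
      | emit b =>
        obtain ⟨t', ρ', o', hr, ht'⟩ := hem b c t ρ o hc ht
        exact ⟨t', _, hr, ρ', o', ht', rfl⟩) h (t := t) ⟨ρ, o, ht, rfl⟩
  exact ⟨t', ρ', o', hd, hJ'⟩

omit [Finite A] [Fintype V] [DecidableEq V] [DecidableEq V'] in
theorem overlay_init (ι : V → V') (hι : Function.Injective ι) (o : List C) :
    overlay ι (init V B) (fun _ => 0) o = ⟨0, fun _ => 0, o⟩ := by
  simp only [overlay, CounterConfig.init]
  congr 1
  funext x
  by_cases hx : ∃ u, ι u = x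
  · obtain ⟨u, rfl⟩ := hx; rw [hι.extend_apply]
  · rw [Function.extend_apply' _ _ _ hx]

/-- Treat a letter of the output by writing it on the output tape. -/
def forward (b : B) (_ : Unit) : CounterProg A V' B Unit := op (.emit b)

theorem runs_embed_forward {ι : V → V'} (hι : Function.Injective ι) (hN : N ≤ N')
    {F : CounterProg A V B E} {e d}
    (h : F.Runs (counterDevice B w) (Bounded w.length N) (.init V B) e d) :
    ∃ d', (embed ι forward F ()).Runs (counterDevice B w) (Bounded w.length N')
      (.init V' B) (e, ()) d' ∧ d'.out = d.out := by
  obtain ⟨⟨⟩, ρ, o, hr, rfl, rfl⟩ := runs_embed (C := B) (em := forward) hι hN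
    (fun l _ ρ o => ρ = (fun _ => 0) ∧ o = l)
    (by rintro l t ρ o ⟨rfl, rfl⟩ u; exact Nat.zero_le _)
    (by
      rintro b c t ρ o hc ⟨rfl, rfl⟩
      have hb := bounded_overlay hι hc hN (ρ := fun _ => 0) (fun _ => Nat.zero_le _) c.out
      exact ⟨(), _, c.out ++ [b], runs_op (w := w) (i := .emit b) hb
        (bounded_overlay hι hc hN (ρ := fun _ => 0) (fun _ => Nat.zero_le _) (c.out ++ [b])),
        rfl, rfl⟩) h (t := ()) ⟨rfl, rfl⟩
  refine ⟨overlay ι d (fun _ => 0) d.out, ?_, rfl⟩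
  rwa [overlay_init ι hι] at hr

/-- Set all counters to zero, and move the input head to the left end marker. -/
noncomputable def reset : CounterProg A V B Unit :=
  seq (clearList Finset.univ.toList) rewind

theorem runs_reset {c : CounterConfig V B} (hc : c.Bounded l N) :
    reset.Runs (counterDevice B w) (Bounded l N) c () ⟨0, fun _ => 0, c.out⟩ := by
  have h₁ := runs_clearList (w := w) Finset.univ.toList hc
  have h₂ := h₁.seq (runs_rewind (w := w) h₁.ok_end)
  simpa [reset] using h₂

end CounterProg

/-- A function defined by cases according to whether `true` occurs in the output of a third
function. -/
theorem CounterComputable.ite {A B : Type} [Finite A] {t : List A → List Bool}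
    {f g : List A → List B} (ht : CounterComputable t) (hf : CounterComputable f)
    (hg : CounterComputable g) :
    CounterComputable fun w => if true ∈ t w then f w else g w := by
  obtain ⟨V₀, _, _, F₀, k₀, h₀⟩ := ht
  obtain ⟨V₁, _, _, F₁, k₁, h₁⟩ := hf
  obtain ⟨V₂, _, _, F₂, k₂, h₂⟩ := hg
  refine ⟨V₀ ⊕ V₁ ⊕ V₂, inferInstance, inferInstance,
    (CounterProg.embed Sum.inl (fun b s => CounterProg.pure (s || b)) F₀ false).bind fun e =>
      CounterProg.seq CounterProg.reset
        ((bif e.2 then CounterProg.embed (Sum.inr ∘ Sum.inl) CounterProg.forward F₁ ()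
          else CounterProg.embed (Sum.inr ∘ Sum.inr) CounterProg.forward F₂ ()).map fun _ => ()),
    k₀ + k₁ + k₂, fun w => ?_⟩
  obtain ⟨c₀, hc₀, ho₀⟩ := h₀ w
  obtain ⟨c₁, hc₁, ho₁⟩ := h₁ w
  obtain ⟨c₂, hc₂, ho₂⟩ := h₂ w
  have hN : ∀ k ≤ k₀ + k₁ + k₂, (w.length + 2) ^ k ≤ (w.length + 2) ^ (k₀ + k₁ + k₂) :=
    fun k hk => Nat.pow_le_pow_right (by omega) hk
  -- The output of the test is not written; the control only remembers the disjunction of its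
  -- letters.
  obtain ⟨s, ρ, o, hr, rfl, rfl, rfl⟩ := CounterProg.runs_embed (C := B)
    (em := fun b s => CounterProg.pure (s || b)) Sum.inl_injective (hN k₀ (by omega))
    (fun (l : List Bool) s (ρ : V₀ ⊕ V₁ ⊕ V₂ → ℕ) o =>
      s = decide (true ∈ l) ∧ ρ = (fun _ => 0) ∧ o = [])
    (by rintro l t ρ o ⟨-, rfl, -⟩ u; exact Nat.zero_le _)
    (by
      rintro b c t ρ o hc ⟨rfl, rfl, rfl⟩
      refine ⟨_, _, _, CounterProg.runs_pure _ (CounterProg.bounded_overlay Sum.inl_injective hc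
        (hN k₀ (by omega)) (fun _ => Nat.zero_le _) _), ?_, rfl, rfl⟩
      cases b <;> simp) hc₀ (t := false) (ρ := fun _ => 0) (o := []) ⟨by simp [CounterConfig.init], rfl, rfl⟩
  rw [CounterProg.overlay_init _ Sum.inl_injective] at hr
  have hr' := CounterProg.runs_reset (w := w) hr.ok_end
  by_cases hw : true ∈ c₀.out
  · obtain ⟨d, hd, hdo⟩ := CounterProg.runs_embed_forward (ι := (Sum.inr ∘ Sum.inl : V₁ → V₀ ⊕ V₁ ⊕ V₂))
      (Sum.inr_injective.comp Sum.inl_injective) (hN k₁ (by omega)) hc₁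
    refine ⟨d, hr.bind (hr'.seq ?_), ?_⟩
    · simp only [hw, decide_true, cond_true]
      exact hd.map _
    · rw [hdo, ho₁]; exact (if_pos (ho₀ ▸ hw)).symm
  · obtain ⟨d, hd, hdo⟩ := CounterProg.runs_embed_forward (ι := (Sum.inr ∘ Sum.inr : V₂ → V₀ ⊕ V₁ ⊕ V₂))
      (Sum.inr_injective.comp Sum.inr_injective) (hN k₂ (by omega)) hc₂
    refine ⟨d, hr.bind (hr'.seq ?_), ?_⟩
    · simp only [hw, decide_false, cond_false]
      exact hd.map _
    · rw [hdo, ho₂]; exact (if_neg (ho₀ ▸ hw)).symm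

/-! ### Loops over a marked position -/

/-- Mark the letter at position `t`. -/
def markAt {A : Type*} (w : List A) (t : ℕ) : List (A × Bool) :=
  w.mapIdx fun i a => (a, decide (i = t))

/-- The concatenation of the values of `f` on the words obtained from `w` by marking one letter. -/
def markLoop {A B : Type*} (f : List (A × Bool) → List B) (w : List A) : List B :=
  (List.range w.length).flatMap fun t => f (markAt w t)

namespace CounterProg

open CounterConfig

variable {A V B C E : Type} [Finite A] [Fintype V] [DecidableEq V] {w : List A} {l N N' : ℕ}

/-- The counters of a program that simulates another one on a marked input: the counters `0` and
`1` hold the truncated differences of the head position and the position of the mark, the counter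
`2` holds the position of the mark, the counter `3` is scratch space, and the counter `4` holds the
number of marked inputs that remain. -/
def markConfig (m n : ℕ) (c : CounterConfig V B) (o : List B) : CounterConfig (V ⊕ Fin 5) B :=
  ⟨c.pos, Sum.elim c.reg ![c.pos - m, m - c.pos, m, 0, n], o ++ c.out⟩

/-- Observe the input symbol `a` and the counters of the simulated program. -/
def observe {U : Type} (a : TapeSymbol C) : CounterProg A (V ⊕ U) B (CounterObs C V) :=
  .atom fun o => ((a, fun v => o.2 (.inl v)), .nop)

theorem runs_observe {U : Type} [DecidableEq U] (a : TapeSymbol C) {r : V → ℕ} {s : U → ℕ} {p : ℕ}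
    {o : List B} (h : Bounded l N ⟨p, Sum.elim r s, o⟩) :
    (observe a).Runs (counterDevice B w) (Bounded l N) ⟨p, Sum.elim r s, o⟩
      (a, fun v => decide (r v ≠ 0)) ⟨p, Sum.elim r s, o⟩ :=
  Control.runs_atom (D := counterDevice B w)
    (fun o : CounterObs A (V ⊕ U) => ((a, fun v => o.2 (.inl v)), .nop)) h h

/-- Observe the marked input. -/
def readMarked : CounterProg A (V ⊕ Fin 5) B (CounterObs (A × Bool) V) :=
  symbol.bind fun s => match s with
    | .leftEnd => observe .leftEnd
    | .rightEnd => observe .rightEnd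
    | .letter a => ite (.inr 0) (observe (.letter (a, false)))
        (ite (.inr 1) (observe (.letter (a, false))) (observe (.letter (a, true))))

/-- Execute an instruction of a program that works on the marked input. -/
def execMarked : CounterInstr V B → CounterProg A (V ⊕ Fin 5) B Unit
  | .nop => pure ()
  | .inc v => op (.inc (.inl v))
  | .dec v => op (.dec (.inl v))
  | .left => symbol.bind fun s => match s with
    | .leftEnd => pure ()
    | _ => seq (op .left) (ite (.inr 0) (op (.dec (.inr 0))) (op (.inc (.inr 1))))
  | .right => seq (op .right) (ite (.inr 1) (op (.dec (.inr 1))) (op (.inc (.inr 0))))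
  | .emit b => op (.emit b)

theorem inputSymbol_markAt (t p : ℕ) :
    Transducer.inputSymbol (markAt w t) p = match Transducer.inputSymbol w p with
      | .leftEnd => .leftEnd
      | .rightEnd => .rightEnd
      | .letter a => .letter (a, decide (p = t + 1)) := by
  cases p with
  | zero => rfl
  | succ p =>
    simp only [Transducer.inputSymbol, markAt, List.getElem?_mapIdx]
    cases w[p]? <;> simp

theorem bounded_markConfig {m n : ℕ} (hm : m ≤ w.length) (hn : n ≤ w.length + 1)
    (hN : N ≤ N') (hw : w.length + 1 ≤ N') {c : CounterConfig V B} (hc : c.Bounded w.length N)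
    (o : List B) : (markConfig m n c o).Bounded w.length N' := by
  have := hc.2
  refine ⟨?_, hc.2⟩
  rintro (v | i)
  · exact (hc.1 v).trans hN
  · fin_cases i <;> simp [markConfig] <;> omega

/-- The letter at position `t` is on square `t + 1`, and the head is there exactly if both truncated
differences vanish. -/
theorem runs_readMarked {t n : ℕ} (hm : t + 1 ≤ w.length) (hn : n ≤ w.length + 1)
    (hN : N ≤ N') (hw : w.length + 1 ≤ N') {c : CounterConfig V B} (hc : c.Bounded w.length N)
    (o : List B) :
    readMarked.Runs (counterDevice B w) (Bounded w.length N') (markConfig (t + 1) n c o)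
      ((counterDevice B (markAt w t)).obs c) (markConfig (t + 1) n c o) := by
  have hb := bounded_markConfig hm hn hN hw hc o
  refine (runs_symbol hb).bind ?_
  simp only [counterDevice, inputSymbol_markAt, show (markConfig (t + 1) n c o).pos = c.pos from rfl]
  rcases Transducer.inputSymbol w c.pos with _ | a | _
  · exact runs_observe _ hb
  · rcases lt_trichotomy c.pos (t + 1) with h | h | h
    · simp only [h.ne, decide_false]
      refine Control.Runs.ite_neg (by simp [markConfig]; omega)
        (Control.Runs.ite_pos (by simp [markConfig]; omega) (runs_observe _ hb))
    · simp only [h, decide_true]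
      refine Control.Runs.ite_neg (by simp [markConfig]; omega)
        (Control.Runs.ite_neg (by simp [markConfig]; omega) (runs_observe _ hb))
    · simp only [h.ne', decide_false]
      refine Control.Runs.ite_pos (by simp [markConfig]; omega) (runs_observe _ hb)
  · exact runs_observe _ hb

/-- At most one of the two truncated differences is positive, and a move of the head changes exactly
one of them; a zero test tells which. A move to the left on the end marker is suppressed, as the
differences must not change then. -/
theorem runs_execMarked {m n : ℕ} (hm : m ≤ w.length) (hn : n ≤ w.length + 1)
    (hN : N ≤ N') (hw : w.length + 1 ≤ N') {w' : List (A × Bool)} {c : CounterConfig V B}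
    (i : CounterInstr V B)
    (hc : c.Bounded w.length N) (hc' : ((counterDevice B w').exec i c).Bounded w.length N)
    (o : List B) :
    (execMarked i).Runs (counterDevice B w) (Bounded w.length N') (markConfig m n c o) ()
      (markConfig m n ((counterDevice B w').exec i c) o) := by
  have hb := bounded_markConfig hm hn hN hw hc o
  have hb' := bounded_markConfig hm hn hN hw hc' o
  cases i with
  | nop => exact runs_pure _ hb
  | inc v =>
    have he : (counterDevice B w).exec (.inc (.inl v)) (markConfig m n c o) =
        markConfig m n ((counterDevice B w').exec (.inc v) c) o := by
      ext (u | u) <;> simp [counterDevice, markConfig, set_reg]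
    rw [← he] at hb' ⊢
    exact runs_op hb hb'
  | dec v =>
    have he : (counterDevice B w).exec (.dec (.inl v)) (markConfig m n c o) =
        markConfig m n ((counterDevice B w').exec (.dec v) c) o := by
      ext (u | u) <;> simp [counterDevice, markConfig, set_reg]
    rw [← he] at hb' ⊢
    exact runs_op hb hb'
  | emit b =>
    have he : (counterDevice B w).exec (.emit b) (markConfig m n c o) =
        markConfig m n ((counterDevice B w').exec (.emit b) c) o := by
      ext (u | u) <;> simp [counterDevice, markConfig]
    rw [← he] at hb' ⊢
    exact runs_op hb hb'
  | left =>
    refine (runs_symbol hb).bind ?_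
    obtain ⟨p, r, o'⟩ := c
    rcases p with _ | p
    · exact runs_pure _ hb
    · have h₁ := runs_op (w := w) (i := .left) hb ⟨hb.1, (Nat.sub_le _ _).trans hb.2⟩
      have key : (seq (op .left) (ite (.inr 0) (op (.dec (.inr 0))) (op (.inc (.inr 1))))).Runs
          (counterDevice B w) (Bounded w.length N') (markConfig m n ⟨p + 1, r, o'⟩ o) ()
          (markConfig m n ((counterDevice B w').exec .left ⟨p + 1, r, o'⟩) o) := by
        refine h₁.seq ?_
        by_cases hp : m < p + 1
        · refine Control.Runs.ite_pos (by simp [counterDevice, markConfig]; omega) ?_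
          convert runs_dec (w := w) (v := .inr 0) h₁.ok_end using 1
          ext u <;> simp [counterDevice, markConfig, set_reg]
          rcases u with u | u
          · simp
          · fin_cases u <;> simp <;> omega
        · refine Control.Runs.ite_neg (by simp [counterDevice, markConfig]; omega) ?_
          convert runs_inc (w := w) (v := .inr 1) h₁.ok_end
            (by simp [counterDevice, markConfig]; omega) using 1
          ext u <;> simp [counterDevice, markConfig, set_reg]
          rcases u with u | u
          · simp
          · fin_cases u <;> simp <;> omega
      rcases hs : Transducer.inputSymbol w (p + 1) with _ | a | _
      · rw [Transducer.inputSymbol] at hs; split at hs <;> cases hs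
      · simpa [markConfig, hs] using key
      · simpa [markConfig, hs] using key
  | right =>
    have h₁ := runs_op (w := w) (i := .right) hb ⟨hb.1, hc'.2⟩
    refine h₁.seq ?_
    have := hc'.2
    simp only [counterDevice] at this
    by_cases hp : c.pos < m
    · refine Control.Runs.ite_pos (by simp [counterDevice, markConfig]; omega) ?_
      convert runs_dec (w := w) (v := .inr 1) h₁.ok_end using 1
      ext u <;> simp [counterDevice, markConfig, set_reg]
      rcases u with u | u
      · simp
      · fin_cases u <;> simp <;> omega
    · refine Control.Runs.ite_neg (by simp [counterDevice, markConfig]; omega) ?_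
      convert runs_inc (w := w) (v := .inr 0) h₁.ok_end
        (by simp [counterDevice, markConfig]; omega) using 1
      ext u <;> simp [counterDevice, markConfig, set_reg]
      rcases u with u | u
      · simp
      · fin_cases u <;> simp <;> omega

/-- Store the length of the input plus one in the counter `v`. -/
def countInput (v : V) : CounterProg A V B Unit :=
  .loop (S := Unit) (fun _ => symbol.bind fun s => match s with
    | .rightEnd => pure (.inr ())
    | _ => (seq (op .right) (op (.inc v))).map .inl) ()

theorem runs_countInput {v : V} (r : V → ℕ) (o : List B) (hr : ∀ u, r u ≤ N)
    (hw : w.length + 1 ≤ N) (d p : ℕ) (hp : p + d = w.length + 1) :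
    (countInput v).Runs (counterDevice B w) (Bounded w.length N)
      ⟨p, Function.update r v p, o⟩ () ⟨w.length + 1, Function.update r v (w.length + 1), o⟩ := by
  have hb : ∀ p, p ≤ w.length + 1 → Bounded w.length N ⟨p, Function.update r v p, o⟩ := by
    refine fun p hp => ⟨fun u => ?_, hp⟩
    by_cases hu : u = v
    · subst hu; simp; omega
    · simpa [hu] using hr u
  induction d generalizing p with
  | zero =>
    obtain rfl : p = w.length + 1 := by omega
    refine .loop_exit ((runs_symbol (hb _ le_rfl)).bind ?_)
    rw [(inputSymbol_eq_rightEnd le_rfl).2 rfl]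
    exact runs_pure _ (hb _ le_rfl)
  | succ d ih =>
    have hle := hb p (by omega)
    have h₁ := runs_op (w := w) (i := .right) hle ⟨hle.1, by simp [counterDevice]; omega⟩
    have h₂ := h₁.seq (runs_inc (v := v) h₁.ok_end (by simp [counterDevice]; omega))
    have h₃ := h₂.map (Sum.inl : Unit → Unit ⊕ Unit)
    simp only [counterDevice, CounterConfig.set, Function.update_self, Function.update_idem] at h₃
    refine .loop_step ((runs_symbol hle).bind ?_) (ih (p + 1) (by omega))
    have hs := (inputSymbol_eq_rightEnd (w := w) (p := p) (by omega)).not.2 (by omega)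
    rcases h : Transducer.inputSymbol w p with _ | _ | _
    · exact h₃
    · exact h₃
    · exact absurd h hs

end CounterProg

namespace CounterProg

open CounterConfig

set_option linter.unusedSectionVars false

variable {A V B C E : Type} [Finite A] [Fintype V] [DecidableEq V] {w : List A} {l N N' : ℕ}

/-- Run `F` on the input where the letter after the marked one is marked. -/
noncomputable def markStep (F : CounterProg (A × Bool) V B Unit) :
    CounterProg A (V ⊕ Fin 5) B Unit :=
  seq (op (.dec (.inr 4))) (seq (op (.inc (.inr 2))) (seq (copy (.inr 2) (.inr 1) (.inr 3))
    (seq ((Control.transl (T := Unit) readMarked (fun i _ => execMarked i) F ()).map fun _ => ())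
      (seq (clearList (.inr 0 :: .inr 1 :: Finset.univ.toList.map .inl)) rewind))))

/-- The configuration before a marked input is treated. -/
def loopConfig (V : Type) (m n : ℕ) (o : List B) : CounterConfig (V ⊕ Fin 5) B :=
  ⟨0, Sum.elim (fun _ => 0) ![0, 0, m, 0, n], o⟩

theorem bounded_loopConfig {m n : ℕ} (hm : m ≤ N) (hn : n ≤ N) (o : List B) :
    (loopConfig V m n o).Bounded l N := by
  refine ⟨?_, Nat.zero_le _⟩
  rintro (v | i)
  · exact Nat.zero_le _
  · fin_cases i <;> simp [loopConfig] <;> omega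

theorem runs_markStep {F : CounterProg (A × Bool) V B Unit} {t n : ℕ} (ht : t < w.length)
    (hn : n ≤ w.length) (hN : N ≤ N') (hw : w.length + 1 ≤ N') {d : CounterConfig V B}
    (h : F.Runs (counterDevice B (markAt w t)) (Bounded w.length N) (.init V B) () d)
    (o : List B) :
    (markStep F).Runs (counterDevice B w) (Bounded w.length N') (loopConfig V t (n + 1) o) ()
      (loopConfig V (t + 1) n (o ++ d.out)) := by
  have h₁ := runs_dec (w := w) (l := w.length) (N := N') (v := .inr 4)
    (bounded_loopConfig (V := V) (m := t) (n := n + 1) (by omega) (by omega) o)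
  refine h₁.seq ?_
  have h₂ := runs_inc (w := w) (v := .inr 2) h₁.ok_end (by
    simp [set_reg, loopConfig]; omega)
  refine h₂.seq ?_
  -- The head is on square `0`, so the difference held in the counter `1` has to be the position of
  -- the mark itself.
  have h₃ := runs_copy (w := w) (u := .inr 2) (v := .inr 1) (t := .inr 3) (by simp) (by simp)
    (by simp) h₂.ok_end (by simp [set_reg, loopConfig]) (by
    simp [set_reg, loopConfig]; omega)
  refine h₃.seq ?_
  have hc : markConfig (t + 1) n (CounterConfig.init V B) o = (((loopConfig V t (n + 1) o).set
      (.inr 4) ((loopConfig V t (n + 1) o).reg (.inr 4) - 1)).set (.inr 2)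
      (((loopConfig V t (n + 1) o).set
      (.inr 4) ((loopConfig V t (n + 1) o).reg (.inr 4) - 1)).reg (.inr 2) + 1)).set (.inr 1)
      ((((loopConfig V t (n + 1) o).set
      (.inr 4) ((loopConfig V t (n + 1) o).reg (.inr 4) - 1)).set (.inr 2)
      (((loopConfig V t (n + 1) o).set
      (.inr 4) ((loopConfig V t (n + 1) o).reg (.inr 4) - 1)).reg (.inr 2) + 1)).reg (.inr 1) +
      (((loopConfig V t (n + 1) o).set
      (.inr 4) ((loopConfig V t (n + 1) o).reg (.inr 4) - 1)).set (.inr 2)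
      (((loopConfig V t (n + 1) o).set
      (.inr 4) ((loopConfig V t (n + 1) o).reg (.inr 4) - 1)).reg (.inr 2) + 1)).reg (.inr 2)) := by
    ext u <;> simp [markConfig, loopConfig, set_reg, CounterConfig.init]
    rcases u with u | u
    · simp
    · fin_cases u <;> simp [hn]
  rw [← hc]
  obtain ⟨⟨⟩, e, he, rfl⟩ := Control.Runs.transl (D' := counterDevice B w)
    (ok' := Bounded w.length N') (rd := readMarked) (im := fun i _ => execMarked i) (T := Unit)
    (fun c _ c' => c' = markConfig (t + 1) n c o)
    (by
      rintro c _ _ hc rfl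
      exact ⟨_, runs_readMarked ht (by omega) hN hw hc o, rfl⟩)
    (by
      rintro i c _ _ hc hc' rfl
      exact ⟨(), _, runs_execMarked ht (by omega) hN hw i hc hc' o, rfl⟩) h (t := ()) rfl
  refine Control.Runs.seq (he.map fun _ => ()) ?_
  have h₄ := runs_clearList (w := w) (.inr 0 :: .inr 1 :: Finset.univ.toList.map .inl) he.ok_end
  refine h₄.seq ?_
  convert runs_rewind (w := w) h₄.ok_end using 1
  ext u <;> simp [markConfig, loopConfig]
  rcases u with u | u
  · simp
  · fin_cases u <;> simp

end CounterProg

theorem length_markAt {A : Type*} (w : List A) (t : ℕ) : (markAt w t).length = w.length := by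
  simp [markAt]

/-- A loop over the positions of the input. -/
theorem CounterComputable.markLoop {A B : Type} [Finite A] {f : List (A × Bool) → List B}
    (hf : CounterComputable f) : CounterComputable (markLoop f) := by
  obtain ⟨V, _, _, F, k, hF⟩ := hf
  refine ⟨V ⊕ Fin 5, inferInstance, inferInstance,
    CounterProg.seq (CounterProg.countInput (.inr 4)) (CounterProg.seq CounterProg.rewind
      (CounterProg.seq (CounterProg.op (.dec (.inr 4)))
        (CounterProg.repeatWhile (.inr 4) (CounterProg.markStep F)))), k + 1, fun w => ?_⟩
  set n := w.length with hn
  have hN : (n + 2) ^ k ≤ (n + 2) ^ (k + 1) := Nat.pow_le_pow_right (by omega) (by omega)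
  have hw : n + 1 ≤ (n + 2) ^ (k + 1) :=
    le_trans (by rw [pow_one]; omega) (Nat.pow_le_pow_right (n := n + 2) (by omega) (by omega : 1 ≤ k + 1))
  set N := (n + 2) ^ (k + 1)
  let out : ℕ → List B := fun m => (List.range m).flatMap fun t => f (markAt w t)
  refine ⟨CounterProg.loopConfig V n 0 (out n), ?_, rfl⟩
  have h₁ := CounterProg.runs_countInput (w := w) (N := N) (v := (.inr 4 : V ⊕ Fin 5)) (fun _ => 0)
    ([] : List B) (fun _ => Nat.zero_le _) hw (n + 1) 0 (by omega)
  rw [show (⟨0, Function.update (fun _ => 0) (.inr 4) 0, []⟩ : CounterConfig (V ⊕ Fin 5) B) =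
    CounterConfig.init _ _ by simp [CounterConfig.init]] at h₁
  refine h₁.seq ?_
  have h₂ := CounterProg.runs_rewind (w := w) h₁.ok_end
  refine h₂.seq ?_
  -- The count includes the left end marker, hence the correction by one.
  have h₃ := CounterProg.runs_dec (w := w) (v := .inr 4) h₂.ok_end
  refine h₃.seq ?_
  have h₄ := CounterProg.runs_while (w := w) (v := .inr 4) (F := CounterProg.markStep F)
    (ok := CounterConfig.Bounded w.length N)
    (fun i => CounterProg.loopConfig V (n - i) i (out (n - i))) n
    (CounterProg.bounded_loopConfig (by omega) (by omega) _)
    (by simp [CounterProg.loopConfig]) (fun i hi => by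
      refine ⟨by simp [CounterProg.loopConfig], ?_⟩
      obtain ⟨d, hd, ho⟩ := hF (markAt w (n - (i + 1)))
      rw [length_markAt] at hd
      have := CounterProg.runs_markStep (w := w) (t := n - (i + 1)) (n := i) (by omega) (by omega)
        hN hw hd (out (n - (i + 1)))
      rw [ho] at this
      convert this using 2
      · omega
      · simp only [out]
        rw [show n - i = n - (i + 1) + 1 by omega, List.range_succ]
        simp)
  convert h₄ using 1
  · ext u <;> simp [CounterProg.loopConfig, out, CounterConfig.set_reg]
    rcases u with u | u
    · simp
    · fin_cases u <;> simp [hn]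
  · simp

/-! ### Composition by recomputation -/

namespace CounterProg

open CounterConfig

set_option linter.unusedSectionVars false

variable {A V₁ V₂ B C : Type} [Finite A] [Finite B] [Fintype V₁] [Fintype V₂] [DecidableEq V₁]
  [DecidableEq V₂] {w : List A} {u : List B} {N₁ N₂ N : ℕ}

/-- Treat a letter of the output by counting down, and keep it when the counter reaches zero. -/
def pick {V : Type} (i : V) (b : B) (t : Option B) : CounterProg A V C (Option B) :=
  ite i (seq (op (.dec i)) (ite i (pure t) (pure (some b)))) (pure t)

/-- The configuration of the composition of two programs: the counter `0` holds the position of the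
input head of the second program, the other two counters are scratch space. -/
def compConfig (V₁ : Type) (p : ℕ) (c : CounterConfig V₂ C) :
    CounterConfig (V₂ ⊕ V₁ ⊕ Fin 3) C :=
  ⟨p, Sum.elim c.reg (Sum.elim (fun _ => 0) ![c.pos, 0, 0]), c.out⟩

/-- Compute the symbol that the second program scans. -/
noncomputable def query (F : CounterProg A V₁ B Unit) :
    CounterProg A (V₂ ⊕ V₁ ⊕ Fin 3) C (TapeSymbol B) :=
  seq rewind (ite (.inr (.inr 0)) (seq (copy (.inr (.inr 0)) (.inr (.inr 1)) (.inr (.inr 2)))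
    ((embed (.inr ∘ .inl) (pick (.inr (.inr 1))) F none).bind fun e =>
      seq (clearList (.inr (.inr 1) :: Finset.univ.toList.map (.inr ∘ .inl)))
        (pure (match e.2 with | none => .rightEnd | some b => .letter b))))
    (pure .leftEnd))

theorem bounded_compConfig {p : ℕ} (hp : p ≤ w.length + 1) {c : CounterConfig V₂ C}
    (hc : c.Bounded u.length N₂) (hN₂ : N₂ ≤ N) (hu : u.length + 1 ≤ N) :
    (compConfig V₁ p c).Bounded w.length N := by
  refine ⟨?_, hp⟩
  have := hc.2
  rintro (v | v | i)
  · exact (hc.1 v).trans hN₂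
  · exact Nat.zero_le _
  · fin_cases i <;> simp [compConfig] <;> omega

/-- The intermediate word is too long to be stored, so the first program is run anew for each
scanned symbol and all letters but one are discarded. Where it leaves the real input head is
irrelevant, because each query begins by rewinding it. -/
theorem runs_query {F : CounterProg A V₁ B Unit} {d : CounterConfig V₁ B}
    (hF : F.Runs (counterDevice B w) (Bounded w.length N₁) (.init V₁ B) () d)
    (hN₁ : N₁ ≤ N) (hN₂ : N₂ ≤ N) (hu : d.out.length + 1 ≤ N) {p : ℕ} (hp : p ≤ w.length + 1)
    {c : CounterConfig V₂ C} (hc : c.Bounded d.out.length N₂) :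
    ∃ p' ≤ w.length + 1, (query F).Runs (counterDevice C w) (Bounded w.length N)
      (compConfig V₁ p c) (Transducer.inputSymbol d.out c.pos) (compConfig V₁ p' c) := by
  have hb := bounded_compConfig (V₁ := V₁) hp hc hN₂ hu
  have hb₀ := bounded_compConfig (V₁ := V₁) (w := w) (Nat.zero_le _) hc hN₂ hu
  have h₁ : rewind.Runs (counterDevice C w) _ _ _ (compConfig V₁ 0 c) := runs_rewind (w := w) hb
  rcases hq : c.pos with _ | q
  · exact ⟨0, Nat.zero_le _, h₁.seq (Control.Runs.ite_neg hq (runs_pure _ hb₀))⟩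
  have hcpos := hc.2
  set ι : V₁ → V₂ ⊕ V₁ ⊕ Fin 3 := .inr ∘ .inl with hι'
  have hι : Function.Injective ι := Sum.inr_injective.comp Sum.inl_injective
  set x : V₂ ⊕ V₁ ⊕ Fin 3 := .inr (.inr 1) with hx'
  have hx : ¬ ∃ v, ι v = x := by simp [hι', hx']
  have h₂ := runs_copy (w := w) (u := .inr (.inr 0)) (v := x) (t := .inr (.inr 2)) (by simp [hx'])
    (by simp) (by simp [hx']) hb₀ rfl (by simp [compConfig, hx']; omega)
  set ρ₀ : V₂ ⊕ V₁ ⊕ Fin 3 → ℕ := (compConfig V₁ 0 c).reg with hρ₀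
  have hρ₀x : ρ₀ x = 0 := rfl
  have hstart : overlay ι (CounterConfig.init V₁ B) (Function.update ρ₀ x (q + 1)) c.out =
      (compConfig V₁ 0 c).set x ((compConfig V₁ 0 c).reg x + (compConfig V₁ 0 c).reg (.inr (.inr 0)))
      := by
    have e : ρ₀ (.inr (.inr 0)) = q + 1 := hq
    change _ = (compConfig V₁ 0 c).set x (ρ₀ x + ρ₀ (.inr (.inr 0)))
    rw [hρ₀x, e, zero_add]
    ext v
    · rfl
    · simp only [overlay, extend_update_right hι _ _ hx]
      by_cases hv : v = x
      · rw [hv, Function.update_self, set_reg_self]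
      · rw [set_reg, if_neg hv, Function.update_of_ne hv]
        by_cases hv' : ∃ v', ι v' = v
        · obtain ⟨v', rfl⟩ := hv'
          rw [hι.extend_apply]; rfl
        · rw [Function.extend_apply' _ _ _ hv']
    · rfl
  -- Square `q + 1` holds the letter with index `q`. The counter `x` starts at `q + 1` and goes down
  -- with each letter; the letter that brings it to zero is kept. If it never gets there, the symbol
  -- is the right end marker.
  obtain ⟨t, ρ, o, h₃, rfl, rfl, rfl⟩ := runs_embed (C := C) (em := pick x) hι hN₁
    (fun l t ρ o => t = l[q]? ∧ ρ = Function.update ρ₀ x (q + 1 - l.length) ∧ o = c.out)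
    (by
      rintro l t ρ o ⟨-, rfl, -⟩ v
      by_cases hv : v = x
      · subst hv; simp; omega
      · rw [Function.update_of_ne hv]; exact hb₀.1 v)
    (by
      rintro b e t ρ o he ⟨rfl, rfl, rfl⟩
      have hbd : ∀ n ≤ N, (overlay ι e (Function.update ρ₀ x n) c.out).Bounded w.length N :=
        fun n hn => bounded_overlay hι he hN₁ (fun v => by
          by_cases hv : v = x
          · subst hv; simpa using hn
          · rw [Function.update_of_ne hv]; exact hb₀.1 v) _
      have hreg : ∀ n, (overlay ι e (Function.update ρ₀ x n) c.out).reg x = n := fun n => by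
        simp [overlay, Function.extend_apply' _ _ _ hx]
      have hset : ∀ n m, (overlay ι e (Function.update ρ₀ x n) c.out).set x m =
          overlay ι e (Function.update ρ₀ x m) c.out := fun n m => by
        simp [overlay, CounterConfig.set, extend_update_right hι _ _ hx]
      have h₀ := hbd (q + 1 - e.out.length) (by omega)
      rcases Nat.lt_or_ge q e.out.length with h | h
      · refine ⟨_, _, _, Control.Runs.ite_neg (by rw [hreg]; omega) (runs_pure _ h₀), ?_, ?_, rfl⟩
        · rw [List.getElem?_append_left h]
        · congr 1; simp; omega
      · have hd := runs_dec (w := w) (v := x) h₀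
        rw [hreg, hset] at hd
        rcases Nat.eq_or_lt_of_le h with h | h
        · refine ⟨_, _, _, Control.Runs.ite_pos (by rw [hreg]; omega)
            (hd.seq (Control.Runs.ite_neg (by rw [hreg]; omega) (runs_pure _ hd.ok_end))),
            ?_, ?_, rfl⟩
          · simp [h]
          · congr 1; simp; omega
        · refine ⟨_, _, _, Control.Runs.ite_pos (by rw [hreg]; omega)
            (hd.seq (Control.Runs.ite_pos (by rw [hreg]; omega) (runs_pure _ hd.ok_end))),
            ?_, ?_, rfl⟩
          · rw [List.getElem?_eq_none (by omega), List.getElem?_eq_none (by simp; omega)]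
          · congr 1; simp; omega) hF (t := none) (ρ := Function.update ρ₀ x (q + 1)) (o := c.out)
    ⟨by simp [CounterConfig.init], by simp [CounterConfig.init], rfl⟩
  rw [hstart] at h₃
  have h₄ : (clearList (x :: Finset.univ.toList.map ι)).Runs (counterDevice C w)
      (Bounded w.length N) (overlay ι d (Function.update ρ₀ x (q + 1 - d.out.length)) c.out) ()
      (compConfig V₁ d.pos c) := by
    convert runs_clearList (w := w) _ h₃.ok_end using 1
    ext v
    · rfl
    · simp only [overlay, extend_update_right hι _ _ hx]
      by_cases hv : v = x
      · rw [hv, if_pos List.mem_cons_self]; rfl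
      · by_cases hv' : ∃ v', ι v' = v
        · obtain ⟨v', rfl⟩ := hv'
          rw [if_pos (List.mem_cons_of_mem _ (List.mem_map_of_mem (Finset.mem_toList.2
            (Finset.mem_univ v'))))]
          rfl
        · rw [Function.update_of_ne hv, Function.extend_apply' _ _ _ hv', if_neg]
          · rfl
          · simp only [List.mem_cons, hv, false_or, List.mem_map, not_exists]
            exact fun v' h => hv' ⟨v', h.2⟩
    · rfl
  refine ⟨d.pos, h₃.ok_end.2, h₁.seq (Control.Runs.ite_pos (by simp [compConfig, hq])
    (h₂.seq (h₃.bind (h₄.seq ?_))))⟩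
  convert runs_pure (w := w) _ h₄.ok_end using 1
  simp only [Transducer.inputSymbol]
  cases d.out[q]? <;> rfl

/-- Execute an instruction of the second program. -/
def execComp : CounterInstr V₂ C → CounterProg A (V₂ ⊕ V₁ ⊕ Fin 3) C Unit
  | .nop => pure ()
  | .inc v => op (.inc (.inl v))
  | .dec v => op (.dec (.inl v))
  | .left => op (.dec (.inr (.inr 0)))
  | .right => op (.inc (.inr (.inr 0)))
  | .emit b => op (.emit b)

theorem runs_execComp {p : ℕ} (hp : p ≤ w.length + 1) (hN₂ : N₂ ≤ N) (hu : u.length + 1 ≤ N)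
    {c : CounterConfig V₂ C} (i : CounterInstr V₂ C) (hc : c.Bounded u.length N₂)
    (hc' : ((counterDevice C u).exec i c).Bounded u.length N₂) :
    (execComp i).Runs (counterDevice C w) (Bounded w.length N) (compConfig V₁ p c) ()
      (compConfig V₁ p ((counterDevice C u).exec i c)) := by
  have hb := bounded_compConfig (V₁ := V₁) hp hc hN₂ hu
  have hb' := bounded_compConfig (V₁ := V₁) hp hc' hN₂ hu
  have key : ∀ j, (counterDevice C w).exec j (compConfig V₁ p c) =
      compConfig V₁ p ((counterDevice C u).exec i c) →
      (op j).Runs (counterDevice C w) (Bounded w.length N) (compConfig V₁ p c) ()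
        (compConfig V₁ p ((counterDevice C u).exec i c)) := by
    intro j hj
    rw [← hj] at hb' ⊢
    exact runs_op hb hb'
  cases i with
  | nop => exact runs_pure _ hb
  | inc v => exact key (.inc (.inl v)) (by
      ext (u | u | u) <;> simp [counterDevice, compConfig, set_reg])
  | dec v => exact key (.dec (.inl v)) (by
      ext (u | u | u) <;> simp [counterDevice, compConfig, set_reg])
  | left => exact key (.dec (.inr (.inr 0))) (by
      ext (u | u | u) <;> simp [counterDevice, compConfig, set_reg]
      fin_cases u <;> simp)
  | right => exact key (.inc (.inr (.inr 0))) (by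
      ext (u | u | u) <;> simp [counterDevice, compConfig, set_reg]
      fin_cases u <;> simp)
  | emit b => exact key (.emit b) rfl

end CounterProg

/-- The functions computed by counter machines are closed under composition. -/
theorem CounterComputable.comp {A B C : Type} [Finite A] [Finite B] {f : List B → List C}
    {g : List A → List B} (hf : CounterComputable f) (hg : CounterComputable g) :
    CounterComputable (f ∘ g) := by
  -- The head position and the counters of the second program are bounded in terms of the length of
  -- `g w`, which must therefore be polynomial in that of `w`.
  obtain ⟨m, hm⟩ := hg.length_le
  obtain ⟨V₂, _, _, F₂, k₂, h₂⟩ := hf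
  obtain ⟨V₁, _, _, F₁, k₁, h₁⟩ := hg
  refine ⟨V₂ ⊕ V₁ ⊕ Fin 3, inferInstance, inferInstance,
    (Control.transl (T := Unit) ((CounterProg.query F₁).bind CounterProg.observe)
      (fun i _ => CounterProg.execComp i) F₂ ()).map fun _ => (), k₁ + (m + 2) + (m + 2) * k₂,
    fun w => ?_⟩
  obtain ⟨c₁, hc₁, ho₁⟩ := h₁ w
  obtain ⟨c₂, hc₂, ho₂⟩ := h₂ (g w)
  rw [← ho₁] at hc₂
  set n := w.length
  have hN : ∀ k ≤ k₁ + (m + 2) + (m + 2) * k₂,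
    (n + 2) ^ k ≤ (n + 2) ^ (k₁ + (m + 2) + (m + 2) * k₂) :=
    fun k hk => Nat.pow_le_pow_right (by omega) hk
  have hu : c₁.out.length + 2 ≤ (n + 2) ^ (m + 2) := by
    have h := hm w
    rw [← ho₁] at h
    have h1 : 1 ≤ (n + 2) ^ m := Nat.one_le_pow _ _ (by omega)
    have h2 : 2 ^ 2 ≤ (n + 2) ^ 2 := Nat.pow_le_pow_left (by omega) 2
    rw [pow_add]
    change c₁.out.length ≤ (n + 2) ^ m at h
    nlinarith
  have hN₁ := hN k₁ (by omega)
  have hN₂ : (c₁.out.length + 2) ^ k₂ ≤ (n + 2) ^ (k₁ + (m + 2) + (m + 2) * k₂) := by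
    refine (Nat.pow_le_pow_left hu _).trans ?_
    rw [← pow_mul]
    exact hN _ (by omega)
  have hu' := (show c₁.out.length + 1 ≤ (n + 2) ^ (m + 2) by omega).trans (hN _ (by omega))
  obtain ⟨⟨⟩, d, hd, p, -, rfl⟩ := Control.Runs.transl (D' := counterDevice C w)
    (ok' := CounterConfig.Bounded n ((n + 2) ^ (k₁ + (m + 2) + (m + 2) * k₂)))
    (rd := (CounterProg.query F₁).bind CounterProg.observe)
    (im := fun i _ => CounterProg.execComp i) (T := Unit)
    (fun c _ c' => ∃ p ≤ n + 1, c' = CounterProg.compConfig V₁ p c)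
    (by
      rintro c _ _ hc ⟨p, hp, rfl⟩
      obtain ⟨p', hp', hq⟩ := CounterProg.runs_query hc₁ hN₁ hN₂ hu' hp hc
      exact ⟨_, hq.bind (CounterProg.runs_observe _ hq.ok_end), p', hp', rfl⟩)
    (by
      rintro i c _ _ hc hc' ⟨p, hp, rfl⟩
      exact ⟨(), _, CounterProg.runs_execComp hp hN₂ hu' i hc hc', p, hp, rfl⟩)
    hc₂ (t := ()) (c' := CounterConfig.init _ C) (by
      refine ⟨0, Nat.zero_le _, ?_⟩
      ext (v | v | v) <;> simp [CounterConfig.init, CounterProg.compConfig]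
      fin_cases v <;> simp)
  exact ⟨_, hd.map fun _ => (), ho₂⟩

/-! ### Closure properties of the functions computable in logarithmic space -/

/-- Relabel the letters on an input tape. -/
def TapeSymbol.map {X X' : Type*} (e : X → X') : TapeSymbol X → TapeSymbol X'
  | .leftEnd => .leftEnd
  | .letter a => .letter (e a)
  | .rightEnd => .rightEnd

namespace Transducer

variable {X X' Y Y' : Type*}

theorem inputSymbol_map (e : X → X') (w : List X) (p : ℕ) :
    inputSymbol (w.map e) p = (inputSymbol w p).map e := by
  cases p with
  | zero => rfl
  | succ p =>
    simp only [inputSymbol, List.getElem?_map]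
    cases w[p]? <;> rfl

/-- The transducer with relabelled inputs and outputs. -/
def relabel (M : Transducer X Y) (e : X' → X) (d : Y → Y') : Transducer X' Y' where
  State := M.State
  Work := M.Work
  finiteState := M.finiteState
  finiteWork := M.finiteWork
  start := M.start
  blank := M.blank
  trans q s x := (M.trans q (s.map e) x).map fun a =>
    { state := a.state
      inputMove := a.inputMove
      write := a.write
      workMove := a.workMove
      output := a.output.map d }

/-- The configuration with relabelled output. -/
def Config.relabel {M : Transducer X Y} (e : X' → X) (d : Y → Y') (c : M.Config) :
    (M.relabel e d).Config :=
  ⟨c.state, c.inputPos, c.work, c.workPos, c.out.map d⟩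

theorem step_relabel (M : Transducer X Y) (e : X' → X) (d : Y → Y') (w : List X') (c : M.Config) :
    (M.relabel e d).step w (c.relabel e d) = (M.step (w.map e) c).map (Config.relabel e d) := by
  simp only [step, relabel, Config.relabel, inputSymbol_map, List.length_map]
  rcases M.trans c.state ((inputSymbol w c.inputPos).map e) (c.work c.workPos) with _ | a
  · rfl
  · exact congrArg (fun o => some (Config.mk (M := M.relabel e d) a.state _ _ _ o))
      List.map_append.symm

theorem reachable_relabel {M : Transducer X Y} {e : X' → X} {d : Y → Y'} {w : List X'}
    {c : M.Config} (h : M.Reachable (w.map e) c) :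
    (M.relabel e d).Reachable w (c.relabel e d) := by
  induction h with
  | refl => exact .refl
  | tail _ h ih => exact ih.tail (by rw [step_relabel, h]; rfl)

theorem exists_of_reachable_relabel {M : Transducer X Y} {e : X' → X} {d : Y → Y'} {w : List X'}
    {c' : (M.relabel e d).Config} (h : (M.relabel e d).Reachable w c') :
    ∃ c : M.Config, M.Reachable (w.map e) c ∧ c' = c.relabel e d := by
  induction h with
  | refl => exact ⟨_, .refl, rfl⟩
  | tail _ h ih =>
    obtain ⟨c, hc, rfl⟩ := ih
    rw [step_relabel, Option.map_eq_some_iff] at h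
    obtain ⟨c', h, rfl⟩ := h
    exact ⟨c', hc.tail h, rfl⟩

end Transducer

/-- Counter machines are only considered over alphabets in `Type`. Relabelling by some `Fin n`
transfers their closure properties to finite alphabets in any universe. -/
theorem LogspaceComputable.relabel {X X' Y Y' : Type*} {f : List X → List Y}
    (hf : LogspaceComputable f) (e : X' → X) (d : Y → Y') :
    LogspaceComputable fun w => (f (w.map e)).map d := by
  obtain ⟨M, k, hM⟩ := hf
  refine ⟨M.relabel e d, k, fun w => ?_⟩
  obtain ⟨⟨c, hc, hstep, hout⟩, hs⟩ := hM (w.map e)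
  rw [List.length_map] at hs
  refine ⟨⟨c.relabel e d, Transducer.reachable_relabel hc, ?_, ?_⟩, fun c' hc' => ?_⟩
  · rw [Transducer.step_relabel, hstep]; rfl
  · simp [Transducer.Config.relabel, hout]
  · obtain ⟨c, hc, rfl⟩ := Transducer.exists_of_reachable_relabel hc'
    exact hs c hc

section

variable {A B C : Type*} [Finite A] [Finite B] [Finite C]

theorem exists_relabelling (A : Type*) [Finite A] :
    ∃ (n : ℕ) (e : A → Fin n) (e' : Fin n → A), (∀ a, e' (e a) = a) ∧ ∀ i, e (e' i) = i := by
  obtain ⟨n, ⟨e⟩⟩ := Finite.exists_equiv_fin A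
  exact ⟨n, e, e.symm, e.symm_apply_apply, e.apply_symm_apply⟩

theorem List.map_map_of_leftInverse {A A' : Type*} {e : A → A'} {e' : A' → A}
    (h : ∀ a, e' (e a) = a) (w : List A) : (w.map e).map e' = w := by
  simp [Function.comp_def, h]

/-- The functions computable in logarithmic space are closed under composition. -/
theorem LogspaceComputable.comp {f : List B → List C} {g : List A → List B}
    (hf : LogspaceComputable f) (hg : LogspaceComputable g) : LogspaceComputable (f ∘ g) := by
  obtain ⟨a, eA, eA', hA, hA'⟩ := exists_relabelling A
  obtain ⟨b, eB, eB', hB, hB'⟩ := exists_relabelling B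
  obtain ⟨c, eC, eC', hC, hC'⟩ := exists_relabelling C
  have hf' := (hf.relabel eB' eC).counterComputable
  have hg' := (hg.relabel eA' eB).counterComputable
  have := (hf'.comp hg').logspaceComputable.relabel eA eC'
  simpa only [Function.comp_def, List.map_map_of_leftInverse hA, List.map_map_of_leftInverse hB,
    List.map_map_of_leftInverse hC] using this

/-- A function defined by cases according to whether `true` occurs in the output of a third
function. -/
theorem LogspaceComputable.ite {t : List A → List Bool} {f g : List A → List B}
    (ht : LogspaceComputable t) (hf : LogspaceComputable f) (hg : LogspaceComputable g) :
    LogspaceComputable fun w => if true ∈ t w then f w else g w := by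
  obtain ⟨a, eA, eA', hA, hA'⟩ := exists_relabelling A
  obtain ⟨b, eB, eB', hB, hB'⟩ := exists_relabelling B
  have ht' := (ht.relabel eA' id).counterComputable
  have hf' := (hf.relabel eA' eB).counterComputable
  have hg' := (hg.relabel eA' eB).counterComputable
  have := (ht'.ite hf' hg').logspaceComputable.relabel eA eB'
  simpa only [apply_ite (List.map eB'), List.map_id, List.map_map_of_leftInverse hA,
    List.map_map_of_leftInverse hB] using this

theorem markAt_map {A A' : Type*} (e : A → A') (w : List A) (t : ℕ) :
    markAt (w.map e) t = (markAt w t).map (Prod.map e id) := by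
  refine List.ext_getElem? fun i => ?_
  simp [markAt, List.getElem?_mapIdx, Function.comp_def]

/-- A loop over the positions of the input. -/
theorem LogspaceComputable.markLoop {f : List (A × Bool) → List B} (hf : LogspaceComputable f) :
    LogspaceComputable (markLoop f) := by
  obtain ⟨a, eA, eA', hA, hA'⟩ := exists_relabelling A
  obtain ⟨b, eB, eB', hB, hB'⟩ := exists_relabelling B
  have := (hf.relabel (Prod.map eA' id) eB).counterComputable.markLoop.logspaceComputable.relabel
    eA eB'
  have hAB : ∀ p : A × Bool, Prod.map eA' id (Prod.map eA id p) = p := by simp [hA]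
  change LogspaceComputable fun w => (List.range w.length).flatMap fun t => f (markAt w t)
  simpa only [_root_.markLoop, List.map_flatMap, List.length_map, markAt_map,
    List.map_map_of_leftInverse hAB, List.map_map_of_leftInverse hB] using this

end

/-! ### Finite automata with output -/

/-- The output of a finite automaton that in the state `s` and on the letter `a` enters the state
`(δ s a).1` and writes `(δ s a).2`. -/
def mealy {A B S : Type*} (δ : S → A → S × List B) : S → List A → List B
  | _, [] => []
  | s, a :: w => (δ s a).2 ++ mealy δ (δ s a).1 w

namespace TapeProg

variable {A B S : Type} [Finite S] (δ : S → A → S × List B) (s₀ : S) (r : A → List B)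

/-- A program that reads the input forwards, as an automaton with output, and then backwards, where
the letter `a` is translated to `r a`. -/
def twoPass : TapeProg A Unit B Unit where
  Q := S ⊕ Unit
  finite := inferInstance
  start := .inl s₀
  act
    | .inl s, (.leftEnd, _) => (.inl (.inl s), ⟨.right, (), .stay, []⟩)
    | .inl s, (.letter a, _) => (.inl (.inl (δ s a).1), ⟨.right, (), .stay, (δ s a).2⟩)
    | .inl _, (.rightEnd, _) => (.inl (.inr ()), ⟨.left, (), .stay, []⟩)
    | .inr _, (.letter a, _) => (.inl (.inr ()), ⟨.left, (), .stay, r a⟩)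
    | .inr _, _ => (.inr (), ⟨.stay, (), .stay, []⟩)

theorem run_twoPass_step {w : List A} {n : ℕ} (hn : 0 < n) {q q' : S ⊕ Unit} {p p' : ℕ}
    {m : HeadMove} {o o' : List B} {c : TapeConfig Unit B}
    (ha : (twoPass δ s₀ r).act q (Transducer.inputSymbol w p, ()) =
      (.inl q', ⟨m, (), .stay, o'⟩))
    (hp : min (m.apply p) (w.length + 1) = p')
    (hc : (twoPass δ s₀ r).Run (tapeDevice Unit B w) (fun c => c.workPos < n)
      (.inl q') ⟨p', fun _ => (), 0, o ++ o'⟩ () c) :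
    (twoPass δ s₀ r).Run (tapeDevice Unit B w) (fun c => c.workPos < n)
      (.inl q) ⟨p, fun _ => (), 0, o⟩ () c := by
  refine .step _ _ _ _ hn ?_
  change (twoPass δ s₀ r).Run _ _
    ((twoPass δ s₀ r).act q (Transducer.inputSymbol w p, ())).1
    ((tapeDevice Unit B w).exec ((twoPass δ s₀ r).act q (Transducer.inputSymbol w p, ())).2 _) _ _
  rw [ha]
  subst hp
  exact hc

theorem run_twoPass_backward {n : ℕ} (hn : 0 < n) (u v : List A) (o : List B) :
    ∃ c, (twoPass δ s₀ r).Run (tapeDevice Unit B (u ++ v)) (fun c => c.workPos < n)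
      (.inl (.inr ())) ⟨u.length, fun _ => (), 0, o⟩ () c ∧ c.out = o ++ u.reverse.flatMap r := by
  induction u using List.reverseRecOn generalizing v o with
  | nil =>
    exact ⟨⟨_, _, 0, o ++ []⟩, .step _ _ _ _ hn (.exit _ _ hn), by simp⟩
  | append_singleton u a ih =>
    obtain ⟨c, hc, ho⟩ := ih (a :: v) (o ++ r a)
    have hs : Transducer.inputSymbol (u ++ [a] ++ v) (u ++ [a]).length = .letter a := by
      simp [Transducer.inputSymbol]
    refine ⟨c, run_twoPass_step δ s₀ r (m := .left) (q' := .inr ()) (o' := r a) hn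
      (by rw [hs]; rfl) (p' := u.length) (by simp [HeadMove.apply]; omega) ?_, by simp [ho]⟩
    simpa using hc

theorem run_twoPass_forward {n : ℕ} (hn : 0 < n) (u v : List A) (s : S) (o : List B) :
    ∃ c, (twoPass δ s₀ r).Run (tapeDevice Unit B (u ++ v)) (fun c => c.workPos < n)
      (.inl (.inl s)) ⟨u.length + 1, fun _ => (), 0, o⟩ () c ∧
      c.out = o ++ mealy δ s v ++ (u ++ v).reverse.flatMap r := by
  induction v generalizing u s o with
  | nil =>
    obtain ⟨c, hc, ho⟩ := run_twoPass_backward δ s₀ r hn u [] o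
    have hs : Transducer.inputSymbol (u ++ []) (u.length + 1) = .rightEnd := by
      simp [Transducer.inputSymbol]
    refine ⟨c, run_twoPass_step δ s₀ r (m := .left) (q' := .inr ()) (o' := []) hn
      (by rw [hs]; rfl) (p' := u.length) (by simp [HeadMove.apply]) ?_, by simp [ho, mealy]⟩
    simpa using hc
  | cons a v ih =>
    obtain ⟨c, hc, ho⟩ := ih (u ++ [a]) (δ s a).1 (o ++ (δ s a).2)
    have hs : Transducer.inputSymbol (u ++ a :: v) (u.length + 1) = .letter a := by
      simp [Transducer.inputSymbol]
    refine ⟨c, run_twoPass_step δ s₀ r (m := .right) (q' := .inl (δ s a).1) (o' := (δ s a).2) hn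
      (by rw [hs]; rfl) (p' := u.length + 2) (by simp [HeadMove.apply]) ?_,
      by simp [ho, mealy]⟩
    simpa using hc

theorem logspaceComputable_twoPass :
    LogspaceComputable fun w => mealy δ s₀ w ++ w.reverse.flatMap r := by
  refine logspaceComputable () (twoPass δ s₀ r) 1 fun w => ?_
  have hn : 0 < 1 * (Nat.log 2 w.length + 1) := by omega
  obtain ⟨c, hc, ho⟩ := run_twoPass_forward δ s₀ r hn [] w s₀ []
  refine ⟨c, run_twoPass_step δ s₀ r (m := .right) (q' := .inl s₀) (o' := []) hn rfl (p' := 1)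
    (by simp [HeadMove.apply]) ?_, by simpa using ho⟩
  simpa using hc

end TapeProg

theorem mealy_map {A A' B B' S : Type*} (e : A' → A) (d : B → B') (δ : S → A → S × List B) (s : S)
    (w : List A') :
    (mealy δ s (w.map e)).map d =
      mealy (fun s a => ((δ s (e a)).1, (δ s (e a)).2.map d)) s w := by
  induction w generalizing s with
  | nil => rfl
  | cons a w ih => simp [mealy, ih]

/-- A word is read forwards by a finite automaton with output, and then backwards letter by
letter. -/
theorem logspaceComputable_mealy_append {A B : Type*} [Finite A] [Finite B] {S : Type} [Finite S]
    (δ : S → A → S × List B) (s : S) (r : A → List B) :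
    LogspaceComputable fun w => mealy δ s w ++ w.reverse.flatMap r := by
  obtain ⟨a, eA, eA', hA, hA'⟩ := exists_relabelling A
  obtain ⟨b, eB, eB', hB, hB'⟩ := exists_relabelling B
  have := (TapeProg.logspaceComputable_twoPass
    (fun s i => ((δ s (eA' i)).1, (δ s (eA' i)).2.map eB)) s
    (fun i => (r (eA' i)).map eB)).relabel eA eB'
  simpa only [List.map_append, mealy_map, hA, List.map_map_of_leftInverse hB, List.map_flatMap,
    ← List.map_reverse, List.flatMap_map] using this

theorem logspaceComputable_mealy {A B : Type*} [Finite A] [Finite B] {S : Type} [Finite S]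
    (δ : S → A → S × List B) (s : S) : LogspaceComputable (mealy δ s) := by
  have h : ∀ w : List A, w.flatMap (fun _ => ([] : List B)) = [] := fun w => by simp
  simpa [h] using logspaceComputable_mealy_append δ s fun _ => ([] : List B)

theorem mealy_unit {A B : Type*} (r : A → List B) (w : List A) :
    mealy (fun (_ : Unit) a => ((), r a)) () w = w.flatMap r := by
  induction w with
  | nil => rfl
  | cons a w ih => simp [mealy, ih]

theorem logspaceComputable_flatMap {A B : Type*} [Finite A] [Finite B] (r : A → List B) :
    LogspaceComputable fun w : List A => w.flatMap r := by
  simpa only [funext (mealy_unit r)] using logspaceComputable_mealy (fun (_ : Unit) a => ((), r a)) ()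

/-! ### Syllables in a group with a family of subgroups -/

section Syllables

variable {ι Γ : Type*} [DecidableEq ι] [Group Γ] (K : ι → Subgroup Γ)

/-- A list of syllables is reduced if its syllables are nontrivial elements of the subgroups `K i`,
and if consecutive syllables have different types. -/
def IsReducedList (l : List (ι × Γ)) : Prop :=
  l.IsChain (fun s t => s.1 ≠ t.1) ∧ ∀ s ∈ l, s.2 ∈ K s.1 ∧ s.2 ≠ 1

/-- The product of the syllables. -/
def syllableProd (l : List (ι × Γ)) : Γ := (l.map Prod.snd).prod

/-- The first syllable, if it has type `i`, and `1` otherwise. -/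
def leadSyllable (i : ι) : List (ι × Γ) → Γ
  | [] => 1
  | s :: _ => if s.1 = i then s.2 else 1

/-- The list without its first syllable, if this has type `i`. -/
def dropSyllable (i : ι) : List (ι × Γ) → List (ι × Γ)
  | [] => []
  | s :: l => if s.1 = i then l else s :: l

/-- The first syllable, if there is one, does not have type `i`. -/
def AvoidsType (i : ι) (l : List (ι × Γ)) : Prop := ∀ s ∈ l.head?, s.1 ≠ i

open Classical in
/-- Put a syllable in front of a list, unless it is trivial. -/
noncomputable def pushSyllable (i : ι) (a : Γ) (l : List (ι × Γ)) : List (ι × Γ) :=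
  if a = 1 then l else (i, a) :: l

/-- Multiply a list of syllables from the left by an element of `K i`. -/
noncomputable def mulSyllable (i : ι) (a : Γ) (l : List (ι × Γ)) : List (ι × Γ) :=
  pushSyllable i (a * leadSyllable i l) (dropSyllable i l)

variable {K} {i : ι} {a b : Γ} {l : List (ι × Γ)}

@[simp] theorem syllableProd_nil : syllableProd ([] : List (ι × Γ)) = 1 := rfl

@[simp] theorem syllableProd_cons (s : ι × Γ) : syllableProd (s :: l) = s.2 * syllableProd l := by
  simp [syllableProd]

@[simp] theorem pushSyllable_one : pushSyllable i 1 l = l := if_pos rfl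

theorem pushSyllable_of_ne (h : a ≠ 1) : pushSyllable i a l = (i, a) :: l := if_neg h

@[simp] theorem syllableProd_push : syllableProd (pushSyllable i a l) = a * syllableProd l := by
  by_cases h : a = 1
  · simp [h]
  · simp [pushSyllable_of_ne h]

theorem lead_mul_syllableProd_drop : leadSyllable i l * syllableProd (dropSyllable i l) =
    syllableProd l := by
  cases l with
  | nil => simp [leadSyllable, dropSyllable]
  | cons s l => by_cases h : s.1 = i <;> simp [leadSyllable, dropSyllable, h]

theorem syllableProd_mul : syllableProd (mulSyllable i a l) = a * syllableProd l := by
  rw [mulSyllable, syllableProd_push, mul_assoc, lead_mul_syllableProd_drop]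

theorem AvoidsType.lead (h : AvoidsType i l) : leadSyllable i l = 1 := by
  cases l with
  | nil => rfl
  | cons s l => exact if_neg (h s rfl)

theorem AvoidsType.drop (h : AvoidsType i l) : dropSyllable i l = l := by
  cases l with
  | nil => rfl
  | cons s l => exact if_neg (h s rfl)

theorem AvoidsType.mulSyllable (h : AvoidsType i l) : mulSyllable i a l = pushSyllable i a l := by
  rw [_root_.mulSyllable, h.lead, h.drop, mul_one]

theorem AvoidsType.lead_push (h : AvoidsType i l) : leadSyllable i (pushSyllable i a l) = a := by
  by_cases ha : a = 1
  · simp [ha, h.lead]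
  · simp [pushSyllable_of_ne ha, leadSyllable]

theorem AvoidsType.drop_push (h : AvoidsType i l) : dropSyllable i (pushSyllable i a l) = l := by
  by_cases ha : a = 1
  · simp [ha, h.drop]
  · simp [pushSyllable_of_ne ha, dropSyllable]

theorem isReducedList_nil : IsReducedList K [] := ⟨.nil, by simp⟩

theorem isReducedList_cons {s : ι × Γ} : IsReducedList K (s :: l) ↔
    s.2 ∈ K s.1 ∧ s.2 ≠ 1 ∧ AvoidsType s.1 l ∧ IsReducedList K l := by
  simp only [IsReducedList, List.isChain_cons, List.forall_mem_cons, AvoidsType, ne_comm]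
  tauto

namespace IsReducedList

theorem lead_mem (h : IsReducedList K l) : leadSyllable i l ∈ K i := by
  cases l with
  | nil => exact one_mem _
  | cons s l =>
    rw [leadSyllable]
    split_ifs with hs
    · exact hs ▸ (isReducedList_cons.1 h).1
    · exact one_mem _

theorem avoidsType_of_lead (h : IsReducedList K l) (hl : leadSyllable i l = 1) :
    AvoidsType i l := by
  cases l with
  | nil => simp [AvoidsType]
  | cons s l =>
    rintro t ⟨⟩ hs
    rw [leadSyllable, if_pos hs] at hl
    exact (isReducedList_cons.1 h).2.1 hl

theorem drop (h : IsReducedList K l) : IsReducedList K (dropSyllable i l) := by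
  cases l with
  | nil => exact h
  | cons s l =>
    rw [dropSyllable]
    split_ifs with hs
    · exact (isReducedList_cons.1 h).2.2.2
    · exact h

theorem avoidsType_drop (h : IsReducedList K l) : AvoidsType i (dropSyllable i l) := by
  cases l with
  | nil => simp [AvoidsType, dropSyllable]
  | cons s l =>
    rw [dropSyllable]
    split_ifs with hs
    · exact hs ▸ (isReducedList_cons.1 h).2.2.1
    · rintro t ⟨⟩
      exact hs

theorem push_lead_drop (h : IsReducedList K l) :
    pushSyllable i (leadSyllable i l) (dropSyllable i l) = l := by
  cases l with
  | nil => simp [leadSyllable, dropSyllable]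
  | cons s l =>
    by_cases hs : s.1 = i
    · simp only [leadSyllable, dropSyllable, if_pos hs]
      rw [pushSyllable_of_ne (isReducedList_cons.1 h).2.1, ← hs]
    · simp [leadSyllable, dropSyllable, hs]

theorem push (h : IsReducedList K l) (ha : a ∈ K i) (hl : AvoidsType i l) :
    IsReducedList K (pushSyllable i a l) := by
  by_cases h1 : a = 1
  · simpa [h1] using h
  · rw [pushSyllable_of_ne h1, isReducedList_cons]
    exact ⟨ha, h1, hl, h⟩

theorem mul (h : IsReducedList K l) (ha : a ∈ K i) : IsReducedList K (mulSyllable i a l) :=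
  h.drop.push (mul_mem ha h.lead_mem) h.avoidsType_drop

theorem mulSyllable_one (h : IsReducedList K l) : mulSyllable i 1 l = l := by
  rw [mulSyllable, one_mul, h.push_lead_drop]

/-- What remains of a reduced list after its syllable of type `i` is removed does not begin with
type `i`. So a syllable of type `i` that is put in front can be taken off again, even if it was
trivial and therefore omitted. -/
theorem mulSyllable_mul (h : IsReducedList K l) :
    mulSyllable i (a * b) l = mulSyllable i a (mulSyllable i b l) := by
  simp only [mulSyllable, h.avoidsType_drop.lead_push, h.avoidsType_drop.drop_push, mul_assoc]

end IsReducedList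

variable (K) in
/-- The action of the subgroup `K i` on the reduced lists. -/
@[reducible] noncomputable def syllableAction (i : ι) :
    MulAction (K i) {l : List (ι × Γ) // IsReducedList K l} where
  smul a l := ⟨mulSyllable i a l, l.2.mul a.2⟩
  one_smul l := Subtype.ext l.2.mulSyllable_one
  mul_smul _ _ l := Subtype.ext l.2.mulSyllable_mul

variable (K) in
/-- The action of the subgroup `K i` on the reduced lists, as a homomorphism. -/
noncomputable def syllableHom (i : ι) :
    K i →* Equiv.Perm {l : List (ι × Γ) // IsReducedList K l} :=
  letI := syllableAction K i
  MulAction.toPermHom _ _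

variable (K) in
/-- The function `nf` writes each element as a reduced product of syllables, compatibly with
multiplication from the left. -/
structure IsReducedForm (nf : Γ → List (ι × Γ)) : Prop where
  reduced : ∀ u, IsReducedList K (nf u)
  prod_nf : ∀ u, syllableProd (nf u) = u
  nf_one : nf 1 = []
  nf_mul : ∀ {i a}, a ∈ K i → ∀ u, nf (a * u) = mulSyllable i a (nf u)

/-! ### Uniqueness of reduced forms, and first syllables of products -/

namespace IsReducedForm

variable {nf : Γ → List (ι × Γ)}

theorem nf_syllableProd (hnf : IsReducedForm K nf) (hl : IsReducedList K l) :
    nf (syllableProd l) = l := by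
  induction l with
  | nil => exact hnf.nf_one
  | cons s l ih =>
    obtain ⟨h₁, h₂, h₃, h₄⟩ := isReducedList_cons.1 hl
    rw [syllableProd_cons, hnf.nf_mul h₁, ih h₄, h₃.mulSyllable, pushSyllable_of_ne h₂]

theorem lead_mul (hnf : IsReducedForm K nf) (ha : a ∈ K i) (u : Γ) :
    leadSyllable i (nf (a * u)) = a * leadSyllable i (nf u) := by
  rw [hnf.nf_mul ha, mulSyllable, (hnf.reduced u).avoidsType_drop.lead_push]

theorem nf_of_mem (hnf : IsReducedForm K nf) (ha : a ∈ K i) : nf a = pushSyllable i a [] := by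
  rw [← mul_one a, hnf.nf_mul ha, hnf.nf_one, mul_one]
  simp [mulSyllable, leadSyllable, dropSyllable]

theorem lead_of_mem (hnf : IsReducedForm K nf) (ha : a ∈ K i) : leadSyllable i (nf a) = a := by
  simpa [hnf.nf_one, leadSyllable] using hnf.lead_mul ha 1

theorem lead_of_mem_of_ne (hnf : IsReducedForm K nf) {j : ι} (ha : a ∈ K j) (hij : j ≠ i) :
    leadSyllable i (nf a) = 1 := by
  rw [hnf.nf_of_mem ha]
  by_cases h : a = 1
  · simp [h, leadSyllable]
  · simp [pushSyllable_of_ne h, leadSyllable, hij]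

theorem eq_nil_of_avoidsType (hnf : IsReducedForm K nf) (hl : IsReducedList K l)
    (hi : AvoidsType i l) (h : syllableProd l ∈ K i) : l = [] := by
  have h₁ := hnf.lead_of_mem h
  rw [hnf.nf_syllableProd hl, hi.lead] at h₁
  rw [← hnf.nf_syllableProd hl, ← h₁, hnf.nf_one]

/-- Multiplication by `c` from the right can only merge with or cancel the last syllable, so no new
syllable of type `i` can come to the front unless the list is empty. -/
theorem lead_syllableProd_mul (hnf : IsReducedForm K nf) {c : Γ} {j : ι} (hc : c ∈ K j)
    (hl : IsReducedList K l) (h0 : l ≠ []) (hi : AvoidsType i l) :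
    leadSyllable i (nf (syllableProd l * c)) = 1 := by
  induction l generalizing i with
  | nil => exact absurd rfl h0
  | cons s l ih =>
    obtain ⟨h₁, h₂, h₃, h₄⟩ := isReducedList_cons.1 hl
    have hs : s.1 ≠ i := hi s rfl
    rw [syllableProd_cons, mul_assoc]
    by_cases h : AvoidsType s.1 (nf (syllableProd l * c))
    · rw [hnf.nf_mul h₁, h.mulSyllable, pushSyllable_of_ne h₂]
      exact if_neg hs
    · have hl0 : l = [] := by
        by_contra h'
        exact h ((hnf.reduced _).avoidsType_of_lead (ih h₄ h' h₃))
      subst hl0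
      rw [syllableProd_nil, one_mul] at h ⊢
      rcases eq_or_ne j s.1 with rfl | hj
      · exact hnf.lead_of_mem_of_ne (mul_mem h₁ hc) hs
      · exact absurd ((hnf.reduced _).avoidsType_of_lead (hnf.lead_of_mem_of_ne hc hj)) h

/-- Multiplication from the right by a syllable does not change the first syllable, unless both
factors lie in the same subgroup. -/
theorem lead_mul_right (hnf : IsReducedForm K nf) {u c : Γ} {j : ι} (hc : c ∈ K j)
    (h : ¬ (j = i ∧ u ∈ K i)) : leadSyllable i (nf (u * c)) = leadSyllable i (nf u) := by
  have hu := hnf.reduced u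
  have hp : leadSyllable i (nf u) * syllableProd (dropSyllable i (nf u)) = u := by
    rw [lead_mul_syllableProd_drop, hnf.prod_nf]
  -- With the leading syllable of type `i` split off from `u`, it remains to see that the rest times
  -- `c` has no such syllable. If the rest is trivial, then `u ∈ K i`, and `c` has another type by
  -- assumption.
  conv_lhs => rw [← hp, mul_assoc, hnf.lead_mul hu.lead_mem]
  suffices leadSyllable i (nf (syllableProd (dropSyllable i (nf u)) * c)) = 1 by rw [this, mul_one]
  by_cases h0 : dropSyllable i (nf u) = []
  · rw [h0, syllableProd_nil, one_mul]
    refine hnf.lead_of_mem_of_ne hc fun hj => h ⟨hj, ?_⟩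
    rw [h0, syllableProd_nil, mul_one] at hp
    exact hp ▸ hu.lead_mem
  · exact hnf.lead_syllableProd_mul hc hu.drop h0 hu.avoidsType_drop

end IsReducedForm

/-! ### Reading the syllables off a word -/

section Words

variable {A B : Type*} {val : A → Γ} {type : A → ι}

theorem evalWord_append (u v : List A) : evalWord val (u ++ v) = evalWord val u * evalWord val v := by
  simp [evalWord]

theorem evalWord_cons (c : A) (v : List A) : evalWord val (c :: v) = val c * evalWord val v := by
  simp [evalWord]

@[simp] theorem evalWord_nil : evalWord val [] = 1 := rfl

theorem evalWord_singleton (c : A) : evalWord val [c] = val c := by simp [evalWord]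

variable (K val type)

open Classical in
/-- The letters of type `i` in a word at the places where the value of the preceding part, multiplied
from the left by `Q`, lies in the coset of `P`. -/
noncomputable def cosetLetters (i : ι) (P : Γ) : Γ → List A → List A
  | _, [] => []
  | Q, c :: v => (if type c = i ∧ P⁻¹ * Q ∈ K i then [c] else []) ++
      cosetLetters i P (Q * val c) v

open Classical in
/-- A letter of `v` is skipped if `u ++ v` has an earlier letter of the same type at a place in the
same coset; otherwise the syllable formed by this letter and the later ones in the same coset is
translated by `out`. -/
noncomputable def wordOutput (out : ι → Γ → List B) : List A → List A → List B
  | _, [] => []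
  | u, c :: v =>
    (if cosetLetters K val type (type c) (evalWord val u) 1 u = [] then
      out (type c) (evalWord val (c :: cosetLetters K val type (type c) 1 1 v)) else []) ++
      wordOutput out (u ++ [c]) v

open Classical in
/-- The translation of a list of syllables, where the syllables at a visited coset are skipped. -/
noncomputable def unvisitedOutput (out : ι → Γ → List B) (V : ι → Γ → Prop) :
    Γ → List (ι × Γ) → List B
  | _, [] => []
  | P, s :: l => (if V s.1 P then [] else out s.1 s.2) ++ unvisitedOutput out V (P * s.2) l

variable {K val type}

theorem cosetLetters_append (i : ι) (P Q : Γ) (u v : List A) :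
    cosetLetters K val type i P Q (u ++ v) =
      cosetLetters K val type i P Q u ++ cosetLetters K val type i P (Q * evalWord val u) v := by
  induction u generalizing Q with
  | nil => simp [cosetLetters]
  | cons c u ih => simp [cosetLetters, ih, evalWord_cons, mul_assoc]

/-- Both `P⁻¹ * Q` and `P'⁻¹ * Q'` get multiplied from the right by the values of the letters read,
which cancel in the quotient; so the two membership tests agree at every place. -/
theorem cosetLetters_congr {i : ι} {P P' Q Q' : Γ} (h : (P⁻¹ * Q) * (P'⁻¹ * Q')⁻¹ ∈ K i)
    (v : List A) : cosetLetters K val type i P Q v = cosetLetters K val type i P' Q' v := by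
  induction v generalizing Q Q' with
  | nil => rfl
  | cons c v ih =>
    have hm : P⁻¹ * Q ∈ K i ↔ P'⁻¹ * Q' ∈ K i := by
      rw [← Subgroup.mul_mem_cancel_left (K i) h (y := P'⁻¹ * Q'), inv_mul_cancel_right]
    rw [cosetLetters, cosetLetters, ih (Q := Q * val c) (Q' := Q' * val c)
      (by simpa [mul_assoc] using h)]
    by_cases h' : P'⁻¹ * Q' ∈ K i <;> simp [hm, h']

/-- Induct from the right. A new letter `c` is collected exactly if it has type `i` and the word
before it lies in `K i`; then the word is its own first syllable and is multiplied by `c`. In all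
other cases `lead_mul_right` says that the first syllable stays the same. -/
theorem evalWord_cosetLetters {nf : Γ → List (ι × Γ)} (hnf : IsReducedForm K nf)
    (hK : ∀ c, val c ∈ K (type c)) (i : ι) (v : List A) :
    evalWord val (cosetLetters K val type i 1 1 v) = leadSyllable i (nf (evalWord val v)) := by
  induction v using List.reverseRecOn with
  | nil => simp [cosetLetters, hnf.nf_one, leadSyllable]
  | append_singleton v c ih =>
    rw [cosetLetters_append, evalWord_append, evalWord_append, ih, evalWord_singleton]
    simp only [cosetLetters, inv_one, one_mul, List.append_nil]
    by_cases h : type c = i ∧ evalWord val v ∈ K i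
    · rw [if_pos (by simpa using h)]
      obtain ⟨rfl, h⟩ := h
      rw [evalWord_singleton, hnf.lead_of_mem h, hnf.lead_of_mem (mul_mem h (hK c))]
    · rw [if_neg (by simpa using h), evalWord_nil, mul_one, hnf.lead_mul_right (hK c) h]

/-- A reduced list that starts in the coset of `P₀` with a syllable of another type never returns to
this coset at a syllable of type `i`, so it does not matter whether the coset counts as visited. The
part `r` has been read already. -/
theorem unvisitedOutput_congr {nf : Γ → List (ι × Γ)} (hnf : IsReducedForm K nf)
    {out : ι → Γ → List B} {i : ι} {V V' : ι → Γ → Prop} {P P₀ : Γ}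
    (hV : ∀ j Q, V' j Q ↔ V j Q ∨ (i = j ∧ Q⁻¹ * P₀ ∈ K j)) (hP : P₀⁻¹ * P ∈ K i)
    (r l : List (ι × Γ)) (hl : IsReducedList K (r ++ l)) (hi : AvoidsType i (r ++ l)) :
    unvisitedOutput out V' (P * syllableProd r) l =
      unvisitedOutput out V (P * syllableProd r) l := by
  induction l generalizing r with
  | nil => rfl
  | cons s l ih =>
    have h₁ := ih (r ++ [s]) (by simpa using hl) (by simpa using hi)
    have h₂ : syllableProd (r ++ [s]) = syllableProd r * s.2 := by simp [syllableProd]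
    rw [h₂, ← mul_assoc] at h₁
    rw [unvisitedOutput, unvisitedOutput, h₁]
    have h₃ : V' s.1 (P * syllableProd r) ↔ V s.1 (P * syllableProd r) := by
      rw [hV, or_iff_left]
      rintro ⟨rfl, h⟩
      have hr : IsReducedList K r :=
        ⟨hl.1.left_of_append, fun t ht => hl.2 t (List.mem_append_left _ ht)⟩
      have hir : AvoidsType s.1 r := by
        cases r with
        | nil => simp [AvoidsType]
        | cons t r => simpa [AvoidsType] using hi
      -- A return to the coset would put the product of `r` in `K s.1`. Then `r` is empty and `s` is
      -- the first syllable, contrary to `hi`.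
      have := hnf.eq_nil_of_avoidsType hr hir (by
        have := mul_mem (inv_mem hP) (inv_mem h)
        simpa [mul_assoc] using this)
      subst this
      exact hi s rfl rfl
    by_cases h' : V s.1 (P * syllableProd r) <;> simp [h₃, h']

open Classical in
theorem unvisitedOutput_push {out : ι → Γ → List B} (hout : ∀ i, out i 1 = []) (i : ι) (a P : Γ)
    (V : ι → Γ → Prop) (l : List (ι × Γ)) : unvisitedOutput out V P (pushSyllable i a l) =
      (if V i P then [] else out i a) ++ unvisitedOutput out V (P * a) l := by
  by_cases ha : a = 1
  · simp [ha, hout]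
  · simp [pushSyllable_of_ne ha, unvisitedOutput]

/-- A word and the list of syllables of its value have the same translation. -/
theorem wordOutput_eq {nf : Γ → List (ι × Γ)} (hnf : IsReducedForm K nf)
    (hK : ∀ c, val c ∈ K (type c)) {out : ι → Γ → List B} (hout : ∀ i, out i 1 = [])
    (u v : List A) : wordOutput K val type out u v = unvisitedOutput out
      (fun i Q => cosetLetters K val type i Q 1 u ≠ []) (evalWord val u) (nf (evalWord val v)) := by
  induction v generalizing u with
  | nil => simp [wordOutput, hnf.nf_one, unvisitedOutput]
  | cons c v ih =>
    -- Reading `c` adds just one coset to those visited, namely that of the value of `u` for the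
    -- type of `c`.
    have hV : ∀ j Q, cosetLetters K val type j Q 1 (u ++ [c]) ≠ [] ↔
        cosetLetters K val type j Q 1 u ≠ [] ∨ (type c = j ∧ Q⁻¹ * evalWord val u ∈ K j) := by
      intro j Q
      rw [cosetLetters_append, one_mul]
      simp only [cosetLetters, List.append_nil, ne_eq, List.append_eq_nil_iff]
      by_cases h : type c = j ∧ Q⁻¹ * evalWord val u ∈ K j
      · simp [h.1, h.2]
      · rw [if_neg h]
        simp [h]
    have hv := hnf.reduced (evalWord val v)
    rw [wordOutput, ih, evalWord_cons, evalWord_cosetLetters hnf hK, evalWord_cons,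
      hnf.nf_mul (hK c), evalWord_append, evalWord_singleton, mulSyllable]
    -- Behind the syllable that contains `c`, the additional visited coset makes no difference.
    have hcongr := unvisitedOutput_congr hnf (out := out) (P₀ := evalWord val u)
      (P := evalWord val u * val c * leadSyllable (type c) (nf (evalWord val v))) hV
      (by simpa [mul_assoc] using mul_mem (hK c) hv.lead_mem) []
      (dropSyllable (type c) (nf (evalWord val v))) hv.drop hv.avoidsType_drop
    rw [syllableProd_nil, mul_one] at hcongr
    have hv' := (hV (type c) (evalWord val u * val c)).2
      (.inr ⟨rfl, by simpa using inv_mem (hK c)⟩)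
    conv_lhs => rw [← hv.push_lead_drop (i := type c)]
    rw [unvisitedOutput_push hout, unvisitedOutput_push hout, ← mul_assoc, hcongr,
      hv.push_lead_drop, if_pos hv', List.nil_append]
    by_cases h : cosetLetters K val type (type c) (evalWord val u) 1 u = [] <;> simp [h]

theorem exists_prefix_of_cosetLetters_ne_nil (hK : ∀ c, val c ∈ K (type c)) {i : ι} {Q : Γ}
    {v : List A} (h : cosetLetters K val type i 1 Q v ≠ []) :
    ∃ q, q <+: v ∧ q ≠ [] ∧ Q * evalWord val q ∈ K i := by
  induction v generalizing Q with
  | nil => exact absurd rfl h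
  | cons c v ih =>
    by_cases hc : type c = i ∧ Q ∈ K i
    · obtain ⟨rfl, hQ⟩ := hc
      exact ⟨[c], by simp, by simp, by simpa [evalWord_singleton] using mul_mem hQ (hK c)⟩
    · obtain ⟨q, hq, -, hq'⟩ := ih (by simpa [cosetLetters, hc] using h)
      exact ⟨c :: q, by simpa using hq, by simp, by simpa [evalWord_cons, mul_assoc] using hq'⟩

/-- The remainder of a word after its longest prefix in `K i` does not begin with a syllable of type
`i`. -/
theorem lead_of_isLongestPrefixIn {nf : Γ → List (ι × Γ)} (hnf : IsReducedForm K nf)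
    (hK : ∀ c, val c ∈ K (type c)) {i : ι} {p v : List A}
    (h : IsLongestPrefixIn val (K i) p (p ++ v)) :
    leadSyllable i (nf (evalWord val v)) = 1 := by
  rw [← evalWord_cosetLetters hnf hK]
  by_contra hne
  obtain ⟨q, hq, hq0, hqK⟩ := exists_prefix_of_cosetLetters_ne_nil hK
    (Q := 1) (i := i) (v := v) fun h' => hne (by rw [h', evalWord_nil])
  have := h.2.2 (p ++ q) ((List.prefix_append_right_inj p).2 hq)
    (by rw [evalWord_append]; exact mul_mem h.2.1 (by simpa using hqK))
  rw [List.length_append] at this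
  exact hq0 (List.length_eq_zero_iff.1 (by omega))

end Words
end Syllables

section Words

variable {ι Γ A B : Type*} [DecidableEq ι] [Group Γ] {K : ι → Subgroup Γ} {val : A → Γ}
  {type : A → ι} {nf : Γ → List (ι × Γ)} {out : ι → Γ → List B}

theorem unvisitedOutput_false (P : Γ) (l : List (ι × Γ)) :
    unvisitedOutput out (fun _ _ => False) P l = l.flatMap fun s => out s.1 s.2 := by
  induction l generalizing P with
  | nil => rfl
  | cons s l ih => simp [unvisitedOutput, ih]

theorem wordOutput_nil (hnf : IsReducedForm K nf) (hK : ∀ c, val c ∈ K (type c))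
    (hout : ∀ i, out i 1 = []) (w : List A) :
    wordOutput K val type out [] w = (nf (evalWord val w)).flatMap fun s => out s.1 s.2 := by
  rw [wordOutput_eq hnf hK hout, ← unvisitedOutput_false (evalWord val [])]
  congr
  ext
  simp [cosetLetters]

theorem evalWord_flatMap_out {out : ι → Γ → List A}
    (hval : ∀ i a, a ∈ K i → evalWord val (out i a) = a) {l : List (ι × Γ)}
    (hl : IsReducedList K l) :
    evalWord val (l.flatMap fun s => out s.1 s.2) = syllableProd l := by
  induction l with
  | nil => rfl
  | cons s l ih =>
    obtain ⟨h₁, -, -, h⟩ := isReducedList_cons.1 hl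
    rw [List.flatMap_cons, evalWord_append, ih h, hval _ _ h₁, syllableProd_cons]

theorem flatMap_out_of_isLongestPrefixIn (hnf : IsReducedForm K nf)
    (hK : ∀ c, val c ∈ K (type c)) (hout : ∀ i, out i 1 = []) {i : ι} {p v : List A}
    (h : IsLongestPrefixIn val (K i) p (p ++ v)) :
    ((nf (evalWord val (p ++ v))).flatMap fun s => out s.1 s.2) =
      out i (evalWord val p) ++ (nf (evalWord val v)).flatMap fun s => out s.1 s.2 := by
  have hv := (hnf.reduced _).avoidsType_of_lead (lead_of_isLongestPrefixIn hnf hK h)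
  rw [evalWord_append, hnf.nf_mul h.2.1, hv.mulSyllable]
  by_cases h1 : evalWord val p = 1
  · simp [h1, hout]
  · simp [pushSyllable_of_ne h1]

end Words

/-! ### The free product of two groups -/

section FreeProduct

open Monoid

variable (G H : Type*) [Group G] [Group H]

/-- The two factors of a free product. -/
def freeFactor : Bool → Subgroup (Coprod G H)
  | false => (Coprod.inl : G →* Coprod G H).range
  | true => (Coprod.inr : H →* Coprod G H).range

/-- The action of a free product on the reduced lists of syllables. -/
noncomputable def coprodHom :
    Coprod G H →* Equiv.Perm {l : List (Bool × Coprod G H) // IsReducedList (freeFactor G H) l} :=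
  Coprod.lift
    ((syllableHom (freeFactor G H) false).comp (Coprod.inl : G →* Coprod G H).rangeRestrict)
    ((syllableHom (freeFactor G H) true).comp (Coprod.inr : H →* Coprod G H).rangeRestrict)

/-- The reduced form of an element of a free product. -/
noncomputable def coprodForm (u : Coprod G H) : List (Bool × Coprod G H) :=
  (coprodHom G H u ⟨[], isReducedList_nil⟩).1

variable {G H}

theorem coprodHom_apply {i : Bool} {a : Coprod G H} (ha : a ∈ freeFactor G H i)
    (l : {l : List (Bool × Coprod G H) // IsReducedList (freeFactor G H) l}) :
    (coprodHom G H a l).1 = mulSyllable i a l.1 := by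
  cases i <;> obtain ⟨a, rfl⟩ := ha <;> rfl

theorem syllableProd_coprodHom (u : Coprod G H)
    (l : {l : List (Bool × Coprod G H) // IsReducedList (freeFactor G H) l}) :
    syllableProd (coprodHom G H u l).1 = u * syllableProd l.1 := by
  induction u using Coprod.induction_on generalizing l with
  | inl a => rw [coprodHom_apply (i := false) ⟨a, rfl⟩, syllableProd_mul]
  | inr a => rw [coprodHom_apply (i := true) ⟨a, rfl⟩, syllableProd_mul]
  | mul u v hu hv => rw [map_mul, Equiv.Perm.mul_apply, hu, hv, mul_assoc]

theorem isReducedForm_coprodForm : IsReducedForm (freeFactor G H) (coprodForm G H) where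
  reduced u := (coprodHom G H u _).2
  prod_nf u := by simp [coprodForm, syllableProd_coprodHom]
  nf_one := by simp [coprodForm]
  nf_mul ha u := by
    rw [coprodForm, map_mul, Equiv.Perm.mul_apply, coprodHom_apply ha]
    rfl

end FreeProduct

section NormalForm

open Monoid

theorem IsFiniteSymmetricGenerating.surjective {X G : Type*} [Group G] {x : X → G}
    (hx : IsFiniteSymmetricGenerating x) : Function.Surjective (evalWord x) := by
  intro a
  have ha : a ∈ Subgroup.closure (Set.range x) := hx.generates ▸ Subgroup.mem_top a
  induction ha using Subgroup.closure_induction with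
  | mem a ha =>
    obtain ⟨c, rfl⟩ := ha
    exact ⟨[c], evalWord_singleton c⟩
  | one => exact ⟨[], rfl⟩
  | mul a b _ _ ha hb =>
    obtain ⟨u, rfl⟩ := ha
    obtain ⟨v, rfl⟩ := hb
    exact ⟨u ++ v, evalWord_append u v⟩
  | inv a _ ha =>
    obtain ⟨u, rfl⟩ := ha
    choose inv hinv using hx.symmetric
    refine ⟨(u.map inv).reverse, ?_⟩
    simp [evalWord, List.prod_inv_reverse, Function.comp_def, hinv]

theorem isFiniteSymmetricGenerating_freeProductGen {X Y G H : Type*} [Group G] [Group H]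
    {x : X → G} {y : Y → H} (hx : IsFiniteSymmetricGenerating x)
    (hy : IsFiniteSymmetricGenerating y) : IsFiniteSymmetricGenerating (freeProductGen x y) where
  finite :=
    have := hx.finite
    have := hy.finite
    inferInstance
  symmetric := by
    rintro (a | b)
    · obtain ⟨c, hc⟩ := hx.symmetric a
      exact ⟨.inl c, by simp [freeProductGen, hc]⟩
    · obtain ⟨c, hc⟩ := hy.symmetric b
      exact ⟨.inr c, by simp [freeProductGen, hc]⟩
  generates := by
    rw [freeProductGen, Set.Sum.elim_range, Subgroup.closure_union,
      Set.range_comp' Coprod.inl x, Set.range_comp' Coprod.inr y, ← MonoidHom.map_closure,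
      ← MonoidHom.map_closure, hx.generates, hy.generates, ← MonoidHom.range_eq_map,
      ← MonoidHom.range_eq_map, Coprod.range_inl_sup_range_inr]

/-- The word for the element `a` that is given by the normal form function `g`, where the identity is
represented by the empty word. -/
noncomputable def elementWord {X G : Type*} [Group G] (x : X → G) (g : List X → List X) (a : G) :
    List X :=
  emptyAtIdentity x g (Function.invFun (evalWord x) a)

section ElementWord

variable {X G : Type*} [Group G] {x : X → G} {g : List X → List X}

theorem elementWord_evalWord (hg : IsLogspaceNormalFormFunction x g) (u : List X) :
    elementWord x g (evalWord x u) = emptyAtIdentity x g u := by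
  obtain ⟨L, hL, hgL⟩ := hg.normalForm
  have h : evalWord x (Function.invFun (evalWord x) (evalWord x u)) = evalWord x u :=
    Function.invFun_eq ⟨u, rfl⟩
  rw [elementWord, emptyAtIdentity, emptyAtIdentity, h]
  congr 1
  exact hL.injOn (hgL _).1 (hgL _).1 (by rw [(hgL _).2, (hgL _).2, h])

theorem elementWord_one (hg : IsLogspaceNormalFormFunction x g) : elementWord x g 1 = [] := by
  rw [← evalWord_nil (val := x), elementWord_evalWord hg]
  exact if_pos rfl

theorem evalWord_elementWord (hg : IsLogspaceNormalFormFunction x g) (a : G) :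
    evalWord x (elementWord x g a) = a := by
  obtain ⟨L, hL, hgL⟩ := hg.normalForm
  obtain ⟨u, rfl⟩ := hg.generating.surjective a
  rw [elementWord_evalWord hg, emptyAtIdentity]
  split_ifs with h
  · exact h.symm
  · exact (hgL u).2

end ElementWord

variable {G H X Y : Type*} [Group G] [Group H] (x : X → G) (y : Y → H)
  (g : List X → List X) (h : List Y → List Y)

/-- The word for an element of one of the two factors of a free product. -/
noncomputable def factorWord : Bool → Coprod G H → List (X ⊕ Y)
  | false, a => (elementWord x g (Coprod.fst a)).map Sum.inl
  | true, a => (elementWord y h (Coprod.snd a)).map Sum.inr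

/-- The normal form function of a free product: the syllables of the reduced form are translated one
by one. -/
noncomputable def coprodNormalForm (w : List (X ⊕ Y)) : List (X ⊕ Y) :=
  (coprodForm G H (evalWord (freeProductGen x y) w)).flatMap fun s => factorWord x y g h s.1 s.2

variable {x y g h}

theorem freeProductGen_mem (c : X ⊕ Y) : freeProductGen x y c ∈ freeFactor G H c.isRight := by
  cases c with
  | inl a => exact ⟨x a, rfl⟩
  | inr b => exact ⟨y b, rfl⟩

theorem evalWord_map {A B Γ : Type*} [Group Γ] (val : B → Γ) (e : A → B) (w : List A) :
    evalWord val (w.map e) = evalWord (val ∘ e) w := by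
  simp [evalWord]

theorem map_evalWord {A Γ Δ : Type*} [Group Γ] [Group Δ] (φ : Γ →* Δ) (val : A → Γ) (w : List A) :
    φ (evalWord val w) = evalWord (φ ∘ val) w := by
  simp [evalWord, map_list_prod]

theorem evalWord_map_inl (u : List X) :
    evalWord (freeProductGen x y) (u.map Sum.inl) = Coprod.inl (evalWord x u) := by
  rw [evalWord_map, map_evalWord]
  rfl

theorem evalWord_map_inr (u : List Y) :
    evalWord (freeProductGen x y) (u.map Sum.inr) = Coprod.inr (evalWord y u) := by
  rw [evalWord_map, map_evalWord]
  rfl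

theorem fst_evalWord (w : List (X ⊕ Y)) :
    Coprod.fst (evalWord (freeProductGen x y) w) = evalWord x (w.filterMap Sum.getLeft?) := by
  induction w with
  | nil => simp
  | cons c w ih =>
    rw [evalWord_cons, map_mul, ih]
    cases c with
    | inl a => exact (evalWord_cons a _).symm
    | inr b => exact one_mul _

theorem snd_evalWord (w : List (X ⊕ Y)) :
    Coprod.snd (evalWord (freeProductGen x y) w) = evalWord y (w.filterMap Sum.getRight?) := by
  induction w with
  | nil => simp
  | cons c w ih =>
    rw [evalWord_cons, map_mul, ih]
    cases c with
    | inl a => exact one_mul _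
    | inr b => exact (evalWord_cons b _).symm

theorem factorWord_one (hg : IsLogspaceNormalFormFunction x g)
    (hh : IsLogspaceNormalFormFunction y h) (i : Bool) : factorWord x y g h i 1 = [] := by
  cases i
  · simp [factorWord, elementWord_one hg]
  · simp [factorWord, elementWord_one hh]

theorem evalWord_factorWord (hg : IsLogspaceNormalFormFunction x g)
    (hh : IsLogspaceNormalFormFunction y h) (i : Bool) (a : Coprod G H)
    (ha : a ∈ freeFactor G H i) :
    evalWord (freeProductGen x y) (factorWord x y g h i a) = a := by
  cases i <;> obtain ⟨a, rfl⟩ := ha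
  · rw [factorWord, evalWord_map_inl, evalWord_elementWord hg, Coprod.fst_apply_inl]
  · rw [factorWord, evalWord_map_inr, evalWord_elementWord hh, Coprod.snd_apply_inr]

theorem evalWord_coprodNormalForm (hg : IsLogspaceNormalFormFunction x g)
    (hh : IsLogspaceNormalFormFunction y h) (w : List (X ⊕ Y)) :
    evalWord (freeProductGen x y) (coprodNormalForm x y g h w) =
      evalWord (freeProductGen x y) w := by
  rw [coprodNormalForm, evalWord_flatMap_out (evalWord_factorWord hg hh)
    (isReducedForm_coprodForm.reduced _), isReducedForm_coprodForm.prod_nf]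

theorem isNormalForm_coprodNormalForm (hg : IsLogspaceNormalFormFunction x g)
    (hh : IsLogspaceNormalFormFunction y h) :
    IsNormalForm (freeProductGen x y) (Set.range (coprodNormalForm x y g h)) := by
  refine ⟨Set.mapsTo_univ _ _, ?_, fun u _ => ?_⟩
  · rintro _ ⟨u, rfl⟩ _ ⟨v, rfl⟩ huv
    rw [evalWord_coprodNormalForm hg hh, evalWord_coprodNormalForm hg hh] at huv
    rw [coprodNormalForm, coprodNormalForm, huv]
  · obtain ⟨w, rfl⟩ :=
      (isFiniteSymmetricGenerating_freeProductGen hg.generating hh.generating).surjective u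
    exact ⟨_, ⟨w, rfl⟩, evalWord_coprodNormalForm hg hh w⟩

theorem isPeelingFunction_coprodNormalForm (hg : IsLogspaceNormalFormFunction x g)
    (hh : IsLogspaceNormalFormFunction y h) :
    IsPeelingFunction x y (emptyAtIdentity x g) (emptyAtIdentity y h)
      (coprodNormalForm x y g h) where
  nil := by simp [coprodNormalForm, isReducedForm_coprodForm.nf_one]
  peelLeft p w hp := by
    rw [coprodNormalForm, flatMap_out_of_isLongestPrefixIn (i := false) isReducedForm_coprodForm
      freeProductGen_mem (factorWord_one hg hh) hp, factorWord, fst_evalWord,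
      elementWord_evalWord hg]
    rfl
  peelRight p w hp := by
    rw [coprodNormalForm, flatMap_out_of_isLongestPrefixIn (i := true) isReducedForm_coprodForm
      freeProductGen_mem (factorWord_one hg hh) hp, factorWord, snd_evalWord,
      elementWord_evalWord hh]
    rfl

end NormalForm

/-! ### Loops over the letters of a word -/

section Marks

variable {A B : Type*}

/-- The word `w` without marks. -/
def unmarked (w : List A) : List (A × Bool) := w.map fun a => (a, false)

@[simp] theorem unmarked_nil : unmarked ([] : List A) = [] := rfl

@[simp] theorem unmarked_cons (a : A) (w : List A) : unmarked (a :: w) = (a, false) :: unmarked w :=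
  rfl

@[simp] theorem unmarked_append (u v : List A) : unmarked (u ++ v) = unmarked u ++ unmarked v :=
  List.map_append

theorem markAt_append_cons (u v : List A) (c : A) :
    markAt (u ++ c :: v) u.length = unmarked u ++ (c, true) :: unmarked v := by
  have h₁ : u.mapIdx (fun i a => (a, decide (i = u.length))) = unmarked u := by
    refine List.ext_getElem (by simp [unmarked]) fun i hi _ => ?_
    simp only [List.length_mapIdx] at hi
    simp [unmarked, hi.ne]
  have h₂ : v.mapIdx (fun i a => (a, decide (i + 1 + u.length = u.length))) = unmarked v := by
    refine List.ext_getElem (by simp [unmarked]) fun i hi _ => ?_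
    simp only [unmarked, List.getElem_mapIdx, List.getElem_map, Prod.mk.injEq, true_and,
      decide_eq_false_iff_not]
    omega
  rw [← h₂]
  simp [markAt, List.mapIdx_append, List.mapIdx_cons, h₁]

theorem markLoop_eq_of_recursion {f : List (A × Bool) → List B} {F : List A → List A → List B}
    {w : List A} (h₀ : ∀ u, F u [] = [])
    (h₁ : ∀ u c v, u ++ c :: v = w →
      F u (c :: v) = f (unmarked u ++ (c, true) :: unmarked v) ++ F (u ++ [c]) v) :
    markLoop f w = F [] w := by
  suffices h : ∀ u v, u ++ v = w →
      ((List.range v.length).flatMap fun t => f (markAt w (u.length + t))) = F u v by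
    simpa [markLoop] using h [] w rfl
  intro u v hw
  induction v generalizing u with
  | nil => simp [h₀]
  | cons c v ih =>
    rw [h₁ u c v hw, ← ih (u ++ [c]) (by simpa using hw), List.length_cons,
      List.range_succ_eq_map, List.flatMap_cons, List.flatMap_map, add_zero, ← hw,
      markAt_append_cons]
    simp [add_assoc, Nat.succ_eq_add_one, add_comm 1]

/-- One step of the automaton that writes the letters between two marked places. -/
def segmentStep (s : Bool) (a : (A × Bool) × Bool) : Bool × List A :=
  (s ^^ (a.1.2 ^^ a.2), if s ^^ (a.1.2 ^^ a.2) then [a.1.1] else [])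

/-- Write the letters from the first marked place up to the second one, where each of the two rows
of marks marks one place. -/
def markedSegment : List ((A × Bool) × Bool) → List A := mealy segmentStep false

/-- Write the letters of a word if the first one is marked. -/
def keepIfHeadMarked : List (A × Bool) → List A :=
  mealy (fun s a => (some (s.getD a.2), if s.getD a.2 then [a.1] else [])) none

theorem keepIfHeadMarked_cons (a : A) (m : Bool) (w : List (A × Bool)) :
    keepIfHeadMarked ((a, m) :: w) = if m then a :: w.map Prod.fst else [] := by
  have h : ∀ w : List (A × Bool),
      mealy (fun (s : Option Bool) (a : A × Bool) =>
        (some (s.getD a.2), if s.getD a.2 then [a.1] else [])) (some m) w =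
        if m then w.map Prod.fst else [] := by
    intro w
    induction w with
    | nil => simp [mealy]
    | cons b w ih => cases m <;> simp_all [mealy]
  cases m <;> simp [keepIfHeadMarked, mealy, h]

theorem mealy_segmentStep (s : Bool) (u : List A) (w : List ((A × Bool) × Bool)) :
    mealy segmentStep s (unmarked (unmarked u) ++ w) =
      (if s then u else []) ++ mealy segmentStep s w := by
  induction u with
  | nil => simp
  | cons a u ih => cases s <;> simpa [mealy, segmentStep] using ih

theorem mealy_segmentStep_false (u : List A) :
    mealy segmentStep false (unmarked (unmarked u)) = [] := by
  simpa [mealy] using mealy_segmentStep false u []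

theorem markedSegment_same (u v : List A) (c : A) :
    markedSegment (unmarked (unmarked u) ++ ((c, true), true) :: unmarked (unmarked v)) = [] := by
  rw [markedSegment, mealy_segmentStep]
  exact mealy_segmentStep_false v

theorem markedSegment_of_ne (u v w : List A) (c d : A) (m : Bool) :
    markedSegment (unmarked (unmarked u) ++ ((c, m), !m) :: (unmarked (unmarked v) ++
      ((d, !m), m) :: unmarked (unmarked w))) = c :: v := by
  have hs : ∀ (s m : Bool) (a : A),
      segmentStep s ((a, m), !m) = (!s, if s then [] else [a]) := by
    intro s m a
    cases s <;> cases m <;> rfl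
  have hm : ((d, !m), m) = ((d, !m), !!m) := by rw [Bool.not_not]
  rw [markedSegment, mealy_segmentStep, mealy, hm, hs, mealy_segmentStep, mealy, hs]
  simp [mealy_segmentStep_false]

end Marks

/-! ### The normal form of a free product in logarithmic space -/

section

variable {ι Γ : Type*} [DecidableEq ι] [Group Γ] {K : ι → Subgroup Γ}
variable {A : Type*} {val : A → Γ} {type : A → ι}

theorem cosetLetters_unmarked (i : ι) (P Q : Γ) (u : List A) :
    cosetLetters K (val ∘ Prod.fst) (type ∘ Prod.fst) i P Q (unmarked u) =
      unmarked (cosetLetters K val type i P Q u) := by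
  induction u generalizing Q with
  | nil => rfl
  | cons c u ih =>
    simp only [unmarked_cons, cosetLetters, ih, Function.comp_apply, unmarked_append]
    split_ifs <;> rfl

theorem evalWord_unmarked (u : List A) :
    evalWord (val ∘ Prod.fst) (unmarked u) = evalWord val u := by
  simp [evalWord, unmarked, Function.comp_def]

/-- The marked letter, if it has type `i`. -/
def innerLetter (type : A → ι) (i : ι) (w : List ((A × Bool) × Bool)) : List (A × Bool) :=
  w.flatMap fun a => if a.2 = true ∧ type a.1.1 = i then [a.1] else []

theorem innerLetter_eq (i : ι) (u v : List (A × Bool)) (c : A × Bool) :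
    innerLetter type i (unmarked u ++ (c, true) :: unmarked v) =
      if type c.1 = i then [c] else [] := by
  have h : ∀ u : List (A × Bool), innerLetter type i (unmarked u) = [] := by
    intro u
    induction u with
    | nil => rfl
    | cons a u ih => simpa [innerLetter] using ih
  have hu := h u
  have hv := h v
  simp only [innerLetter] at hu hv
  simp [innerLetter, hu, hv]

/-- A test for membership of a segment in `K i` gives the letters in the coset of the marked place. -/
theorem markLoop_eq_cosetLetters {test : List A → List Bool} {i : ι}
    (htest : ∀ w, true ∈ test w ↔ evalWord val w ∈ K i) (u v : List A) (c : A) :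
    markLoop (fun w => if true ∈ test (markedSegment w) then innerLetter type i w else [])
      (unmarked u ++ (c, true) :: unmarked v) =
    cosetLetters K (val ∘ Prod.fst) (type ∘ Prod.fst) i (evalWord val u) 1
      (unmarked u ++ (c, true) :: unmarked v) := by
  rw [markLoop_eq_of_recursion (F := fun U V => cosetLetters K (val ∘ Prod.fst) (type ∘ Prod.fst) i
    (evalWord val u) (evalWord (val ∘ Prod.fst) U) V) (fun _ => rfl)]
  · rfl
  intro U C V h
  have key : true ∈ test (markedSegment (unmarked U ++ (C, true) :: unmarked V)) ↔
      (evalWord val u)⁻¹ * evalWord (val ∘ Prod.fst) U ∈ K i := by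
    rw [htest]
    rcases List.append_eq_append_iff.1 h with ⟨t, h₁, h₂⟩ | ⟨t, h₁, h₂⟩
    · rcases t with _ | ⟨C', t⟩
      · rw [List.append_nil] at h₁
        obtain ⟨rfl, rfl⟩ := List.cons_eq_cons.1 h₂
        rw [← h₁, markedSegment_same, evalWord_unmarked]
        simp
      · obtain ⟨rfl, rfl⟩ := List.cons_eq_cons.1 h₂
        obtain ⟨u₁, u₂, rfl, rfl, h₃⟩ := List.map_eq_append_iff.1 h₁
        obtain ⟨c', u₂, rfl, rfl, rfl⟩ := List.map_eq_cons_iff.1 h₃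
        have e := markedSegment_of_ne u₁ u₂ v c' c false
        simp only [unmarked, List.map_append, List.map_cons, List.append_eq,
          List.cons_append, Bool.not_false] at e ⊢
        rw [e]
        change _ ↔ _ * evalWord _ (unmarked u₁) ∈ _
        rw [evalWord_unmarked, evalWord_append, mul_inv_rev, inv_mul_cancel_right, inv_mem_iff]
    · rcases t with _ | ⟨C', t⟩
      · rw [List.append_nil] at h₁
        obtain ⟨rfl, rfl⟩ := List.cons_eq_cons.1 h₂
        rw [h₁, markedSegment_same, evalWord_unmarked]
        simp
      · obtain ⟨rfl, h₃⟩ := List.cons_eq_cons.1 h₂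
        obtain ⟨v₁, v₂, rfl, rfl, h₄⟩ := List.map_eq_append_iff.1 h₃
        obtain ⟨c', v₂, rfl, rfl, rfl⟩ := List.map_eq_cons_iff.1 h₄
        subst h₁
        have e := markedSegment_of_ne u v₁ v₂ c c' true
        simp only [unmarked, List.map_append, List.map_cons, List.append_assoc,
          List.cons_append, Bool.not_true] at e ⊢
        rw [e]
        change _ ↔ _ * evalWord _ (unmarked u ++ (c, true) :: unmarked v₁) ∈ _
        simp only [evalWord_append, evalWord_cons, evalWord_unmarked, inv_mul_cancel_left,
          Function.comp_apply]
  rw [innerLetter_eq]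
  simp only [cosetLetters, evalWord_append, evalWord_singleton, Function.comp_apply]
  by_cases h₂ : (evalWord val u)⁻¹ * evalWord (val ∘ Prod.fst) U ∈ K i
  · simp [if_pos (key.2 h₂), h₂]
  · simp [if_neg (mt key.1 h₂), h₂]


/-- The letters in the coset of the marked place, if the marked place is the first of them. -/
theorem keepIfHeadMarked_cosetLetters (i : ι) (u v : List A) (c : A) (hK : val c ∈ K (type c))
    (hc : type c = i) :
    keepIfHeadMarked (cosetLetters K (val ∘ Prod.fst) (type ∘ Prod.fst) i (evalWord val u) 1
      (unmarked u ++ (c, true) :: unmarked v)) =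
    if cosetLetters K val type i (evalWord val u) 1 u = [] then
      c :: cosetLetters K val type i 1 1 v else [] := by
  have hv : cosetLetters K val type i (evalWord val u) (evalWord val u * val c) v =
      cosetLetters K val type i 1 1 v :=
    cosetLetters_congr (by simpa [← hc] using hK) v
  rw [cosetLetters_append, cosetLetters_unmarked, evalWord_unmarked, one_mul, cosetLetters,
    if_pos ⟨hc, by simp⟩, Function.comp_apply, cosetLetters_unmarked, hv]
  have hfst : ∀ w : List A, (unmarked w).map Prod.fst = w := fun w => by
    simp [unmarked, Function.comp_def]
  rcases cosetLetters K val type i (evalWord val u) 1 u with _ | ⟨d, w⟩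
  · simp [keepIfHeadMarked_cons, hfst]
  · simp [keepIfHeadMarked_cons]

end

section

open Monoid

variable {G H : Type*} [Group G] [Group H]

/-- The retraction of a free product onto one of its factors. -/
def factorRetraction : Bool → (Coprod G H →* Coprod G H)
  | false => Coprod.inl.comp Coprod.fst
  | true => Coprod.inr.comp Coprod.snd

theorem mem_freeFactor_iff {i : Bool} {a : Coprod G H} :
    a ∈ freeFactor G H i ↔ factorRetraction i a = a := by
  cases i
  · refine ⟨?_, fun h => ⟨_, h⟩⟩
    rintro ⟨a, rfl⟩
    simp [factorRetraction]
  · refine ⟨?_, fun h => ⟨_, h⟩⟩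
    rintro ⟨a, rfl⟩
    simp [factorRetraction]

theorem evalWord_flatMap {A C Γ : Type*} [Group Γ] {val : A → Γ} {z : C → Γ} {s : A → List C}
    (hs : ∀ a, evalWord z (s a) = val a) (w : List A) :
    evalWord z (w.flatMap s) = evalWord val w := by
  induction w with
  | nil => rfl
  | cons a w ih => rw [List.flatMap_cons, evalWord_append, hs, ih, evalWord_cons]

theorem evalWord_reverse_flatMap {A C Γ : Type*} [Group Γ] {val : A → Γ} {z : C → Γ}
    {s : A → List C} (hs : ∀ a, evalWord z (s a) = (val a)⁻¹) (w : List A) :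
    evalWord z (w.reverse.flatMap s) = (evalWord val w)⁻¹ := by
  induction w with
  | nil => simp
  | cons a w ih =>
    rw [List.reverse_cons, List.flatMap_append, evalWord_append, ih, evalWord_cons, mul_inv_rev,
      List.flatMap_singleton, hs]

theorem logspaceComputable_nil {A B : Type*} [Finite A] [Finite B] :
    LogspaceComputable fun _ : List A => ([] : List B) := by
  have h : ∀ w : List A, w.flatMap (fun _ => ([] : List B)) = [] := fun w => by simp
  simpa only [h] using logspaceComputable_flatMap fun _ : A => ([] : List B)

theorem true_mem_wordProblem {C Γ : Type*} [Group Γ] (z : C → Γ) (w : List C) :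
    true ∈ wordProblem z w ↔ evalWord z w = 1 := by
  simp [wordProblem]

/-- Membership in one of the factors of a free product is decidable in logarithmic space. -/
theorem exists_logspace_membership {A : Type*} [Finite A] (val : A → Coprod G H)
    (hwp : HasLogspaceWordProblem (Coprod G H)) (i : Bool) :
    ∃ test : List A → List Bool, LogspaceComputable test ∧
      ∀ w, true ∈ test w ↔ evalWord val w ∈ freeFactor G H i := by
  obtain ⟨k, z, hz, hwp⟩ := hwp
  choose s hs using fun a => hz.surjective (val a)
  choose r hr using fun a => hz.surjective (factorRetraction i (val a))⁻¹
  refine ⟨_, hwp.comp (logspaceComputable_mealy_append (fun (_ : Unit) a => ((), s a)) () r),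
    fun w => ?_⟩
  rw [Function.comp_apply, true_mem_wordProblem, mealy_unit, evalWord_append,
    evalWord_flatMap hs,
    evalWord_reverse_flatMap (val := fun a => factorRetraction i (val a)) hr, mul_inv_eq_one,
    mem_freeFactor_iff, map_evalWord, eq_comm]
  rfl

/-- The empty word can be taken as the normal form of the identity, if the group embeds in a group
with word problem decidable in logarithmic space. -/
theorem logspaceComputable_emptyAtIdentity {X G Γ : Type*} [Group G] [Group Γ] {x : X → G}
    {g : List X → List X} (hg : IsLogspaceNormalFormFunction x g)
    (hwp : HasLogspaceWordProblem Γ) {φ : G →* Γ} (hφ : Function.Injective φ) :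
    LogspaceComputable (emptyAtIdentity x g) := by
  have := hg.generating.finite
  obtain ⟨k, z, hz, hwp⟩ := hwp
  choose s hs using fun a => hz.surjective (φ (x a))
  have h := (hwp.comp (logspaceComputable_flatMap s)).ite logspaceComputable_nil hg.logspace
  refine cast (congrArg _ (funext fun w => ?_)) h
  have hw : true ∈ wordProblem z (w.flatMap s) ↔ evalWord x w = 1 := by
    rw [true_mem_wordProblem, evalWord_flatMap hs, ← map_eq_one_iff φ hφ, map_evalWord]
    rfl
  by_cases h1 : evalWord x w = 1
  · exact (if_pos (hw.2 h1)).trans (if_pos h1).symm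
  · exact (if_neg (mt hw.1 h1)).trans (if_neg h1).symm

variable {X Y : Type*} {x : X → G} {y : Y → H} {g : List X → List X} {h : List Y → List Y}

/-- The word for the value of a word over the letters of one factor is computable in logarithmic
space. -/
theorem logspaceComputable_factorWord (hg : IsLogspaceNormalFormFunction x g)
    (hh : IsLogspaceNormalFormFunction y h) (hwp : HasLogspaceWordProblem (Coprod G H))
    (i : Bool) : LogspaceComputable fun w =>
      factorWord x y g h i (evalWord (freeProductGen x y) w) := by
  have := hg.generating.finite
  have := hh.generating.finite
  cases i
  · have h := (logspaceComputable_flatMap fun a : X => [(Sum.inl a : X ⊕ Y)]).comp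
      ((logspaceComputable_emptyAtIdentity hg hwp Coprod.inl_injective).comp
        (logspaceComputable_flatMap fun c : X ⊕ Y => c.getLeft?.toList))
    refine cast (congrArg _ (funext fun w => ?_)) h
    simp only [factorWord, fst_evalWord, elementWord_evalWord hg, Function.comp_apply,
      List.filterMap_eq_flatMap_toList, ← List.map_eq_flatMap]
  · have h := (logspaceComputable_flatMap fun a : Y => [(Sum.inr a : X ⊕ Y)]).comp
      ((logspaceComputable_emptyAtIdentity hh hwp Coprod.inr_injective).comp
        (logspaceComputable_flatMap fun c : X ⊕ Y => c.getRight?.toList))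
    refine cast (congrArg _ (funext fun w => ?_)) h
    simp only [factorWord, snd_evalWord, elementWord_evalWord hh, Function.comp_apply,
      List.filterMap_eq_flatMap_toList, ← List.map_eq_flatMap]

theorem logspaceComputable_coprodNormalForm (hg : IsLogspaceNormalFormFunction x g)
    (hh : IsLogspaceNormalFormFunction y h) (hwp : HasLogspaceWordProblem (Coprod G H)) :
    LogspaceComputable (coprodNormalForm x y g h) := by
  have := hg.generating.finite
  have := hh.generating.finite
  choose test htest hmem using exists_logspace_membership (freeProductGen x y) hwp
  have hφ : ∀ i : Bool, LogspaceComputable ((fun w => factorWord x y g h i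
      (evalWord (freeProductGen x y) w)) ∘ keepIfHeadMarked ∘ markLoop fun w =>
        if true ∈ test i (markedSegment w) then innerLetter Sum.isRight i w else []) := fun i =>
    (logspaceComputable_factorWord hg hh hwp i).comp ((logspaceComputable_mealy _ _).comp
      (((htest i).comp (logspaceComputable_mealy _ _)).ite (logspaceComputable_flatMap _)
        logspaceComputable_nil).markLoop)
  have ht : LogspaceComputable fun w : List ((X ⊕ Y) × Bool) =>
      w.flatMap fun a => if a.2 = true then [a.1.isRight] else [] := logspaceComputable_flatMap _
  refine cast (congrArg _ (funext fun w => ?_)) ((ht.ite (hφ true) (hφ false)).markLoop)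
  rw [coprodNormalForm, ← wordOutput_nil isReducedForm_coprodForm freeProductGen_mem
    (factorWord_one hg hh)]
  refine markLoop_eq_of_recursion (fun _ => rfl) fun u c v _ => ?_
  have hc : true ∈ ((unmarked u ++ (c, true) :: unmarked v).flatMap fun a =>
      if a.2 = true then [a.1.isRight] else []) ↔ c.isRight = true := by
    simp [unmarked]
  have hi : ∀ i, c.isRight = i →
      factorWord x y g h i (evalWord (freeProductGen x y) (keepIfHeadMarked
        (markLoop (fun w => if true ∈ test i (markedSegment w) then innerLetter Sum.isRight i w
          else []) (unmarked u ++ (c, true) :: unmarked v)))) =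
      if cosetLetters (freeFactor G H) (freeProductGen x y) Sum.isRight i
        (evalWord (freeProductGen x y) u) 1 u = [] then
        factorWord x y g h i (evalWord (freeProductGen x y) (c ::
          cosetLetters (freeFactor G H) (freeProductGen x y) Sum.isRight i 1 1 v)) else [] := by
    intro i hi
    rw [markLoop_eq_cosetLetters (hmem i),
      keepIfHeadMarked_cosetLetters i u v c (freeProductGen_mem c) hi]
    split_ifs
    · rfl
    · exact factorWord_one hg hh i
  rw [wordOutput]
  congr 1
  by_cases hc' : c.isRight = true
  · rw [if_pos (hc.2 hc')]
    rw [hc']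
    refine Eq.trans ?_ (hi true hc').symm
    split_ifs <;> rfl
  · rw [if_neg (mt hc.1 hc')]
    rw [Bool.not_eq_true] at hc'
    rw [hc']
    refine Eq.trans ?_ (hi false hc').symm
    split_ifs <;> rfl

end

theorem mainTheorem4 {G H X Y : Type*} [Group G] [Group H] (x : X → G) (y : Y → H)
    (g : List X → List X) (h : List Y → List Y)
    (hg : IsLogspaceNormalFormFunction x g) (hh : IsLogspaceNormalFormFunction y h)
    (hwp : HasLogspaceWordProblem (Monoid.Coprod G H)) :
    ∃ f : List (X ⊕ Y) → List (X ⊕ Y),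
      IsLogspaceNormalFormFunction (freeProductGen x y) f ∧
      IsPeelingFunction x y (emptyAtIdentity x g) (emptyAtIdentity y h) f :=
  ⟨coprodNormalForm x y g h,
    { generating := isFiniteSymmetricGenerating_freeProductGen hg.generating hh.generating
      logspace := logspaceComputable_coprodNormalForm hg hh hwp
      normalForm := ⟨_, isNormalForm_coprodNormalForm hg hh, fun w =>
        ⟨⟨w, rfl⟩, evalWord_coprodNormalForm hg hh w⟩⟩ },
    isPeelingFunction_coprodNormalForm hg hh⟩
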